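/- **Setting.** Let $N\ge 2$ be an integer and $0<r,t_*<\infty$. For $\Im\tau>0$ put $$\vartheta_0(v;\tau)=\sum_{n\in\mathbb Z}(-1)^n e^{\pi i\tau n^2}e^{2\pi i n v},\qquad \vartheta_1(v;\tau)=i\sum_{n\in\mathbb Z}(-1)^n e^{\pi i\tau(n-1/2)^2}e^{\pi i(2n-1)v},\qquad \eta(\tau)=e^{\pi i\tau/12}\prod_{n\ge1}(1-e^{2\pi i n\tau}).$$ Let $R$ be one of $A_{N-1},B_N,B_N^\vee,C_N,C_N^\vee,BC_N,D_N$, and put - $\mathcal N^R=N,\ 2N-1,\ 2N,\ 2(N+1),\ 2N,\ 2N+1,\ 2(N-1)$, respectively; - $J^R(j)=j-1$ for $A_{N-1},B_N,B_N^\vee,D_N$; $J^R(j)=j$ for $C_N,BC_N$; $J^R(j)=j-\frac12$ for $C_N^\vee$; - $\tau^R(t)=\dfrac{i\mathcal N^R(t_*-t)}{2\pi r^2}$. With $g^{R,\alpha}_j(z;\tau)=e^{iJ^R(j)z/r}\,\vartheta_1\!\Big(J^R(j)\tau+\frac{\mathcal N^R z}{2\pi r}+\alpha;\mathcal N^R\tau\Big)$,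 define for $j\in\mathbb Z$ $$f_j^R(z;\tau)=\begin{cases} g_j^{R,\alpha}(z;\tau),\ \alpha=\frac{1-(-1)^N}{4}, & R=A_{N-1},\\ g_j^{R,0}(z;\tau)-g_j^{R,0}(-z;\tau), & R=B_N,B_N^\vee,\\ g_j^{R,1/2}(z;\tau)-g_j^{R,1/2}(-z;\tau), & R=C_N,C_N^\vee,BC_N,\\ g_j^{R,1/2}(z;\tau)+g_j^{R,1/2}(-z;\tau), & R=D_N.\end{cases}$$ For $u=(u_1,\dots,u_N)\in\mathbb R^N$ with $u_1<\dots<u_N$ put $\Delta^R(u)=\det_{1\le \ell,m\le N}[f^R_\ell(u_m;\tau^R(0))]$ and, if $\Delta^R(u)\ne0$, $$\Phi^R_{u,u_j}(z)=\frac{\det_{1\le\ell,m\le N}[f^R_\ell(u_m+(z-u_m)\delta_{mj};\tau^R(0))]}{\Delta^R(u)},\qquad M^R_{u,u_j}(t,x)=\mathbb E\big[\Phi^R_{u,u_j}(x+iY_t)\big],\quad Y_t\sim\mathcal N(0,t),$$ where $Y_0=0$. For $x=(x_1,\dots,x_N)\in\mathbb R^N$, the determinantal martingale-function is $D^R_u(t,x)=\det_{1\le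 j,k\le N}[M^R_{u,u_j}(t,x_k)]$. Define further - $c_0^{A_{N-1}}=\eta(\tau)^{-(N-1)(N-2)/2}$, $c_0^{B_N}=c_0^{C_N}=\eta(\tau)^{-N(N-1)}$, $c_0^{B_N^\vee}=\eta(\tau)^{-(N-1)^2}\eta(2\tau)^{-(N-1)}$, $c_0^{C_N^\vee}=\eta(\tau)^{-(N-1)^2}\eta(\tau/2)^{-(N-1)}$, $c_0^{BC_N}=\eta(\tau)^{-N(N-1)}\eta(2\tau)^{-N}$, $c_0^{D_N}=\eta(\tau)^{-N(N-2)}$; - $k_{\rm sym}^{A_{N-1}}(x;\tau)=\vartheta_1\big(\frac{\sum_j x_j-\kappa_N}{2\pi r};\tau\big)$ with $\kappa_N=\pi r(N-1)$ for $N$ even, $\pi r(N-2)$ for $N$ odd; $k^R_{\rm sym}=1$ for the other $R$; - $k_1^{A_{N-1}}=k_1^{D_N}=1$, $k_1^{B_N}(x;\tau)=\vartheta_1(\frac{x}{2\pi r};\tau)$, $k_1^{B_N^\vee}(x;\tau)=\vartheta_1(\frac{x}{\pi r};2\tau)$, $k_1^{C_N}(x;\tau)=\vartheta_1(\frac{x}{\pi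 r};\tau)$, $k_1^{C_N^\vee}(x;\tau)=\vartheta_1(\frac{x}{2\pi r};\frac{\tau}{2})$, $k_1^{BC_N}(x;\tau)=\vartheta_1(\frac{x}{2\pi r};\tau)\vartheta_0(\frac{x}{\pi r};2\tau)$; - $k_2^{A_{N-1}}(x,y;\tau)=\vartheta_1(\frac{x-y}{2\pi r};\tau)$ and $k_2^R(x,y;\tau)=\vartheta_1(\frac{x-y}{2\pi r};\tau)\vartheta_1(\frac{x+y}{2\pi r};\tau)$ for the other $R$. **Statement.** (i) For each $R$ and each $u$ with $u_1<\dots<u_N$: $c_0^R(\tau^R(0))\neq0$, and $\Delta^R(u)\ne0$ if and only if $k^R_{\rm sym}(u;\tau^R(0))$, all $k_1^R(u_\ell;\tau^R(0))$ and all $k_2^R(u_k,u_j;\tau^R(0))$, $j<k$, are nonzero. If $R\ne A_{N-1}$ and $0<u_1<\dots<u_N<\pi r$, then $\Delta^R(u)\neq0$. (ii) For each $R$, each $u$ with $u_1<\dots<u_N$ and $\Delta^R(u)\ne0$, all $t\in[0,t_*)$ and all $x\in\mathbb R^N$, the expectations $M^R_{u,u_j}(t,x_k)$ converge absolutely, and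 $$D^R_u(t,x)=\frac{c_0^R(\tau^R(t))}{c_0^R(\tau^R(0))}\,\frac{k^R_{\rm sym}(x;\tau^R(t))}{k^R_{\rm sym}(u;\tau^R(0))}\prod_{\ell=1}^N\frac{k_1^R(x_\ell;\tau^R(t))}{k_1^R(u_\ell;\tau^R(0))}\prod_{1\le j<k\le N}\frac{k_2^R(x_k,x_j;\tau^R(t))}{k_2^R(u_k,u_j;\tau^R(0))}.$$ (iii) In particular, under the assumptions of (ii), put $$P^R=\prod_{j<k}\frac{\vartheta_1(\frac{x_k-x_j}{2\pi r};\tau^R(t))}{\vartheta_1(\frac{u_k-u_j}{2\pi r};\tau^R(0))}\,\frac{\vartheta_1(\frac{x_k+x_j}{2\pi r};\tau^R(t))}{\vartheta_1(\frac{u_k+u_j}{2\pi r};\tau^R(0))}.$$ Then, with $c_1^{B_N}=c_1^{C_N^\vee}=1$, $c_1^{B_N^\vee}=c_1^{C_N}=2$, $c_2^{B_N}=c_2^{C_N}=1$, $c_2^{B_N^\vee}=2$, $c_2^{C_N^\vee}=\frac12$, $$D^R_u(t,x)=\frac{c_0^R(\tau^R(t))}{c_0^R(\tau^R(0))}\prod_{\ell=1}^N\frac{\vartheta_1(c_1^Rx_\ell/2\pi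 r;c_2^R\tau^R(t))}{\vartheta_1(c_1^Ru_\ell/2\pi r;c_2^R\tau^R(0))}\;P^R\quad\text{for }R=B_N,B_N^\vee,C_N,C_N^\vee,$$ $$D^{R}_u(t,x)=\frac{c_0^{R}(\tau^{R}(t))}{c_0^{R}(\tau^{R}(0))}\prod_{\ell=1}^N\frac{\vartheta_1(x_\ell/2\pi r;\tau^{R}(t))}{\vartheta_1(u_\ell/2\pi r;\tau^{R}(0))}\frac{\vartheta_0(x_\ell/\pi r;2\tau^{R}(t))}{\vartheta_0(u_\ell/\pi r;2\tau^{R}(0))}\;P^{R}\quad\text{for }R=BC_N,$$ $$D^{R}_u(t,x)=\frac{c_0^{R}(\tau^{R}(t))}{c_0^{R}(\tau^{R}(0))}\;P^{R}\quad\text{for }R=D_N.$$ -/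

import Mathlib

namespace EllipticDyson

/-- The Jacobi theta function `ϑ₀(v; τ) = ∑_{n ∈ ℤ} (-1)ⁿ q^{n²} z^{2n}` with `z = e^{πiv}`,
`q = e^{πiτ}`, for `Im τ > 0`. -/
noncomputable def theta0 (v τ : ℂ) : ℂ :=
  ∑' n : ℤ, (-1 : ℂ) ^ n * Complex.exp (Real.pi * Complex.I * τ * (n : ℂ) ^ 2)
    * Complex.exp (Real.pi * Complex.I * v * (2 * (n : ℂ)))

/-- The Jacobi theta function `ϑ₁(v; τ) = i ∑_{n ∈ ℤ} (-1)ⁿ q^{(n-1/2)²} z^{2n-1}` with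
`z = e^{πiv}`, `q = e^{πiτ}`, for `Im τ > 0`. -/
noncomputable def theta1 (v τ : ℂ) : ℂ :=
  Complex.I * ∑' n : ℤ, (-1 : ℂ) ^ n
    * Complex.exp (Real.pi * Complex.I * τ * ((n : ℂ) - 1 / 2) ^ 2)
    * Complex.exp (Real.pi * Complex.I * v * (2 * (n : ℂ) - 1))

/-- The seven families of irreducible reduced affine root systems
`A_{N-1}, B_N, B_N^∨, C_N, C_N^∨, BC_N, D_N`. -/
inductive RootFamily where
  | A | B | Bv | C | Cv | BC | D
  deriving DecidableEq

/-- The number `𝒩^R`. -/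
def calN (R : RootFamily) (N : ℕ) : ℝ :=
  match R with
  | .A => (N : ℝ)
  | .B => 2 * (N : ℝ) - 1
  | .Bv | .Cv => 2 * (N : ℝ)
  | .C => 2 * ((N : ℝ) + 1)
  | .BC => 2 * (N : ℝ) + 1
  | .D => 2 * ((N : ℝ) - 1)

/-- The (half-)integer `J^R(j)`. -/
noncomputable def J (R : RootFamily) (j : ℤ) : ℝ :=
  match R with
  | .A | .B | .Bv | .D => (j : ℝ) - 1
  | .C | .BC => (j : ℝ)
  | .Cv => (j : ℝ) - 1 / 2

/-- The time-dependent modulus `τ^R(t) = i 𝒩^R (t_* - t) / (2 π r²)`. -/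
noncomputable def tau (R : RootFamily) (N : ℕ) (r tstar t : ℝ) : ℂ :=
  Complex.I * (calN R N : ℂ) * ((tstar : ℂ) - (t : ℂ)) / (2 * (Real.pi : ℂ) * (r : ℂ) ^ 2)

/-- The elementary building block `e^{i J z / r} ϑ₁(J τ + n z / (2 π r) + α; n τ)`. -/
noncomputable def thetaWave (J n r : ℝ) (α τ z : ℂ) : ℂ :=
  Complex.exp (Complex.I * (J : ℂ) * z / (r : ℂ))
    * theta1 ((J : ℂ) * τ + (n : ℂ) * z / (2 * (Real.pi : ℂ) * (r : ℂ)) + α) ((n : ℂ) * τ)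

/-- The entire function `f^R_j(z; τ)`. The replacement of `(i J z / r, n z / 2πr)` by its negative
in the second terms is the replacement of `z` by `-z`. -/
noncomputable def f (R : RootFamily) (N : ℕ) (r : ℝ) (j : ℤ) (z τ : ℂ) : ℂ :=
  match R with
  | .A => thetaWave (J .A j) (calN .A N) r ((1 - (-1 : ℂ) ^ N) / 4) τ z
  | .B => thetaWave (J .B j) (calN .B N) r 0 τ z
      - thetaWave (J .B j) (calN .B N) r 0 τ (-z)
  | .Bv => thetaWave (J .Bv j) (calN .Bv N) r 0 τ z
      - thetaWave (J .Bv j) (calN .Bv N) r 0 τ (-z)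
  | .C => thetaWave (J .C j) (calN .C N) r (1 / 2) τ z
      - thetaWave (J .C j) (calN .C N) r (1 / 2) τ (-z)
  | .Cv => thetaWave (J .Cv j) (calN .Cv N) r (1 / 2) τ z
      - thetaWave (J .Cv j) (calN .Cv N) r (1 / 2) τ (-z)
  | .BC => thetaWave (J .BC j) (calN .BC N) r (1 / 2) τ z
      - thetaWave (J .BC j) (calN .BC N) r (1 / 2) τ (-z)
  | .D => thetaWave (J .D j) (calN .D N) r (1 / 2) τ z
      + thetaWave (J .D j) (calN .D N) r (1 / 2) τ (-z)

/-- The matrix `(F_ℓ(z_m))_{1 ≤ ℓ, m ≤ N}` of a sequence of functions `F_j`, `j ∈ ℤ`; the index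
`ℓ ∈ {1, …, N}` is written as `ℓ + 1` with `ℓ : Fin N`. -/
def fMatrix {N : ℕ} (F : ℤ → ℂ → ℂ) (z : Fin N → ℂ) : Matrix (Fin N) (Fin N) ℂ :=
  Matrix.of fun l m => F ((l : ℤ) + 1) (z m)

/-- `Φ_{u,u_j}(z) = det[F_ℓ(u_m + (z - u_m) δ_{mj})] / det[F_ℓ(u_m)]`: in the numerator the
`j`-th point `u_j` is replaced by `z`. -/
noncomputable def Phi {N : ℕ} (F : ℤ → ℂ → ℂ) (u : Fin N → ℝ) (j : Fin N) (z : ℂ) : ℂ :=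
  (fMatrix F (Function.update (fun m => (u m : ℂ)) j z)).det
    / (fMatrix F (fun m => (u m : ℂ))).det

/-- `M_{u,u_j}(t, x) = Ẽ[Φ_{u,u_j}(x + i B̃(t))]`, where `B̃(t)` is centred Gaussian with variance
`t ≥ 0` (the point mass at `0` for `t = 0`). -/
noncomputable def M {N : ℕ} (F : ℤ → ℂ → ℂ) (u : Fin N → ℝ) (j : Fin N) (t x : ℝ) : ℂ :=
  ∫ y : ℝ, Phi F u j ((x : ℂ) + Complex.I * (y : ℂ))
    ∂(ProbabilityTheory.gaussianReal 0 t.toNNReal)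

/-- The determinantal martingale-function `D_u(t, x) = det_{j,k}[M_{u,u_j}(t, x_k)]`. -/
noncomputable def detMart {N : ℕ} (F : ℤ → ℂ → ℂ) (u : Fin N → ℝ) (t : ℝ) (x : Fin N → ℝ) : ℂ :=
  (Matrix.of fun j k : Fin N => M F u j t (x k)).det

/-- The functions `f^R_j(·; τ^R(0))`, `j ∈ ℤ`. -/
noncomputable def f0 (R : RootFamily) (N : ℕ) (r tstar : ℝ) (j : ℤ) (z : ℂ) : ℂ :=
  f R N r j z (tau R N r tstar 0)

/-- The determinantal martingale-function `D^R_u(t, x)` associated with the `f^R_j`. -/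
noncomputable def DR (R : RootFamily) {N : ℕ} (r tstar : ℝ) (u : Fin N → ℝ) (t : ℝ)
    (x : Fin N → ℝ) : ℂ :=
  detMart (f0 R N r tstar) u t x

/-- The Weyl chamber `x_1 < x_2 < ⋯ < x_N`. -/
def weylChamber (N : ℕ) : Set (Fin N → ℝ) := {x | StrictMono x}

/-- The bounded chamber `0 < x_1 < x_2 < ⋯ < x_N < π r`. -/
def weylAlcove (N : ℕ) (r : ℝ) : Set (Fin N → ℝ) :=
  {x | StrictMono x ∧ ∀ i, 0 < x i ∧ x i < Real.pi * r}

/-- The number `κ_N`. -/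
noncomputable def kappa (N : ℕ) (r : ℝ) : ℝ :=
  if Even N then Real.pi * r * ((N : ℝ) - 1) else Real.pi * r * ((N : ℝ) - 2)

/-- The eta prefactor `c^R_0(τ)`; the exponent for `A` is an exact integer quotient. -/
noncomputable def c0 (R : RootFamily) (N : ℕ) (τ : ℂ) : ℂ :=
  match R with
  | .A => ModularForm.eta τ ^ (-((((N : ℤ) - 1) * ((N : ℤ) - 2)) / 2))
  | .B | .C => ModularForm.eta τ ^ (-((N : ℤ) * ((N : ℤ) - 1)))
  | .Bv => ModularForm.eta τ ^ (-((N : ℤ) - 1) ^ 2) * ModularForm.eta (2 * τ) ^ (-((N : ℤ) - 1))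
  | .Cv => ModularForm.eta τ ^ (-((N : ℤ) - 1) ^ 2) * ModularForm.eta (τ / 2) ^ (-((N : ℤ) - 1))
  | .BC => ModularForm.eta τ ^ (-((N : ℤ) * ((N : ℤ) - 1))) * ModularForm.eta (2 * τ) ^ (-(N : ℤ))
  | .D => ModularForm.eta τ ^ (-((N : ℤ) * ((N : ℤ) - 2)))

/-- The symmetric factor `k^R_sym(x; τ)`. -/
noncomputable def kSym (R : RootFamily) {N : ℕ} (r : ℝ) (x : Fin N → ℝ) (τ : ℂ) : ℂ :=
  match R with
  | .A => theta1 (((∑ j, x j - kappa N r) / (2 * Real.pi * r) : ℝ) : ℂ) τ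
  | _ => 1

/-- The one-variable factor `k^R_1(x; τ)`. -/
noncomputable def k1 (R : RootFamily) (r x : ℝ) (τ : ℂ) : ℂ :=
  match R with
  | .A | .D => 1
  | .B => theta1 ((x / (2 * Real.pi * r) : ℝ) : ℂ) τ
  | .Bv => theta1 ((x / (Real.pi * r) : ℝ) : ℂ) (2 * τ)
  | .C => theta1 ((x / (Real.pi * r) : ℝ) : ℂ) τ
  | .Cv => theta1 ((x / (2 * Real.pi * r) : ℝ) : ℂ) (τ / 2)
  | .BC => theta1 ((x / (2 * Real.pi * r) : ℝ) : ℂ) τ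
      * theta0 ((x / (Real.pi * r) : ℝ) : ℂ) (2 * τ)

/-- The two-variable factor `k^R_2(x, y; τ)`. -/
noncomputable def k2 (R : RootFamily) (r x y : ℝ) (τ : ℂ) : ℂ :=
  match R with
  | .A => theta1 (((x - y) / (2 * Real.pi * r) : ℝ) : ℂ) τ
  | _ => theta1 (((x - y) / (2 * Real.pi * r) : ℝ) : ℂ) τ
      * theta1 (((x + y) / (2 * Real.pi * r) : ℝ) : ℂ) τ

/-- The number `c^R_1`, meaningful for `B, Bv, C, Cv` only. -/
def c1 (R : RootFamily) : ℝ :=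
  match R with
  | .Bv | .C => 2
  | _ => 1

/-- The number `c^R_2`, meaningful for `B, Bv, C, Cv` only. -/
noncomputable def c2 (R : RootFamily) : ℝ :=
  match R with
  | .Bv => 2
  | .Cv => 1 / 2
  | _ => 1

/-- The common product `∏_{j<k} [ϑ₁((x_k - x_j)/2πr; τ) / ϑ₁((u_k - u_j)/2πr; τ')]
[ϑ₁((x_k + x_j)/2πr; τ) / ϑ₁((u_k + u_j)/2πr; τ')]`. -/
noncomputable def pairProd {N : ℕ} (r : ℝ) (u x : Fin N → ℝ) (τ' τ : ℂ) : ℂ :=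
  ∏ j : Fin N, ∏ k ∈ Finset.Ioi j,
    (theta1 (((x k - x j) / (2 * Real.pi * r) : ℝ) : ℂ) τ
        / theta1 (((u k - u j) / (2 * Real.pi * r) : ℝ) : ℂ) τ'
      * (theta1 (((x k + x j) / (2 * Real.pi * r) : ℝ) : ℂ) τ
        / theta1 (((u k + u j) / (2 * Real.pi * r) : ℝ) : ℂ) τ'))

end EllipticDyson

open EllipticDyson

/-!
In the variable `v = z / (2πr)` the functions `f^R_ℓ(·; τ)` are theta functions of degree
`M = 𝒩^R`: entire functions with `F (v + 1) = ε₁ F v` and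
`F (v + τ) = ε₂ e^{-πiMτ - 2πiMv} F v`, where the signs `ε₁, ε₂` depend only on the family, and,
except for the family `A`, with a parity under `v ↦ -v`. Such functions form a space of dimension
at most `N`, since the quasi-periodicity is a recursion for the Fourier coefficients
(`twistedCoeff_recursion`) and `N` of these determine all the others
(`eq_zero_of_twistedCoeff_lt`, `eq_zero_of_twistedCoeff_parity`). The product
`k_sym ∏ k₁ ∏ k₂` is alternating and lies in the same space in each variable; hence it is
proportional to `det f_ℓ(v_m)` as soon as this determinant is nonzero at one point
(`alternating_mul_det`).

The factor of proportionality as a function of `τ = is` is found at division points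
`v_m = (k₀ + m + n / 2) / M`. There the theta function in each wave no longer depends on `m`, up
to a sign, so that the determinant is a product of theta constants times a trigonometric
determinant which is nonzero by a Vandermonde argument (`det_wave_division`). On the product side
the Jacobi triple product (`tendsto_triple_product`) turns every factor into an elementary number
times the exponential of a real series, and the distribution relations of these series
(`logTheta_distribution`, `logThetaImag_distribution`) sum them over the division points. The
outcome, a quotient of values of `η`, is `c₀` (`eta_identity_A` and its companions). This is the
determinant formula `detFormula`: up to `e^{-πiτ ∑ J² / M}` and a constant independent of `τ` and
of the points, the determinant equals `c₀ k_sym ∏ k₁ ∏ k₂`.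

Finally, by Cramer's rule, `D_u(t, x)` is the determinant of the Gaussian averages of
`f_ℓ(x_k + iY)` divided by `det f_ℓ(u_m)` (`detMart_eq`). Averaging acts on the Fourier modes of
`f_ℓ` as the backward heat flow, which moves the modulus from `τ(0)` to `τ(t)` and produces a
factor `e^{t J² / 2r²}` (`integral_f0_gaussian`). These factors are the ratio of the exponentials
in the determinant formulas at `τ(t)` and at `τ(0)`, and the factorization follows by division.
-/

namespace EllipticDyson

open Complex Real Filter Topology

/-! ### Jacobi theta functions -/

theorem neg_one_zpow_eq_exp (n : ℤ) : (-1 : ℂ) ^ n = cexp (π * I * n) := by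
  rw [mul_comm, Complex.exp_int_mul, Complex.exp_pi_mul_I]

theorem theta0_eq_jacobiTheta₂ (v τ : ℂ) : theta0 v τ = jacobiTheta₂ (v + 1 / 2) τ := by
  unfold theta0 jacobiTheta₂ jacobiTheta₂_term
  refine tsum_congr fun n => ?_
  rw [neg_one_zpow_eq_exp, ← Complex.exp_add, ← Complex.exp_add]
  ring_nf

theorem theta1_eq_jacobiTheta₂ (v τ : ℂ) :
    theta1 v τ = I * cexp (π * I * τ / 4 - π * I * v) * jacobiTheta₂ (v + 1 / 2 - τ / 2) τ := by
  unfold theta1 jacobiTheta₂ jacobiTheta₂_term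
  rw [mul_assoc I, ← tsum_mul_left (a := cexp (π * I * τ / 4 - π * I * v))]
  congr 1
  refine tsum_congr fun n => ?_
  rw [neg_one_zpow_eq_exp, ← Complex.exp_add, ← Complex.exp_add, ← Complex.exp_add]
  ring_nf

theorem theta1_add_one (v τ : ℂ) : theta1 (v + 1) τ = -theta1 v τ := by
  rw [theta1_eq_jacobiTheta₂, theta1_eq_jacobiTheta₂,
    show v + 1 + 1 / 2 - τ / 2 = (v + 1 / 2 - τ / 2) + 1 by ring, jacobiTheta₂_add_left,
    show π * I * τ / 4 - π * I * (v + 1) = (π * I * τ / 4 - π * I * v) - π * I by ring,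
    Complex.exp_sub _ (π * I), Complex.exp_pi_mul_I]
  ring

theorem theta1_add_tau (v τ : ℂ) :
    theta1 (v + τ) τ = -cexp (-π * I * τ - 2 * π * I * v) * theta1 v τ := by
  rw [theta1_eq_jacobiTheta₂, theta1_eq_jacobiTheta₂,
    show v + τ + 1 / 2 - τ / 2 = (v + 1 / 2 - τ / 2) + τ by ring, jacobiTheta₂_add_left']
  have h : cexp (π * I * τ / 4 - π * I * (v + τ)) * cexp (-π * I * (τ + 2 * (v + 1 / 2 - τ / 2)))
      = -cexp (-π * I * τ - 2 * π * I * v) * cexp (π * I * τ / 4 - π * I * v) := by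
    rw [← Complex.exp_add, neg_mul (cexp _), ← Complex.exp_add, ← Complex.exp_sub_pi_mul_I]
    ring_nf
  linear_combination I * jacobiTheta₂ (v + 1 / 2 - τ / 2) τ * h

theorem theta1_neg (v τ : ℂ) : theta1 (-v) τ = -theta1 v τ := by
  rw [theta1_eq_jacobiTheta₂, theta1_eq_jacobiTheta₂, ← jacobiTheta₂_neg_left,
    show -(-v + 1 / 2 - τ / 2) = ((v + 1 / 2 - τ / 2) + τ) - 1 by ring,
    ← jacobiTheta₂_add_left, sub_add_cancel, jacobiTheta₂_add_left']
  have h : cexp (π * I * τ / 4 - π * I * (-v)) * cexp (-π * I * (τ + 2 * (v + 1 / 2 - τ / 2)))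
      = -cexp (π * I * τ / 4 - π * I * v) := by
    rw [← Complex.exp_add, ← Complex.exp_sub_pi_mul_I]
    ring_nf
  linear_combination I * jacobiTheta₂ (v + 1 / 2 - τ / 2) τ * h

theorem theta0_add_one (v τ : ℂ) : theta0 (v + 1) τ = theta0 v τ := by
  rw [theta0_eq_jacobiTheta₂, theta0_eq_jacobiTheta₂,
    show v + 1 + 1 / 2 = v + 1 / 2 + 1 by ring, jacobiTheta₂_add_left]

theorem theta0_add_tau (v τ : ℂ) :
    theta0 (v + τ) τ = -cexp (-π * I * τ - 2 * π * I * v) * theta0 v τ := by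
  rw [theta0_eq_jacobiTheta₂, theta0_eq_jacobiTheta₂,
    show v + τ + 1 / 2 = v + 1 / 2 + τ by ring, jacobiTheta₂_add_left',
    show -π * I * (τ + 2 * (v + 1 / 2)) = (-π * I * τ - 2 * π * I * v) - π * I by ring,
    Complex.exp_sub _ (π * I), Complex.exp_pi_mul_I]
  ring

theorem theta0_neg (v τ : ℂ) : theta0 (-v) τ = theta0 v τ := by
  rw [theta0_eq_jacobiTheta₂, theta0_eq_jacobiTheta₂, ← jacobiTheta₂_neg_left,
    ← jacobiTheta₂_add_left]
  ring_nf

theorem differentiable_theta1 {τ : ℂ} (hτ : 0 < τ.im) : Differentiable ℂ fun v => theta1 v τ := by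
  simp_rw [theta1_eq_jacobiTheta₂]
  intro v
  have h := (differentiableAt_jacobiTheta₂_fst (v + 1 / 2 - τ / 2) hτ).comp v
    (f := fun v => v + 1 / 2 - τ / 2) (by fun_prop)
  exact DifferentiableAt.mul (by fun_prop) h

theorem differentiable_theta0 {τ : ℂ} (hτ : 0 < τ.im) : Differentiable ℂ fun v => theta0 v τ := by
  simp_rw [theta0_eq_jacobiTheta₂]
  intro v
  exact (differentiableAt_jacobiTheta₂_fst (v + 1 / 2) hτ).comp v
    (f := fun v => v + 1 / 2) (by fun_prop)

theorem theta1_add_nat (v τ : ℂ) (n : ℕ) : theta1 (v + n) τ = (-1) ^ n * theta1 v τ := by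
  induction n with
  | zero => simp
  | succ n ih => rw [Nat.cast_succ, ← add_assoc, theta1_add_one, ih, pow_succ]; ring

/-! ### Spaces of theta functions of given degree and multipliers -/

/-- The space of entire functions `F` with `F (v + 1) = ε₁ F v` and
`F (v + τ) = ε₂ e^{-πiMτ - 2πiMv} F v`: the theta functions of degree `M` with multipliers
`ε₁`, `ε₂`. -/
def thetaSpace (M : ℕ) (ε₁ ε₂ τ : ℂ) : Submodule ℂ (ℂ → ℂ) where
  carrier := {F | Differentiable ℂ F ∧ (∀ v, F (v + 1) = ε₁ * F v) ∧
    ∀ v, F (v + τ) = ε₂ * cexp (-π * I * M * τ - 2 * π * I * M * v) * F v}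
  zero_mem' := ⟨differentiable_const 0, by simp, by simp⟩
  add_mem' := by
    rintro F G ⟨hF, hF1, hF2⟩ ⟨hG, hG1, hG2⟩
    refine ⟨hF.add hG, fun v => ?_, fun v => ?_⟩
    · simp only [Pi.add_apply, hF1, hG1]; ring
    · simp only [Pi.add_apply, hF2, hG2]; ring
  smul_mem' := by
    rintro c F ⟨hF, hF1, hF2⟩
    refine ⟨hF.const_smul c, fun v => ?_, fun v => ?_⟩
    · simp only [Pi.smul_apply, smul_eq_mul, hF1]; ring
    · simp only [Pi.smul_apply, smul_eq_mul, hF2]; ring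

theorem mul_mem_thetaSpace {M M' : ℕ} {ε₁ ε₂ ε₁' ε₂' τ : ℂ} {F G : ℂ → ℂ}
    (hF : F ∈ thetaSpace M ε₁ ε₂ τ) (hG : G ∈ thetaSpace M' ε₁' ε₂' τ) :
    (fun v => F v * G v) ∈ thetaSpace (M + M') (ε₁ * ε₁') (ε₂ * ε₂') τ := by
  obtain ⟨hF, hF1, hF2⟩ := hF
  obtain ⟨hG, hG1, hG2⟩ := hG
  refine ⟨hF.mul hG, fun v => ?_, fun v => ?_⟩
  · simp only [hF1, hG1]; ring
  · have h : cexp (-π * I * (M + M' : ℕ) * τ - 2 * π * I * (M + M' : ℕ) * v)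
        = cexp (-π * I * M * τ - 2 * π * I * M * v)
          * cexp (-π * I * M' * τ - 2 * π * I * M' * v) := by
      rw [← Complex.exp_add]; push_cast; ring_nf
    simp only [hF2, hG2, h]; ring

theorem const_mem_thetaSpace (c τ : ℂ) : (fun _ => c) ∈ thetaSpace 0 1 1 τ :=
  ⟨differentiable_const c, by simp, by simp⟩

theorem prod_mem_thetaSpace {ι : Type*} (s : Finset ι) {M : ℕ} {ε₁ ε₂ τ : ℂ} {F : ι → ℂ → ℂ}
    (hF : ∀ i ∈ s, F i ∈ thetaSpace M ε₁ ε₂ τ) :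
    (fun v => ∏ i ∈ s, F i v) ∈ thetaSpace (s.card * M) (ε₁ ^ s.card) (ε₂ ^ s.card) τ := by
  classical
  induction s using Finset.induction_on with
  | empty => simpa using const_mem_thetaSpace 1 τ
  | insert a s ha ih =>
    have h := mul_mem_thetaSpace (hF a (Finset.mem_insert_self a s))
      (ih fun i hi => hF i (Finset.mem_insert_of_mem hi))
    simp only [Finset.prod_insert ha, Finset.card_insert_of_notMem ha]
    rwa [pow_succ', pow_succ', add_mul, one_mul, add_comm (s.card * M)]

/-- The Fourier coefficient `∫₀¹ F(x) e^{-2πiex} dx` at a possibly non-integral frequency `e`. -/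
noncomputable def twistedCoeff (e : ℂ) (F : ℂ → ℂ) : ℂ :=
  ∫ x in (0 : ℝ)..1, F x * cexp (-(2 * π * I * e * x))

section

variable {M : ℕ} {ε₁ ε₂ e : ℂ} {s : ℝ} {F : ℂ → ℂ}

theorem periodic_twist (hF : ∀ v, F (v + 1) = ε₁ * F v) (he : cexp (2 * π * I * e) = ε₁) (v : ℂ) :
    F (v + 1) * cexp (-(2 * π * I * e * (v + 1))) = F v * cexp (-(2 * π * I * e * v)) := by
  rw [hF, ← he, mul_add, neg_add, Complex.exp_add, mul_one, Complex.exp_neg (2 * π * I * e)]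
  field_simp [Complex.exp_ne_zero]

/-- Moving the contour of integration up by the period `τ = is` turns the quasi-periodicity of a
theta function into a recursion for its Fourier coefficients. -/
theorem twistedCoeff_recursion (hF : F ∈ thetaSpace M ε₁ ε₂ (I * s))
    (he : cexp (2 * π * I * e) = ε₁) :
    twistedCoeff e F = ε₂ * cexp (-π * I * M * (I * s) - 2 * π * I * e * (I * s))
      * twistedCoeff (e + M) F := by
  obtain ⟨hd, h1, h2⟩ := hF
  have hG : Differentiable ℂ fun v => F v * cexp (-(2 * π * I * e * v)) := by fun_prop
  have hrect := Complex.integral_boundary_rect_eq_zero_of_differentiableOn _ 0 (1 + I * s)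
    hG.differentiableOn
  have hper : ∀ y : ℝ, F ((1 : ℝ) + y * I) * cexp (-(2 * π * I * e * ((1 : ℝ) + y * I)))
      = F ((0 : ℝ) + y * I) * cexp (-(2 * π * I * e * ((0 : ℝ) + y * I))) := by
    intro y
    have := periodic_twist h1 he (y * I)
    simpa [add_comm] using this
  have hre : (1 + I * (s : ℂ)).re = 1 := by simp
  have him : (1 + I * (s : ℂ)).im = s := by simp
  rw [hre, him] at hrect
  simp only [Complex.zero_re, Complex.zero_im] at hrect
  simp_rw [hper] at hrect
  rw [add_sub_cancel_right, sub_eq_zero] at hrect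
  unfold twistedCoeff
  rw [← intervalIntegral.integral_const_mul]
  refine Eq.trans ?_ (hrect.trans ?_)
  · simp
  · refine intervalIntegral.integral_congr fun x _ => ?_
    rw [mul_comm (s : ℂ) I, h2]
    have : cexp (-π * I * M * (I * s) - 2 * π * I * M * x) * cexp (-(2 * π * I * e * (x + I * s)))
        = cexp (-π * I * M * (I * s) - 2 * π * I * e * (I * s))
          * cexp (-(2 * π * I * (e + M) * x)) := by
      rw [← Complex.exp_add, ← Complex.exp_add]; ring_nf
    linear_combination ε₂ * F x * this

theorem twistedCoeff_neg {σ : ℂ} (hF : ∀ v, F (v + 1) = ε₁ * F v)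
    (he : cexp (2 * π * I * e) = ε₁) (hσ : ∀ v, F (-v) = σ * F v) :
    twistedCoeff (-e) F = σ * twistedCoeff e F := by
  unfold twistedCoeff
  have hp : Function.Periodic (fun x : ℝ => F x * cexp (-(2 * π * I * e * x))) 1 := by
    intro x
    have := periodic_twist hF he x
    push_cast
    exact this
  have h := hp.intervalIntegral_add_eq (-1) 0
  norm_num at h
  rw [← h, ← intervalIntegral.integral_const_mul]
  have h2 := intervalIntegral.integral_comp_neg (a := (0 : ℝ)) (b := 1)
    (fun x : ℝ => σ * (F x * cexp (-(2 * π * I * e * x))))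
  rw [neg_zero] at h2
  rw [← h2]
  refine intervalIntegral.integral_congr fun x _ => ?_
  rw [Complex.ofReal_neg, hσ, ← mul_assoc, ← hσ, ← hσ, neg_neg]
  congr 2
  ring

/-- An entire function all of whose (twisted) Fourier coefficients on the real line vanish
is zero. -/
theorem eq_zero_of_twistedCoeff_eq_zero (hd : Differentiable ℂ F)
    (hF : ∀ v, F (v + 1) = ε₁ * F v) (he : cexp (2 * π * I * e) = ε₁)
    (h0 : ∀ n : ℤ, twistedCoeff (e + n) F = 0) : F = 0 := by
  have hp : Function.Periodic (fun x : ℝ => F x * cexp (-(2 * π * I * e * x))) 1 := by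
    intro x
    have := periodic_twist hF he x
    push_cast
    exact this
  have hc : Continuous fun x : ℝ => F x * cexp (-(2 * π * I * e * x)) := by
    have := hd.continuous
    fun_prop
  have : Fact ((0 : ℝ) < 1) := ⟨one_pos⟩
  let g : C(AddCircle (1 : ℝ), ℂ) := ⟨hp.lift, continuous_coinduced_dom.mpr hc⟩
  have hg : ∀ n, fourierCoeff g n = 0 := by
    intro n
    rw [fourierCoeff_eq_intervalIntegral g n 0, zero_add, div_one, one_smul, ← h0 n]
    refine intervalIntegral.integral_congr fun x _ => ?_
    have hgx : g (x : AddCircle (1 : ℝ)) = F x * cexp (-(2 * π * I * e * x)) := rfl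
    rw [hgx, fourier_coe_apply, smul_eq_mul, mul_left_comm, ← Complex.exp_add]
    push_cast
    ring_nf
  have hzero : ∀ x : ℝ, F x = 0 := by
    intro x
    have hs : Summable (fourierCoeff g) := by
      rw [funext hg]; exact summable_zero
    have h1 := has_pointwise_sum_fourier_series_of_summable hs (x : AddCircle (1 : ℝ))
    simp only [hg, zero_smul] at h1
    have h2 : F x * cexp (-(2 * π * I * e * x)) = 0 := h1.unique hasSum_zero
    exact (mul_eq_zero.mp h2).resolve_right (Complex.exp_ne_zero _)
  have han : AnalyticOnNhd ℂ F Set.univ := fun z _ => hd.analyticAt z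
  have han0 : AnalyticOnNhd ℂ (0 : ℂ → ℂ) Set.univ := fun z _ => analyticAt_const
  refine han.eq_of_frequently_eq (z₀ := 0) han0 ?_
  have ht : Filter.Tendsto (fun n : ℕ => ((1 / ((n : ℝ) + 1) : ℝ) : ℂ)) Filter.atTop
      (nhdsWithin 0 {0}ᶜ) := by
    refine tendsto_nhdsWithin_iff.mpr ⟨?_, Filter.Eventually.of_forall fun n => ?_⟩
    · rw [← Complex.ofReal_zero]
      exact (Complex.continuous_ofReal.tendsto 0).comp tendsto_one_div_add_atTop_nhds_zero_nat
    · exact Complex.ofReal_ne_zero.mpr (by positivity)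
  exact ht.frequently (Filter.Frequently.of_forall fun n => hzero _)

end

/-! ### Interpolation in spaces of theta functions -/

theorem twistedCoeff_add {e : ℂ} {F G : ℂ → ℂ} (hF : Continuous F) (hG : Continuous G) :
    twistedCoeff e (F + G) = twistedCoeff e F + twistedCoeff e G := by
  unfold twistedCoeff
  rw [← intervalIntegral.integral_add]
  · simp only [Pi.add_apply, add_mul]
  all_goals exact Continuous.intervalIntegrable (by fun_prop) _ _

theorem twistedCoeff_smul (e c : ℂ) (F : ℂ → ℂ) :
    twistedCoeff e (c • F) = c * twistedCoeff e F := by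
  unfold twistedCoeff
  rw [← intervalIntegral.integral_const_mul]
  simp only [Pi.smul_apply, smul_eq_mul, mul_assoc]

/-- If `N` Fourier coefficients determine the elements of `V`, and some `N` elements of `V` have a
nonsingular matrix of values at `y₁, …, y_N`, then the values at these points determine the
elements of `V`. -/
theorem eq_zero_of_forall_eval_eq_zero {N : ℕ} {V : Submodule ℂ (ℂ → ℂ)} {e : ℂ}
    (hc : ∀ F ∈ V, Continuous F)
    (hV : ∀ F ∈ V, (∀ n : ℕ, n < N → twistedCoeff (e + n) F = 0) → F = 0)
    {f : Fin N → ℂ → ℂ} (hf : ∀ l, f l ∈ V) {y : Fin N → ℂ}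
    (hy : (Matrix.of fun l m => f l (y m)).det ≠ 0)
    {F : ℂ → ℂ} (hF : F ∈ V) (h0 : ∀ m, F (y m) = 0) : F = 0 := by
  let T : V →ₗ[ℂ] (Fin N → ℂ) :=
    { toFun := fun G n => twistedCoeff (e + (n : ℕ)) G
      map_add' := fun G H => by
        ext n; exact twistedCoeff_add (hc _ G.2) (hc _ H.2)
      map_smul' := fun c G => by
        ext n; exact twistedCoeff_smul _ c G }
  have hT : Function.Injective T := by
    refine (injective_iff_map_eq_zero T).mpr fun G hG => Subtype.ext ?_
    exact hV _ G.2 fun n hn => congrFun hG ⟨n, hn⟩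
  let E : V →ₗ[ℂ] (Fin N → ℂ) :=
    { toFun := fun G m => (G : ℂ → ℂ) (y m)
      map_add' := fun G H => rfl
      map_smul' := fun c G => rfl }
  let f' : Fin N → V := fun l => ⟨f l, hf l⟩
  have hEf : LinearIndependent ℂ (E ∘ f') := Matrix.linearIndependent_rows_of_det_ne_zero hy
  have hlin : LinearIndependent ℂ f' := LinearIndependent.of_comp E hEf
  have : FiniteDimensional ℂ V := Module.Finite.of_injective T hT
  have hle : Module.finrank ℂ V ≤ N := by
    simpa using LinearMap.finrank_le_finrank_of_injective hT
  have hge : N ≤ Module.finrank ℂ V := by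
    simpa using hlin.fintype_card_le_finrank
  have hspan := hlin.span_eq_top_of_card_eq_finrank' (by simpa using le_antisymm hge hle)
  have hmem : (⟨F, hF⟩ : V) ∈ Submodule.span ℂ (Set.range f') := by rw [hspan]; trivial
  obtain ⟨c, hcF⟩ := (Submodule.mem_span_range_iff_exists_fun ℂ).mp hmem
  have hE : ∑ l, c l • (E ∘ f') l = 0 := by
    have : E ⟨F, hF⟩ = 0 := funext h0
    rw [← hcF, map_sum] at this
    simpa using this
  have hc0 := Fintype.linearIndependent_iff.mp hEf c hE
  have : (⟨F, hF⟩ : V) = 0 := by rw [← hcF]; simp [hc0]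
  exact congrArg Subtype.val this

/-- A function of `N` variables that belongs to `V` in each variable and vanishes on the grid
spanned by a set of points determining the elements of `V` vanishes identically. -/
theorem eq_zero_of_forall_grid {N : ℕ} {V : Submodule ℂ (ℂ → ℂ)} {y : Fin N → ℂ}
    (hV : ∀ F ∈ V, (∀ m, F (y m) = 0) → F = 0) {Q : (Fin N → ℂ) → ℂ}
    (hslot : ∀ x i, (fun t => Q (Function.update x i t)) ∈ V)
    (hgrid : ∀ κ : Fin N → Fin N, Q (y ∘ κ) = 0) (x : Fin N → ℂ) : Q x = 0 := by
  -- The variables outside `S` lie on the grid; they are set free one after the other.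
  have key : ∀ S : Finset (Fin N), ∀ x : Fin N → ℂ, (∀ i ∉ S, ∃ k, x i = y k) → Q x = 0 := by
    intro S
    induction S using Finset.induction_on with
    | empty =>
      intro x hx
      choose κ hκ using fun i => hx i (Finset.notMem_empty i)
      rw [show x = y ∘ κ from funext hκ]
      exact hgrid κ
    | insert a S ha ih =>
      intro x hx
      have h := hV _ (hslot x a) fun m => by
        refine ih _ fun i hi => ?_
        by_cases hia : i = a
        · subst hia; exact ⟨m, by simp⟩
        · rw [Function.update_of_ne hia]
          exact hx i (by simp [hia, hi])
      have := congrFun h (x a)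
      simpa using this
  exact key Finset.univ x fun i hi => absurd (Finset.mem_univ i) hi

theorem det_update_mem {N : ℕ} {V : Submodule ℂ (ℂ → ℂ)} {f : Fin N → ℂ → ℂ}
    (hf : ∀ l, f l ∈ V) (x : Fin N → ℂ) (i : Fin N) :
    (fun t => (Matrix.of fun l m => f l (Function.update x i t m)).det) ∈ V := by
  have : (fun t => (Matrix.of fun l m => f l (Function.update x i t m)).det)
      = ∑ l, (Matrix.of fun l m => f l (x m)).adjugate i l • f l := by
    ext t
    rw [Finset.sum_apply]
    have h : (Matrix.of fun l m => f l (Function.update x i t m))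
        = (Matrix.of fun l m => f l (x m)).updateCol i (fun l => f l t) := by
      ext l m
      by_cases hm : m = i
      · subst hm; simp
      · simp [hm]
    rw [h, ← Matrix.cramer_apply, Matrix.cramer_eq_adjugate_mulVec]
    rfl
  rw [this]
  exact Submodule.sum_mem _ fun l _ => Submodule.smul_mem _ _ (hf l)

/-- A function of `N` variables which is alternating and belongs to `V` in each variable is a
multiple of the determinant of `N` elements of `V`; the factor is found by evaluation at `y`. -/
theorem alternating_mul_det {N : ℕ} {V : Submodule ℂ (ℂ → ℂ)} {f : Fin N → ℂ → ℂ}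
    (hf : ∀ l, f l ∈ V) {y : Fin N → ℂ} (hV : ∀ F ∈ V, (∀ m, F (y m) = 0) → F = 0)
    {P : (Fin N → ℂ) → ℂ} (hslot : ∀ x i, (fun t => P (Function.update x i t)) ∈ V)
    (hperm : ∀ x (σ : Equiv.Perm (Fin N)), P (x ∘ σ) = (Equiv.Perm.sign σ : ℤ) * P x)
    (x : Fin N → ℂ) :
    P x * (Matrix.of fun l m => f l (y m)).det = P y * (Matrix.of fun l m => f l (x m)).det := by
  set d : (Fin N → ℂ) → ℂ := fun x => (Matrix.of fun l m => f l (x m)).det with hd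
  let Q : (Fin N → ℂ) → ℂ := fun x => d y * P x - P y * d x
  have hQslot : ∀ x i, (fun t => Q (Function.update x i t)) ∈ V := fun x i =>
    V.sub_mem (V.smul_mem (d y) (hslot x i)) (V.smul_mem (P y) (det_update_mem hf x i))
  have hdperm : ∀ x (σ : Equiv.Perm (Fin N)), d (x ∘ σ) = (Equiv.Perm.sign σ : ℤ) * d x := by
    intro x σ
    exact Matrix.det_permute' σ (Matrix.of fun l m => f l (x m))
  have hQperm : ∀ x (σ : Equiv.Perm (Fin N)), Q (x ∘ σ) = (Equiv.Perm.sign σ : ℤ) * Q x := by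
    intro x σ
    simp only [Q, hdperm, hperm]
    ring
  have hgrid : ∀ κ : Fin N → Fin N, Q (y ∘ κ) = 0 := by
    intro κ
    by_cases hκ : Function.Injective κ
    · have h := hQperm y (Equiv.ofBijective κ (Finite.injective_iff_bijective.mp hκ))
      have h0 : Q y = 0 := by simp only [Q]; ring
      rw [h0, mul_zero] at h
      exact h
    · simp only [Function.Injective, not_forall] at hκ
      obtain ⟨i, j, hij, hne⟩ := hκ
      have h := hQperm (y ∘ κ) (Equiv.swap i j)
      have hsw : (y ∘ κ) ∘ Equiv.swap i j = y ∘ κ := by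
        ext m
        simp only [Function.comp_apply]
        congr 1
        by_cases hmi : m = i
        · rw [hmi, Equiv.swap_apply_left, hij]
        · by_cases hmj : m = j
          · rw [hmj, Equiv.swap_apply_right, hij]
          · rw [Equiv.swap_apply_of_ne_of_ne hmi hmj]
      rw [hsw, Equiv.Perm.sign_swap hne] at h
      simp only [Units.val_neg, Units.val_one, Int.cast_neg, Int.cast_one] at h
      linear_combination h / 2
  have := eq_zero_of_forall_grid hV hQslot hgrid x
  simp only [Q] at this
  linear_combination this

/-! ### Fourier coefficients and parity -/

/-- The subspace of the functions in `thetaSpace M ε₁ ε₂ τ` with `F (-v) = σ F v`. -/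
def thetaSpaceParity (M : ℕ) (ε₁ ε₂ σ τ : ℂ) : Submodule ℂ (ℂ → ℂ) where
  carrier := {F | F ∈ thetaSpace M ε₁ ε₂ τ ∧ ∀ v, F (-v) = σ * F v}
  zero_mem' := ⟨Submodule.zero_mem _, by simp⟩
  add_mem' := by
    rintro F G ⟨hF, hF1⟩ ⟨hG, hG1⟩
    refine ⟨Submodule.add_mem _ hF hG, fun v => ?_⟩
    simp only [Pi.add_apply, hF1, hG1]; ring
  smul_mem' := by
    rintro c F ⟨hF, hF1⟩
    refine ⟨Submodule.smul_mem _ c hF, fun v => ?_⟩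
    simp only [Pi.smul_apply, smul_eq_mul, hF1]; ring

section

variable {M : ℕ} {ε₁ ε₂ σ e : ℂ} {s : ℝ} {F : ℂ → ℂ}

theorem exp_add_int (he : cexp (2 * π * I * e) = ε₁) (n : ℤ) :
    cexp (2 * π * I * (e + n)) = ε₁ := by
  rw [mul_add, Complex.exp_add, he, mul_comm _ (n : ℂ), Complex.exp_int_mul_two_pi_mul_I, mul_one]

theorem twistedCoeff_eq_zero_iff (hF : F ∈ thetaSpace M ε₁ ε₂ (I * s)) (hε₂ : ε₂ ≠ 0)
    (he : cexp (2 * π * I * e) = ε₁) (n k : ℤ) :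
    twistedCoeff (e + n) F = 0 ↔ twistedCoeff (e + (n + M * k : ℤ)) F = 0 := by
  have step : ∀ n : ℤ, twistedCoeff (e + n) F = 0 ↔ twistedCoeff (e + (n + M : ℤ)) F = 0 := by
    intro n
    rw [twistedCoeff_recursion hF (exp_add_int he n), mul_eq_zero,
      or_iff_right (mul_ne_zero hε₂ (Complex.exp_ne_zero _))]
    push_cast
    rw [add_assoc]
  induction k using Int.induction_on with
  | zero => simp
  | succ k ih =>
    refine ih.trans ((step _).trans ?_)
    rw [show n + M * (k : ℤ) + M = n + M * (k + 1) by ring]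
  | pred k ih =>
    refine ih.trans (((step (n + M * (-k - 1))).trans ?_).symm)
    rw [show n + M * (-(k : ℤ) - 1) + M = n + M * (-k) by ring]

/-- A theta function of degree `M` is determined by `M` consecutive Fourier coefficients. -/
theorem eq_zero_of_twistedCoeff_lt (hM : 0 < M) (hF : F ∈ thetaSpace M ε₁ ε₂ (I * s))
    (hε₂ : ε₂ ≠ 0) (he : cexp (2 * π * I * e) = ε₁)
    (h0 : ∀ n : ℕ, n < M → twistedCoeff (e + n) F = 0) : F = 0 := by
  refine eq_zero_of_twistedCoeff_eq_zero hF.1 hF.2.1 he fun n => ?_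
  have hM' : (0 : ℤ) < M := by exact_mod_cast hM
  rw [← Int.emod_add_mul_ediv n M, ← twistedCoeff_eq_zero_iff hF hε₂ he]
  have h1 := Int.emod_nonneg n hM'.ne'
  have h2 := Int.emod_lt_of_pos n hM'
  obtain ⟨m, hm⟩ := Int.eq_ofNat_of_zero_le h1
  rw [hm] at h2 ⊢
  have := h0 m (by exact_mod_cast h2)
  exact_mod_cast this

/-- In the presence of a parity the frequencies `e + n` and `-(e + n)` carry the same
information, and for odd functions the coefficients at the frequency `0` and, if `ε₂ = 1`, at the
frequency `M / 2` vanish. So `N` coefficients suffice as soon as each residue modulo `M` is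
reached in one of these ways. -/
theorem eq_zero_of_twistedCoeff_parity {N w : ℕ} (hM : 0 < M)
    (hF : F ∈ thetaSpaceParity M ε₁ ε₂ σ (I * s)) (hε₂ : ε₂ ≠ 0)
    (he : cexp (2 * π * I * e) = ε₁) (hw : 2 * e = -w)
    (hcover : ∀ n < M, n < N ∨ (n ≤ w ∧ w < n + N) ∨ (σ = -1 ∧ 2 * n = w) ∨
      (σ = -1 ∧ ε₂ = 1 ∧ 2 * n = M + w))
    (h0 : ∀ n : ℕ, n < N → twistedCoeff (e + n) F = 0) : F = 0 := by
  refine eq_zero_of_twistedCoeff_lt hM hF.1 hε₂ he fun n hn => ?_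
  have hneg : ∀ k : ℤ, twistedCoeff (-(e + k)) F = σ * twistedCoeff (e + k) F := fun k =>
    twistedCoeff_neg hF.1.2.1 (exp_add_int he k) hF.2
  rcases hcover n hn with h | ⟨h1, h2⟩ | ⟨hσ, h⟩ | ⟨hσ, hε, h⟩
  · exact h0 n h
  · have h3 := hneg ((w - n : ℕ) : ℤ)
    rw [Int.cast_natCast, h0 (w - n) (by omega), mul_zero] at h3
    rw [← h3, Nat.cast_sub h1]
    congr 1
    linear_combination hw
  · have h3 := hneg n
    have h4 : e + n = 0 := by
      have : (2 * n : ℂ) = w := by exact_mod_cast h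
      linear_combination hw / 2 + this / 2
    rw [Int.cast_natCast, h4, hσ, neg_zero] at h3
    rw [h4]
    linear_combination h3 / 2
  · have h3 := hneg n
    have h4 : e + n = M / 2 := by
      have : (2 * n : ℂ) = M + w := by exact_mod_cast h
      linear_combination hw / 2 + this / 2
    have h5 := twistedCoeff_recursion hF.1 (exp_add_int he (n - M))
    have h6 : e + ((n - M : ℤ) : ℂ) = -(M / 2) := by push_cast; linear_combination h4
    rw [h6, hε, show -π * I * M * (I * s) - 2 * π * I * (-(M / 2)) * (I * s) = 0 by ring,
      Complex.exp_zero, show -((M : ℂ) / 2) + M = M / 2 by ring] at h5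
    rw [Int.cast_natCast, h4, hσ] at h3
    rw [h4]
    linear_combination (h3 - h5) / 2

end

/-! ### The Jacobi triple product -/

/-- The finite Euler product `∏_{n = 1}^m (1 - Qⁿ)`. -/
noncomputable def eulerProd (Q : ℂ) (m : ℕ) : ℂ := ∏ n ∈ Finset.range m, (1 - Q ^ (n + 1))

/-- The reciprocal of `eulerProd`, extended by zero to negative integers. With this convention
`invEulerProd_sub_one` holds for all integers, so that Gauss' finite form of the triple product
needs no boundary terms. -/
noncomputable def invEulerProd (Q : ℂ) : ℤ → ℂ
  | Int.ofNat m => (eulerProd Q m)⁻¹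
  | Int.negSucc _ => 0

theorem one_sub_pow_ne_zero {Q : ℂ} (hQ : ‖Q‖ < 1) (n : ℕ) : 1 - Q ^ (n + 1) ≠ 0 := by
  intro h
  have h1 : ‖Q ^ (n + 1)‖ = 1 := by rw [← sub_eq_zero.mp h, norm_one]
  rw [norm_pow] at h1
  exact (pow_lt_one₀ (norm_nonneg Q) hQ n.succ_ne_zero).ne h1

theorem eulerProd_ne_zero {Q : ℂ} (hQ : ‖Q‖ < 1) (m : ℕ) : eulerProd Q m ≠ 0 :=
  Finset.prod_ne_zero_iff.mpr fun n _ => one_sub_pow_ne_zero hQ n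

theorem invEulerProd_sub_one {Q : ℂ} (hQ : ‖Q‖ < 1) (j : ℤ) :
    invEulerProd Q (j - 1) = (1 - Q ^ j) * invEulerProd Q j := by
  match j with
  | Int.ofNat 0 =>
    have h : (Int.ofNat 0 - 1 : ℤ) = Int.negSucc 0 := rfl
    rw [h]
    simp [invEulerProd]
  | Int.ofNat (n + 1) =>
    have h : (Int.ofNat (n + 1) - 1 : ℤ) = Int.ofNat n := by simp
    have h1 := one_sub_pow_ne_zero hQ n
    have h2 := eulerProd_ne_zero hQ n
    rw [h]
    simp only [invEulerProd, Int.ofNat_eq_natCast, zpow_natCast]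
    rw [eulerProd, eulerProd, Finset.prod_range_succ, ← eulerProd]
    field_simp
  | Int.negSucc n =>
    have h : (Int.negSucc n - 1 : ℤ) = Int.negSucc (n + 1) := rfl
    rw [h]
    simp [invEulerProd]

/-- Gauss' finite form of the Jacobi triple product. -/
theorem hasSum_finite_triple_product {q w : ℂ} (hq : ‖q‖ < 1) (hq0 : q ≠ 0) (hw : w ≠ 0) (m : ℕ) :
    HasSum (fun k : ℤ => eulerProd (q ^ 2) (2 * m) * invEulerProd (q ^ 2) (m - k)
      * invEulerProd (q ^ 2) (m + k) * (q ^ (k ^ 2) * w ^ k))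
      (∏ n ∈ Finset.range m, ((1 + q ^ (2 * n + 1) * w) * (1 + q ^ (2 * n + 1) * w⁻¹))) := by
  have hQ : ‖q ^ 2‖ < 1 := by
    rw [norm_pow]; exact pow_lt_one₀ (norm_nonneg q) hq two_ne_zero
  have hQ0 : q ^ 2 ≠ 0 := pow_ne_zero 2 hq0
  induction m with
  | zero =>
    have h := hasSum_single (f := fun k : ℤ => eulerProd (q ^ 2) (2 * 0)
      * invEulerProd (q ^ 2) ((0 : ℕ) - k) * invEulerProd (q ^ 2) ((0 : ℕ) + k)
      * (q ^ (k ^ 2) * w ^ k)) 0 ?_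
    · have h0 : invEulerProd (q ^ 2) 0 = 1 := by
        change (eulerProd (q ^ 2) 0)⁻¹ = 1
        simp [eulerProd]
      simpa [h0, eulerProd] using h
    · intro k hk
      rcases lt_or_gt_of_ne hk with h | h
      · obtain ⟨n, rfl⟩ := Int.eq_negSucc_of_lt_zero h
        simp [invEulerProd]
      · obtain ⟨n, hn⟩ := Int.eq_negSucc_of_lt_zero (neg_lt_zero.mpr h)
        simp [hn, invEulerProd]
  | succ m ih =>
    rw [Finset.prod_range_succ]
    have h1 := (Equiv.subRight (1 : ℤ)).hasSum_iff.mpr ih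
    have h2 := (Equiv.addRight (1 : ℤ)).hasSum_iff.mpr ih
    have h := ((ih.mul_left (1 + (q ^ 2) ^ (2 * m + 1))).add
      (h1.mul_left (q ^ (2 * m + 1) * w))).add (h2.mul_left (q ^ (2 * m + 1) * w⁻¹))
    have hww : w * w⁻¹ = 1 := mul_inv_cancel₀ hw
    rw [show ∀ x : ℂ, x * ((1 + q ^ (2 * m + 1) * w) * (1 + q ^ (2 * m + 1) * w⁻¹))
      = (1 + (q ^ 2) ^ (2 * m + 1)) * x + q ^ (2 * m + 1) * w * x + q ^ (2 * m + 1) * w⁻¹ * x from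
      fun x => by linear_combination (q ^ (2 * m + 1)) ^ 2 * x * hww]
    refine Eq.mp (congrArg (fun g => HasSum g _) (funext fun k => Eq.symm ?_)) h
    simp only [Function.comp_apply, Equiv.subRight_apply, Equiv.coe_addRight]
    have ea : ((m : ℤ) - k) = (m + 1 - k) - 1 := by ring
    have eb : ((m : ℤ) + k) = (m + 1 + k) - 1 := by ring
    have ea1 : ((m : ℤ) - (k - 1)) = m + 1 - k := by ring
    have eb1 : ((m : ℤ) + (k - 1)) = (m + 1 + k) - 1 - 1 := by ring
    have ea2 : ((m : ℤ) - (k + 1)) = (m + 1 - k) - 1 - 1 := by ring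
    have eb2 : ((m : ℤ) + (k + 1)) = m + 1 + k := by ring
    rw [ea, eb, ea1, eb1, ea2, eb2, Nat.cast_succ]
    simp only [invEulerProd_sub_one hQ]
    have hE : eulerProd (q ^ 2) (2 * (m + 1)) = eulerProd (q ^ 2) (2 * m)
        * (1 - (q ^ 2) ^ (2 * m + 1)) * (1 - (q ^ 2) ^ (2 * m + 2)) := by
      rw [show 2 * (m + 1) = 2 * m + 1 + 1 by ring, eulerProd, Finset.prod_range_succ,
        Finset.prod_range_succ, ← eulerProd]
    rw [hE]
    set x : ℂ := (q ^ 2) ^ ((m : ℤ) + 1 - k) with hx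
    set y : ℂ := (q ^ 2) ^ ((m : ℤ) + 1 + k) with hy
    have hxy : (q ^ 2) ^ (2 * m + 2) = x * y := by
      rw [hx, hy, ← zpow_add₀ hQ0, ← zpow_natCast]
      congr 1; push_cast; ring
    have hxy1 : (q ^ 2) ^ (2 * m + 1) = x * y * (q ^ 2)⁻¹ := by
      rw [← hxy, pow_succ _ (2 * m + 1)]; field_simp
    have hx1 : (q ^ 2) ^ ((m : ℤ) + 1 - k - 1) = x * (q ^ 2)⁻¹ := by
      rw [zpow_sub_one₀ hQ0]
    have hy1 : (q ^ 2) ^ ((m : ℤ) + 1 + k - 1) = y * (q ^ 2)⁻¹ := by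
      rw [zpow_sub_one₀ hQ0]
    have hk1 : q ^ (2 * m + 1) * w * (q ^ ((k - 1) ^ 2) * w ^ (k - 1))
        = x * (q ^ (k ^ 2) * w ^ k) := by
      have e1 : q ^ (2 * m + 1) * q ^ ((k - 1) ^ 2) = x * q ^ (k ^ 2) := by
        rw [hx, ← zpow_natCast q 2, ← zpow_mul, ← zpow_natCast, ← zpow_add₀ hq0, ← zpow_add₀ hq0]
        congr 1; push_cast; ring
      rw [zpow_sub_one₀ hw]
      field_simp
      linear_combination e1
    have hk2 : q ^ (2 * m + 1) * w⁻¹ * (q ^ ((k + 1) ^ 2) * w ^ (k + 1))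
        = y * (q ^ (k ^ 2) * w ^ k) := by
      have e1 : q ^ (2 * m + 1) * q ^ ((k + 1) ^ 2) = y * q ^ (k ^ 2) := by
        rw [hy, ← zpow_natCast q 2, ← zpow_mul, ← zpow_natCast, ← zpow_add₀ hq0, ← zpow_add₀ hq0]
        congr 1; push_cast; ring
      rw [zpow_add_one₀ hw]
      field_simp
      linear_combination e1
    rw [hxy, hxy1, hx1, hy1]
    set E := eulerProd (q ^ 2) (2 * m)
    set A := invEulerProd (q ^ 2) ((m : ℤ) + 1 - k)
    set B := invEulerProd (q ^ 2) ((m : ℤ) + 1 + k)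
    linear_combination (-E * A * (1 - y * (q ^ 2)⁻¹) * (1 - y) * B) * hk1
      + (-E * (1 - x * (q ^ 2)⁻¹) * (1 - x) * A * B) * hk2

theorem tendsto_eulerProd {Q : ℂ} (hQ : ‖Q‖ < 1) :
    Tendsto (eulerProd Q) atTop (𝓝 (∏' n : ℕ, (1 - Q ^ (n + 1)))) :=
  (ModularForm.multipliable_one_sub_pow hQ).hasProd.tendsto_prod_nat

theorem tprod_one_sub_pow_ne_zero {Q : ℂ} (hQ : ‖Q‖ < 1) : ∏' n : ℕ, (1 - Q ^ (n + 1)) ≠ 0 := by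
  simp_rw [sub_eq_add_neg]
  refine tprod_one_add_ne_zero_of_summable (f := fun n : ℕ => -Q ^ (n + 1)) (fun n => ?_) ?_
  · rw [← sub_eq_add_neg]; exact one_sub_pow_ne_zero hQ n
  · simpa using (summable_nat_add_iff 1).mpr (summable_geometric_of_lt_one (norm_nonneg _) hQ)

theorem exists_bound_invEulerProd {Q : ℂ} (hQ : ‖Q‖ < 1) :
    ∃ C, 0 ≤ C ∧ ∀ j, ‖invEulerProd Q j‖ ≤ C := by
  have h := ((tendsto_eulerProd hQ).inv₀ (tprod_one_sub_pow_ne_zero hQ)).norm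
  obtain ⟨C, hC⟩ := h.bddAbove_range
  have hC' : ∀ m, ‖(eulerProd Q m)⁻¹‖ ≤ C := fun m => hC ⟨m, rfl⟩
  have h0 : 0 ≤ C := (norm_nonneg _).trans (hC' 0)
  refine ⟨C, h0, fun j => ?_⟩
  match j with
  | Int.ofNat m => exact hC' m
  | Int.negSucc _ => simpa [invEulerProd] using h0

theorem tendsto_invEulerProd {Q : ℂ} (hQ : ‖Q‖ < 1) :
    Tendsto (invEulerProd Q) atTop (𝓝 (∏' n : ℕ, (1 - Q ^ (n + 1)))⁻¹) := by
  have h := (tendsto_eulerProd hQ).inv₀ (tprod_one_sub_pow_ne_zero hQ)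
  rw [← Nat.map_cast_int_atTop]
  exact h

/-- The Jacobi triple product identity for `jacobiTheta₂`. -/
theorem tendsto_triple_product (z : ℂ) {τ : ℂ} (hτ : 0 < τ.im) :
    Tendsto (fun m => ∏ n ∈ Finset.range m, ((1 + cexp (π * I * τ) ^ (2 * n + 1)
        * cexp (2 * π * I * z)) * (1 + cexp (π * I * τ) ^ (2 * n + 1)
        * (cexp (2 * π * I * z))⁻¹))) atTop
      (𝓝 ((∏' n : ℕ, (1 - (cexp (π * I * τ) ^ 2) ^ (n + 1)))⁻¹ * jacobiTheta₂ z τ)) := by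
  set q := cexp (π * I * τ) with hqdef
  set w := cexp (2 * π * I * z) with hwdef
  have hq : ‖q‖ < 1 := by
    rw [hqdef, Complex.norm_exp]
    have : (π * I * τ).re = -(π * τ.im) := by simp
    rw [this]
    exact Real.exp_lt_one_iff.mpr (neg_lt_zero.mpr (mul_pos Real.pi_pos hτ))
  have hQ : ‖q ^ 2‖ < 1 := by
    rw [norm_pow]; exact pow_lt_one₀ (norm_nonneg q) hq two_ne_zero
  have hterm : ∀ k : ℤ, q ^ (k ^ 2) * w ^ k = jacobiTheta₂_term k z τ := by
    intro k
    rw [hqdef, hwdef, ← Complex.exp_int_mul, ← Complex.exp_int_mul, ← Complex.exp_add,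
      jacobiTheta₂_term]
    push_cast
    ring_nf
  have hsum := fun m => (hasSum_finite_triple_product (q := q) (w := w) hq
    (Complex.exp_ne_zero _) (Complex.exp_ne_zero _) m).tsum_eq
  simp_rw [hterm] at hsum
  simp_rw [← hsum]
  obtain ⟨C, hC0, hC⟩ := exists_bound_invEulerProd hQ
  obtain ⟨D, hD⟩ := (tendsto_eulerProd hQ).norm.bddAbove_range
  have hD' : ∀ m, ‖eulerProd (q ^ 2) m‖ ≤ D := fun m => hD ⟨m, rfl⟩
  rw [jacobiTheta₂, ← tsum_mul_left]
  set P := ∏' n : ℕ, (1 - (q ^ 2) ^ (n + 1))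
  have hP : P ≠ 0 := tprod_one_sub_pow_ne_zero hQ
  refine tendsto_tsum_of_dominated_convergence
    (bound := fun k : ℤ => D * C * C * ‖jacobiTheta₂_term k z τ‖) ?_ (fun k => ?_)
    (Eventually.of_forall fun m k => ?_)
  · exact ((summable_jacobiTheta₂_term_iff z τ).mpr hτ).norm.mul_left _
  · refine Tendsto.mul_const _ ?_
    have h1 : Tendsto (fun m : ℕ => eulerProd (q ^ 2) (2 * m)) atTop (𝓝 P) :=
      (tendsto_eulerProd hQ).comp (tendsto_id.const_mul_atTop' two_pos)
    have hcast : Tendsto (fun m : ℕ => (m : ℤ)) atTop atTop := tendsto_natCast_atTop_atTop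
    have h2 : Tendsto (fun m : ℕ => invEulerProd (q ^ 2) (m - k)) atTop (𝓝 P⁻¹) :=
      (tendsto_invEulerProd hQ).comp (tendsto_atTop_add_const_right _ (-k) hcast)
    have h3 : Tendsto (fun m : ℕ => invEulerProd (q ^ 2) (m + k)) atTop (𝓝 P⁻¹) :=
      (tendsto_invEulerProd hQ).comp (tendsto_atTop_add_const_right _ k hcast)
    have h4 := (h1.mul h2).mul h3
    rwa [mul_inv_cancel₀ hP, one_mul] at h4
  · rw [norm_mul, norm_mul, norm_mul]
    have := (norm_nonneg _).trans (hD' 0)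
    gcongr
    · exact hD' _
    · exact hC _
    · exact hC _

/-! ### Logarithms of the infinite products on the imaginary axis -/

/-- The logarithm of the infinite product defining `η(iy)`, so that `η(iy) = exp (logEta y)`. -/
noncomputable def logEta (y : ℝ) : ℝ :=
  -(π * y / 12) + ∑' n : ℕ, Real.log (1 - Real.exp (-(2 * π * y)) ^ (n + 1))

/-- The logarithm of `ϑ₁(v; iy) / (2 sin(πv) η(iy))`, `v` real, defined through the infinite
product and therefore meaningful also at the zeros of the sine. -/
noncomputable def logTheta (v y : ℝ) : ℝ :=
  -(π * y / 6) + ∑' n : ℕ, Real.log (1 - 2 * Real.exp (-(2 * π * y)) ^ (n + 1)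
    * Real.cos (2 * π * v) + (Real.exp (-(2 * π * y)) ^ (n + 1)) ^ 2)

/-- The logarithm of `∏_{n ≥ 0} (1 + p^{n + a})` with `p = e^{-2πy}`. -/
noncomputable def logShiftedProd (a y : ℝ) : ℝ :=
  ∑' n : ℕ, Real.log (1 + Real.exp (-(2 * π * y * (n + a))))

/-- The logarithm of `e^{-πya²} ϑ₁(iay + 1/2; iy) / η(iy)`, `a` real. -/
noncomputable def logThetaImag (a y : ℝ) : ℝ :=
  -(π * y * (a ^ 2 - a + 1 / 6)) + logShiftedProd a y + logShiftedProd (1 - a) y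

theorem tendsto_prod_exp_tsum_log {a : ℕ → ℝ} (ha : Summable a) (hpos : ∀ n, 0 < 1 + a n) :
    Tendsto (fun m => ∏ n ∈ Finset.range m, (1 + a n)) atTop
      (𝓝 (Real.exp (∑' n, Real.log (1 + a n)))) := by
  have h := (Real.summable_log_one_add_of_summable ha).hasSum.tendsto_sum_nat
  refine ((Real.continuous_exp.tendsto _).comp h).congr fun m => ?_
  rw [Function.comp_apply, Real.exp_sum]
  exact Finset.prod_congr rfl fun n _ => Real.exp_log (hpos n)

section

variable {y : ℝ}

theorem nome_lt_one (hy : 0 < y) : Real.exp (-(2 * π * y)) < 1 := by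
  rw [Real.exp_lt_one_iff]; have := Real.pi_pos; simp; positivity

theorem summable_nome (hy : 0 < y) : Summable fun n : ℕ => Real.exp (-(2 * π * y)) ^ (n + 1) :=
  (summable_nat_add_iff 1).mpr (summable_geometric_of_lt_one (Real.exp_pos _).le (nome_lt_one hy))

theorem nome_pow_lt_one (hy : 0 < y) (n : ℕ) : Real.exp (-(2 * π * y)) ^ (n + 1) < 1 :=
  pow_lt_one₀ (Real.exp_pos _).le (nome_lt_one hy) n.succ_ne_zero

/-- The factor is at least `(1 - p)²`. -/
theorem theta_factor_pos {p : ℝ} (hp0 : 0 ≤ p) (hp : p < 1) (x : ℝ) :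
    0 < 1 - 2 * p * Real.cos x + p ^ 2 := by
  nlinarith [Real.cos_le_one x, mul_le_mul_of_nonneg_left (Real.cos_le_one x) hp0,
    mul_pos (sub_pos.mpr hp) (sub_pos.mpr hp)]

theorem summable_theta_factor {p : ℕ → ℝ} (hp0 : ∀ n, 0 ≤ p n) (hp : ∀ n, p n < 1)
    (hs : Summable p) (x : ℝ) : Summable fun n => -(2 * p n * Real.cos x) + p n ^ 2 := by
  refine Summable.of_norm_bounded (hs.mul_left 3) fun n => ?_
  rw [Real.norm_eq_abs, abs_le]
  constructor <;> nlinarith [Real.cos_le_one x, Real.neg_one_le_cos x,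
    mul_le_mul_of_nonneg_left (Real.cos_le_one x) (hp0 n),
    mul_le_mul_of_nonneg_left (Real.neg_one_le_cos x) (hp0 n), hp n, hp0 n,
    mul_nonneg (hp0 n) (sub_nonneg.mpr (hp n).le)]

theorem summable_log_theta_factor {p : ℕ → ℝ} (hp0 : ∀ n, 0 ≤ p n) (hp : ∀ n, p n < 1)
    (hs : Summable p) (x : ℝ) :
    Summable fun n => Real.log (1 - 2 * p n * Real.cos x + p n ^ 2) := by
  have := Real.summable_log_one_add_of_summable (summable_theta_factor hp0 hp hs x)
  refine this.congr fun n => ?_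
  ring_nf

theorem tendsto_theta_factor {p : ℕ → ℝ} (hp0 : ∀ n, 0 ≤ p n) (hp : ∀ n, p n < 1)
    (hs : Summable p) (x : ℝ) :
    Tendsto (fun m => ∏ n ∈ Finset.range m, (1 - 2 * p n * Real.cos x + p n ^ 2)) atTop
      (𝓝 (Real.exp (∑' n, Real.log (1 - 2 * p n * Real.cos x + p n ^ 2)))) := by
  have h := tendsto_prod_exp_tsum_log (summable_theta_factor hp0 hp hs x) fun n => by
    have := theta_factor_pos (hp0 n) (hp n) x
    linarith
  simpa only [← add_assoc, ← sub_eq_add_neg] using h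

/-- The complex form of a factor of the triple product at a point of the unit circle. -/
theorem theta_factor_eq (p x : ℝ) :
    (1 - (p : ℂ) * cexp (I * x)) * (1 - p * (cexp (I * x))⁻¹)
      = ((1 - 2 * p * Real.cos x + p ^ 2 : ℝ) : ℂ) := by
  have h : cexp (I * x) * (cexp (I * x))⁻¹ = 1 := mul_inv_cancel₀ (Complex.exp_ne_zero _)
  have h2 : cexp (I * x) + (cexp (I * x))⁻¹ = 2 * Complex.cos x := by
    rw [Complex.two_cos, ← Complex.exp_neg]; ring_nf
  push_cast
  linear_combination (p : ℂ) ^ 2 * h - p * h2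

theorem exp_pi_I_tau_sq (y : ℝ) : cexp (π * I * (I * y)) ^ 2 = (Real.exp (-(2 * π * y)) : ℝ) := by
  rw [← Complex.exp_nat_mul]
  push_cast
  congr 1
  linear_combination (2 * π * y : ℂ) * I_mul_I

theorem im_I_mul (y : ℝ) : (I * (y : ℂ)).im = y := by simp

theorem eulerProd_eq_exp (hy : 0 < y) :
    ∏' n : ℕ, (1 - (cexp (π * I * (I * y)) ^ 2) ^ (n + 1))
      = ((Real.exp (∑' n : ℕ, Real.log (1 - Real.exp (-(2 * π * y)) ^ (n + 1))) : ℝ) : ℂ) := by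
  rw [exp_pi_I_tau_sq]
  have hQ : ‖((Real.exp (-(2 * π * y)) : ℝ) : ℂ)‖ < 1 := by
    rw [Complex.norm_real, Real.norm_eq_abs, abs_of_pos (Real.exp_pos _)]
    exact nome_lt_one hy
  have h := tendsto_eulerProd hQ
  have h2 := tendsto_prod_exp_tsum_log (summable_nome hy).neg fun n => by
    have := nome_pow_lt_one hy n
    linarith
  simp only [← sub_eq_add_neg] at h2
  have h3 := (Complex.continuous_ofReal.tendsto _).comp h2
  refine tendsto_nhds_unique h (h3.congr fun m => ?_)
  simp [eulerProd]

theorem eta_eq_exp (hy : 0 < y) : ModularForm.eta (I * y) = (Real.exp (logEta y) : ℝ) := by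
  unfold ModularForm.eta logEta
  rw [Real.exp_add, Complex.ofReal_mul, ← eulerProd_eq_exp hy]
  congr 1
  · simp only [Function.Periodic.qParam]
    push_cast
    congr 1
    linear_combination (2 * π * y / 24 : ℂ) * I_mul_I
  · refine tprod_congr fun n => ?_
    rw [ModularForm.eta_q_eq_pow, ← Complex.exp_nat_mul (π * I * (I * y)) 2]
    congr 3
    push_cast; ring

/-- The Jacobi triple product for `ϑ₁(v; iy)`, `v` real. -/
theorem theta1_eq_exp (hy : 0 < y) (v : ℝ) :
    theta1 v (I * y) = 2 * Real.sin (π * v) * ((Real.exp (logEta y + logTheta v y) : ℝ) : ℂ) := by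
  set p := Real.exp (-(2 * π * y)) with hp
  have hτ : 0 < (I * (y : ℂ)).im := by rw [im_I_mul]; exact hy
  have h := tendsto_triple_product (v + 1 / 2 - I * y / 2) hτ
  rw [eulerProd_eq_exp hy] at h
  set q := cexp (π * I * (I * y)) with hq
  have hq0 : q ≠ 0 := Complex.exp_ne_zero _
  have hq2 : q ^ 2 = (p : ℂ) := exp_pi_I_tau_sq y
  set ζ := cexp (I * (2 * π * v : ℝ)) with hζ
  have hζ0 : ζ ≠ 0 := Complex.exp_ne_zero _
  have hw : cexp (2 * π * I * (v + 1 / 2 - I * y / 2)) = -ζ * q⁻¹ := by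
    rw [hζ, hq, ← Complex.exp_neg, neg_mul, ← Complex.exp_add, ← Complex.exp_add_pi_mul_I]
    congr 1
    push_cast; ring
  rw [hw] at h
  have hfac : ∀ m, (∏ n ∈ Finset.range m, ((1 + q ^ (2 * n + 1) * (-ζ * q⁻¹))
      * (1 + q ^ (2 * n + 1) * (-ζ * q⁻¹)⁻¹))) * (1 - (p : ℂ) ^ m * ζ)
      = (1 - ζ) * ((∏ n ∈ Finset.range m,
        (1 - 2 * p ^ (n + 1) * Real.cos (2 * π * v) + (p ^ (n + 1)) ^ 2) : ℝ) : ℂ) := by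
    intro m
    have h1 : ∀ n : ℕ, (1 + q ^ (2 * n + 1) * (-ζ * q⁻¹)) = 1 - (p : ℂ) ^ n * ζ := by
      intro n
      rw [← hq2, ← pow_mul, pow_succ]; field_simp; ring
    have h2 : ∀ n : ℕ, (1 + q ^ (2 * n + 1) * (-ζ * q⁻¹)⁻¹) = 1 - (p : ℂ) ^ (n + 1) * ζ⁻¹ := by
      intro n
      rw [← hq2, ← pow_mul, mul_inv, inv_inv, inv_neg]; ring
    simp_rw [h1, h2]
    push_cast
    rw [Finset.prod_mul_distrib, mul_right_comm,
      ← Finset.prod_range_succ (fun n => 1 - (p : ℂ) ^ n * ζ), Finset.prod_range_succ', pow_zero,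
      one_mul, mul_right_comm, ← Finset.prod_mul_distrib, mul_comm]
    congr 1
    refine Finset.prod_congr rfl fun n _ => ?_
    have := theta_factor_eq (p ^ (n + 1)) (2 * π * v)
    push_cast at this ⊢
    rw [hζ]
    push_cast
    exact this
  have hp1 : ‖(p : ℂ)‖ < 1 := by
    rw [Complex.norm_real, Real.norm_eq_abs, abs_of_pos (Real.exp_pos _)]
    exact nome_lt_one hy
  have hlim : Tendsto (fun m : ℕ => 1 - (p : ℂ) ^ m * ζ) atTop (𝓝 1) := by
    simpa using ((tendsto_pow_atTop_nhds_zero_of_norm_lt_one hp1).mul_const ζ).const_sub 1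
  have hL := h.mul hlim
  simp_rw [hfac] at hL
  have hR := (Complex.continuous_ofReal.tendsto _).comp (tendsto_theta_factor
    (fun n => (pow_pos (Real.exp_pos _) (n + 1)).le) (nome_pow_lt_one hy) (summable_nome hy)
    (2 * π * v))
  have huniq := tendsto_nhds_unique hL (hR.const_mul (1 - ζ))
  rw [mul_one] at huniq
  rw [theta1_eq_jacobiTheta₂]
  unfold logEta logTheta
  rw [show ∀ a b c d : ℝ, (a + b) + (c + d) = (a + c) + b + d by intros; ring, Real.exp_add,
    Real.exp_add, Complex.ofReal_mul, Complex.ofReal_mul]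
  set A := ((Real.exp (∑' n : ℕ, Real.log (1 - p ^ (n + 1))) : ℝ) : ℂ) with hA
  have hA0 : A ≠ 0 := Complex.ofReal_ne_zero.mpr (Real.exp_pos _).ne'
  set B := ((Real.exp (∑' n : ℕ, Real.log (1 - 2 * p ^ (n + 1) * Real.cos (2 * π * v)
    + (p ^ (n + 1)) ^ 2)) : ℝ) : ℂ)
  have hJ : jacobiTheta₂ (v + 1 / 2 - I * y / 2) (I * y) = A * ((1 - ζ) * B) := by
    rw [← huniq]; field_simp
  rw [hJ]
  have e1 : ((Real.exp (-(π * y / 12) + -(π * y / 6)) : ℝ) : ℂ) = cexp (π * I * (I * y) / 4) := by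
    push_cast
    congr 1
    linear_combination (-(π * y / 4) : ℂ) * I_mul_I
  have e2 : I * cexp (-(π * I * v)) * (1 - ζ) = 2 * Real.sin (π * v) := by
    rw [hζ, Complex.ofReal_sin, Complex.two_sin, mul_assoc, mul_sub, ← Complex.exp_add]
    push_cast
    ring_nf
  rw [e1, sub_eq_add_neg, Complex.exp_add]
  linear_combination cexp (π * I * (I * y) / 4) * A * B * e2

end

section

variable {y : ℝ}

theorem tsum_succ_eq_odd_add_even {g : ℕ → ℝ} (hg : Summable fun n => g (n + 1)) :
    ∑' n, g (n + 1) = ∑' n, g (2 * n + 1) + ∑' n, g (2 * n + 2) := by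
  refine (tsum_even_add_odd ?_ ?_).symm
  · exact hg.comp_injective (i := fun n => 2 * n) fun a b hab => by simpa using hab
  · exact hg.comp_injective (i := fun n => 2 * n + 1) fun a b hab => by simpa using hab

/-- The Jacobi triple product for `ϑ₀(v; iy)`, `v` real. -/
theorem theta0_eq_exp (hy : 0 < y) (v : ℝ) :
    theta0 v (I * y)
      = ((Real.exp (logEta y + logTheta v (y / 2) - logTheta v y) : ℝ) : ℂ) := by
  set r := Real.exp (-(π * y)) with hr
  have hτ : 0 < (I * (y : ℂ)).im := by rw [im_I_mul]; exact hy
  have h := tendsto_triple_product (v + 1 / 2) hτ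
  rw [eulerProd_eq_exp hy] at h
  have hq : cexp (π * I * (I * y)) = (r : ℂ) := by
    rw [hr]
    push_cast
    congr 1
    linear_combination (π * y : ℂ) * I_mul_I
  rw [hq] at h
  set ζ := cexp (I * (2 * π * v : ℝ)) with hζ
  have hw : cexp (2 * π * I * (v + 1 / 2)) = -ζ := by
    rw [hζ, ← Complex.exp_add_pi_mul_I]
    congr 1
    push_cast; ring
  rw [hw] at h
  have hfac : ∀ m, (∏ n ∈ Finset.range m, ((1 + (r : ℂ) ^ (2 * n + 1) * (-ζ))
      * (1 + (r : ℂ) ^ (2 * n + 1) * (-ζ)⁻¹)))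
      = ((∏ n ∈ Finset.range m,
        (1 - 2 * r ^ (2 * n + 1) * Real.cos (2 * π * v) + (r ^ (2 * n + 1)) ^ 2) : ℝ) : ℂ) := by
    intro m
    rw [Complex.ofReal_prod]
    refine Finset.prod_congr rfl fun n _ => ?_
    rw [← theta_factor_eq, ← hζ, inv_neg]
    push_cast
    ring
  simp_rw [hfac] at h
  have hr1 : r < 1 := by
    rw [hr, Real.exp_lt_one_iff, neg_lt_zero]; have := Real.pi_pos; positivity
  have hr0 : 0 < r := Real.exp_pos _
  have hs0 : Summable fun n : ℕ => r ^ n := summable_geometric_of_lt_one hr0.le hr1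
  have hs1 : Summable fun n : ℕ => r ^ (2 * n + 1) :=
    hs0.comp_injective (i := fun n => 2 * n + 1) fun a b hab => by simpa using hab
  have hR := (Complex.continuous_ofReal.tendsto _).comp (tendsto_theta_factor
    (p := fun n => r ^ (2 * n + 1)) (fun n => (pow_pos hr0 _).le)
    (fun n => pow_lt_one₀ hr0.le hr1 (by omega)) hs1 (2 * π * v))
  have huniq := tendsto_nhds_unique h hR
  -- The exponents `n + 1` split into the odd ones, which make up `ϑ₀`, and the even ones.
  have hhalf : Real.exp (-(2 * π * (y / 2))) = r := by rw [hr]; ring_nf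
  have hsq : Real.exp (-(2 * π * y)) = r ^ 2 := by
    rw [hr, ← Real.exp_nat_mul]; push_cast; ring_nf
  have hsum : Summable fun n : ℕ =>
      Real.log (1 - 2 * r ^ (n + 1) * Real.cos (2 * π * v) + (r ^ (n + 1)) ^ 2) :=
    summable_log_theta_factor (fun n => (pow_pos hr0 _).le)
      (fun n => pow_lt_one₀ hr0.le hr1 (by omega)) ((summable_nat_add_iff 1).mpr hs0) _
  have hsplit := tsum_succ_eq_odd_add_even
    (g := fun n => Real.log (1 - 2 * r ^ n * Real.cos (2 * π * v) + (r ^ n) ^ 2)) hsum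
  rw [theta0_eq_jacobiTheta₂]
  unfold logEta logTheta
  rw [hhalf, hsq, hsplit]
  have e : ∀ n : ℕ, (r ^ 2) ^ (n + 1) = r ^ (2 * n + 2) := fun n => by
    rw [← pow_mul]; ring_nf
  simp_rw [hsq] at huniq
  simp_rw [e] at huniq ⊢
  rw [show ∀ a b c : ℝ, -(π * y / 12) + a + (-(π * (y / 2) / 6) + (b + c)) - (-(π * y / 6) + c)
    = a + b by intros; ring]
  rw [Real.exp_add, Complex.ofReal_mul, ← huniq]
  rw [mul_inv_cancel_left₀ (Complex.ofReal_ne_zero.mpr (Real.exp_pos _).ne')]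

theorem summable_exp_shift (hy : 0 < y) (a : ℝ) :
    Summable fun n : ℕ => Real.exp (-(2 * π * y * (n + a))) := by
  have h := (summable_geometric_of_lt_one (Real.exp_pos _).le (nome_lt_one hy)).mul_left
    (Real.exp (-(2 * π * y * a)))
  refine h.congr fun n => ?_
  rw [← Real.exp_nat_mul, ← Real.exp_add]
  ring_nf

theorem summable_log_shift (hy : 0 < y) (a : ℝ) :
    Summable fun n : ℕ => Real.log (1 + Real.exp (-(2 * π * y * (n + a)))) :=
  Real.summable_log_one_add_of_summable (summable_exp_shift hy a)

/-- The Jacobi triple product for `ϑ₁` on the line `1 / 2 + iℝ`. -/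
theorem theta1_imag_eq_exp (hy : 0 < y) (a : ℝ) :
    cexp (π * I * (I * y) * a ^ 2) * theta1 (a * (I * y) + 1 / 2) (I * y)
      = ((Real.exp (logEta y + logThetaImag a y) : ℝ) : ℂ) := by
  have hτ : 0 < (I * (y : ℂ)).im := by rw [im_I_mul]; exact hy
  have h := tendsto_triple_product (a * (I * y) + 1 / 2 + 1 / 2 - I * y / 2) hτ
  rw [eulerProd_eq_exp hy] at h
  have hq : ∀ n : ℕ, cexp (π * I * (I * y)) ^ (2 * n + 1) = cexp (-(π * y) * (2 * n + 1)) := by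
    intro n
    rw [← Complex.exp_nat_mul]
    congr 1
    push_cast
    linear_combination (2 * n + 1) * (π * y : ℂ) * I_mul_I
  have hw : cexp (2 * π * I * (a * (I * y) + 1 / 2 + 1 / 2 - I * y / 2))
      = cexp (-(π * y) * (2 * a - 1)) := by
    rw [← Complex.exp_periodic (-(π * y) * (2 * a - 1))]
    congr 1
    linear_combination (2 * a - 1) * (π * y : ℂ) * I_mul_I
  simp only [hw, hq] at h
  have hfac : ∀ m, (∏ n ∈ Finset.range m, ((1 + cexp (-(π * y) * (2 * n + 1))
      * cexp (-(π * y) * (2 * a - 1)))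
      * (1 + cexp (-(π * y) * (2 * n + 1)) * (cexp (-(π * y) * (2 * a - 1)))⁻¹)))
      = (((∏ n ∈ Finset.range m, (1 + Real.exp (-(2 * π * y * (n + a)))))
        * ∏ n ∈ Finset.range m, (1 + Real.exp (-(2 * π * y * (n + (1 - a))))) : ℝ) : ℂ) := by
    intro m
    push_cast
    rw [← Finset.prod_mul_distrib]
    refine Finset.prod_congr rfl fun n _ => ?_
    rw [← Complex.exp_neg, ← Complex.exp_add, ← Complex.exp_add]
    ring_nf
  simp_rw [hfac] at h
  have hR := (Complex.continuous_ofReal.tendsto _).comp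
    ((tendsto_prod_exp_tsum_log (summable_exp_shift hy a) fun n => by positivity).mul
      (tendsto_prod_exp_tsum_log (summable_exp_shift hy (1 - a)) fun n => by positivity))
  have huniq := tendsto_nhds_unique h hR
  rw [theta1_eq_jacobiTheta₂]
  unfold logEta logThetaImag logShiftedProd
  rw [show ∀ b c d : ℝ, -(π * y / 12) + b + (-(π * y * (a ^ 2 - a + 1 / 6)) + c + d)
    = -(π * y * (a - 1 / 2) ^ 2) + b + (c + d) by intros; ring, Real.exp_add, Real.exp_add,
    Complex.ofReal_mul, Complex.ofReal_mul, Real.exp_add (∑' _, _), ← huniq,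
    mul_assoc ((Real.exp (-(π * y * (a - 1 / 2) ^ 2)) : ℝ) : ℂ),
    mul_inv_cancel_left₀ (Complex.ofReal_ne_zero.mpr (Real.exp_pos _).ne')]
  have e1 : cexp (π * I * (I * y) * a ^ 2) * (I * cexp (π * I * (I * y) / 4
      - π * I * (a * (I * y) + 1 / 2))) = ((Real.exp (-(π * y * (a - 1 / 2) ^ 2)) : ℝ) : ℂ) := by
    have e2 : I = cexp (π * I / 2) := by
      rw [show (π * I / 2 : ℂ) = π / 2 * I by ring, Complex.exp_pi_div_two_mul_I]
    rw [show ∀ x z : ℂ, x * (I * z) = x * (cexp (π * I / 2) * z) from fun x z => by rw [← e2],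
      ← Complex.exp_add, ← Complex.exp_add]
    push_cast
    congr 1
    linear_combination (π * y * (a - 1 / 2) ^ 2 : ℂ) * I_mul_I
  rw [← e1]
  ring

end

/-! ### Distribution relations and special values -/

section

variable {y : ℝ}

theorem logTheta_neg (v y : ℝ) : logTheta (-v) y = logTheta v y := by
  unfold logTheta
  simp_rw [mul_neg, Real.cos_neg]

theorem logTheta_add_one (v y : ℝ) : logTheta (v + 1) y = logTheta v y := by
  unfold logTheta
  have : Real.cos (2 * π * (v + 1)) = Real.cos (2 * π * v) := by
    rw [mul_add, mul_one, Real.cos_add_two_pi]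
  simp_rw [this]

theorem logTheta_add_int (v y : ℝ) (n : ℤ) : logTheta (v + n) y = logTheta v y := by
  have : Function.Periodic (fun v => logTheta v y) 1 := fun v => logTheta_add_one v y
  simpa using this.int_mul n v

theorem prod_one_sub_mul_pow {n : ℕ} (hn : 0 < n) {ω : ℂ} (hω : IsPrimitiveRoot ω n) (z : ℂ) :
    ∏ b ∈ Finset.range n, (1 - z * ω ^ b) = 1 - z ^ n := by
  have h := hω.pow_sub_pow_eq_prod_sub_mul 1 z hn
  rw [one_pow] at h
  rw [h]
  refine Finset.prod_nbij (fun b => ω ^ b) (fun b _ => ?_) (fun b hb c hc hbc => ?_)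
    (fun μ hμ => ?_) (fun b _ => by rw [mul_comm])
  · rw [Polynomial.mem_nthRootsFinset hn, ← pow_mul, mul_comm, pow_mul, hω.pow_eq_one, one_pow]
  · exact hω.pow_inj (Finset.mem_range.mp hb) (Finset.mem_range.mp hc) hbc
  · have : NeZero n := ⟨hn.ne'⟩
    obtain ⟨b, hb, rfl⟩ := hω.eq_pow_of_pow_eq_one ((Polynomial.mem_nthRootsFinset hn _).mp hμ)
    exact ⟨b, Finset.mem_coe.mpr (Finset.mem_range.mpr hb), rfl⟩

/-- The product of the quadratic factors over a full grid of `n`-division points. -/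
theorem prod_theta_factor (n : ℕ) (hn : 0 < n) (p v : ℝ) :
    ∏ b ∈ Finset.range n, (1 - 2 * p * Real.cos (2 * π * (v + b / n)) + p ^ 2)
      = 1 - 2 * p ^ n * Real.cos (2 * π * (n * v)) + (p ^ n) ^ 2 := by
  have hω := Complex.isPrimitiveRoot_exp n hn.ne'
  have hn' : (n : ℂ) ≠ 0 := by exact_mod_cast hn.ne'
  set ω := cexp (2 * π * I / n) with hωdef
  have e : ∀ b : ℕ, cexp (I * (2 * π * (v + b / n) : ℝ)) = cexp (I * (2 * π * v : ℝ)) * ω ^ b := by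
    intro b
    rw [hωdef, ← Complex.exp_nat_mul, ← Complex.exp_add]
    congr 1
    push_cast
    field_simp
  apply Complex.ofReal_injective
  rw [Complex.ofReal_prod, ← theta_factor_eq]
  simp_rw [← theta_factor_eq, e, mul_inv, ← inv_pow, ← mul_assoc]
  rw [Finset.prod_mul_distrib, prod_one_sub_mul_pow hn hω, prod_one_sub_mul_pow hn hω.inv]
  have e2 : cexp (I * (2 * π * n * v : ℝ)) = cexp (I * (2 * π * v : ℝ)) ^ n := by
    rw [← Complex.exp_nat_mul]
    congr 1
    push_cast
    ring
  rw [e2, mul_pow, mul_pow, inv_pow]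
  push_cast
  ring

/-- The distribution relation under multiplication of the argument and the modulus by `n`, which
comes from `prod_theta_factor` applied to each factor of the infinite product. -/
theorem logTheta_distribution (hy : 0 < y) (n : ℕ) (hn : 0 < n) (v : ℝ) :
    ∑ b ∈ Finset.range n, logTheta (v + b / n) y = logTheta (n * v) (n * y) := by
  unfold logTheta
  rw [Finset.sum_add_distrib, ← Summable.tsum_finsetSum]
  · congr 1
    · simp; ring
    · refine tsum_congr fun m => ?_
      rw [← Real.log_prod]
      · rw [prod_theta_factor n hn, ← pow_mul, mul_comm (m + 1) n, pow_mul, ← Real.exp_nat_mul]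
        ring_nf
      · intro b _
        exact (theta_factor_pos (pow_pos (Real.exp_pos _) _).le (nome_pow_lt_one hy m) _).ne'
  · intro b _
    exact summable_log_theta_factor (fun n => (pow_pos (Real.exp_pos _) _).le)
      (nome_pow_lt_one hy) (summable_nome hy) _

/-- The indices of the product are sorted by their residues modulo `n`. -/
theorem logShiftedProd_distribution (hy : 0 < y) (n : ℕ) (hn : 0 < n) (a : ℝ) :
    ∑ b ∈ Finset.range n, logShiftedProd ((a + b) / n) (n * y) = logShiftedProd a y := by
  have : NeZero n := ⟨hn.ne'⟩
  unfold logShiftedProd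
  have hs := summable_log_shift hy a
  rw [← (Nat.divModEquiv n).symm.tsum_eq]
  have hs2 := (Nat.divModEquiv n).symm.summable_iff.mpr hs
  simp only [Function.comp_def] at hs2
  rw [hs2.tsum_prod]
  simp_rw [tsum_fintype]
  rw [Summable.tsum_finsetSum, Finset.sum_range]
  · refine Finset.sum_congr rfl fun b _ => tsum_congr fun m => ?_
    congr 3
    simp only [Nat.divModEquiv_symm_apply]
    push_cast
    have : (n : ℝ) ≠ 0 := by exact_mod_cast hn.ne'
    field_simp
    ring
  · intro b _
    refine hs.comp_injective (i := fun m => (Nat.divModEquiv n).symm (m, b)) ?_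
    intro c d hcd
    simpa using (Nat.divModEquiv n).symm.injective hcd

theorem logThetaImag_one_sub (a y : ℝ) : logThetaImag (1 - a) y = logThetaImag a y := by
  unfold logThetaImag
  rw [sub_sub_cancel]
  ring

theorem sum_range_bernoulli (n : ℕ) (hn : 0 < n) (a : ℝ) :
    ∑ b ∈ Finset.range n, (n * (((a + b) / n) ^ 2 - (a + b) / n + 1 / 6) : ℝ)
      = a ^ 2 - a + 1 / 6 := by
  have h : ∀ m : ℕ, ∑ b ∈ Finset.range m, ((a + b) ^ 2 - n * (a + b) + n ^ 2 / 6 : ℝ)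
      = m * a ^ 2 + a * m * (m - 1) + m * (m - 1) * (2 * m - 1) / 6 - n * (m * a + m * (m - 1) / 2)
        + m * n ^ 2 / 6 := by
    intro m
    induction m with
    | zero => simp
    | succ m ih => rw [Finset.sum_range_succ, ih]; push_cast; ring
  have hn' : (n : ℝ) ≠ 0 := by exact_mod_cast hn.ne'
  have e : ∀ b : ℕ, (n * (((a + b) / n) ^ 2 - (a + b) / n + 1 / 6) : ℝ)
      = ((a + b) ^ 2 - n * (a + b) + n ^ 2 / 6) / n := by
    intro b; field_simp
  simp_rw [e]
  rw [← Finset.sum_div, h n]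
  field_simp
  ring

/-- The distribution relation in the imaginary direction. The quadratic terms in the definition of
`logThetaImag` are Bernoulli polynomials, which satisfy the same relation. -/
theorem logThetaImag_distribution (hy : 0 < y) (n : ℕ) (hn : 0 < n) (a : ℝ) :
    ∑ b ∈ Finset.range n, logThetaImag ((a + b) / n) (n * y) = logThetaImag a y := by
  have hn' : (n : ℝ) ≠ 0 := by exact_mod_cast hn.ne'
  unfold logThetaImag
  rw [Finset.sum_add_distrib, Finset.sum_add_distrib, logShiftedProd_distribution hy n hn]
  congr 1
  · congr 1
    rw [← sum_range_bernoulli n hn a, Finset.mul_sum, ← Finset.sum_neg_distrib]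
    exact Finset.sum_congr rfl fun b _ => by ring
  · rw [← logShiftedProd_distribution hy n hn, ← Finset.sum_range_reflect]
    refine Finset.sum_congr rfl fun b hb => ?_
    have hb' : b < n := Finset.mem_range.mp hb
    congr 1
    rw [Nat.sub_sub, Nat.cast_sub (by omega)]
    push_cast
    field_simp
    ring

theorem logTheta_zero (hy : 0 < y) : logTheta 0 y = 2 * logEta y := by
  unfold logTheta logEta
  rw [mul_add, ← tsum_mul_left]
  congr 1
  · ring
  · refine tsum_congr fun n => ?_
    have : 0 < 1 - Real.exp (-(2 * π * y)) ^ (n + 1) := sub_pos.mpr (nome_pow_lt_one hy n)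
    rw [two_mul (Real.log _), ← Real.log_mul this.ne' this.ne']
    congr 1
    rw [mul_zero, Real.cos_zero]
    ring

theorem logTheta_half (hy : 0 < y) :
    logTheta (1 / 2) y = 2 * logEta (2 * y) - 2 * logEta y := by
  have h := logTheta_distribution hy 2 two_pos 0
  simp only [Finset.sum_range_succ, Finset.sum_range_zero, Nat.cast_zero, Nat.cast_one,
    Nat.cast_ofNat, mul_zero, zero_div, zero_add] at h
  rw [logTheta_zero hy, logTheta_zero (by positivity)] at h
  linarith

theorem logThetaImag_zero (hy : 0 < y) :
    logThetaImag 0 y = Real.log 2 + 2 * logEta (2 * y) - 2 * logEta y := by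
  rw [add_sub_assoc, ← logTheta_half hy]
  unfold logThetaImag logTheta logShiftedProd
  rw [(summable_log_shift hy 0).tsum_eq_zero_add]
  have e : ∀ n : ℕ, Real.log (1 - 2 * Real.exp (-(2 * π * y)) ^ (n + 1)
      * Real.cos (2 * π * (1 / 2)) + (Real.exp (-(2 * π * y)) ^ (n + 1)) ^ 2)
      = 2 * Real.log (1 + Real.exp (-(2 * π * y * (n + (1 - 0))))) := by
    intro n
    rw [← Real.exp_nat_mul, two_mul (Real.log _), ← Real.log_mul (by positivity) (by positivity),
      show 2 * π * (1 / 2) = π by ring, Real.cos_pi]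
    push_cast
    ring_nf
  simp_rw [e, tsum_mul_left]
  simp
  norm_num
  ring

theorem logThetaImag_half (hy : 0 < y) :
    logThetaImag (1 / 2) y = logThetaImag 0 (y / 2) - logThetaImag 0 y := by
  have h := logThetaImag_distribution (y := y / 2) (by positivity) 2 two_pos 0
  simp only [Finset.sum_range_succ, Finset.sum_range_zero, Nat.cast_zero, Nat.cast_one,
    Nat.cast_ofNat, zero_div, zero_add] at h
  rw [show 2 * (y / 2) = y by ring] at h
  linarith

end

/-! ### Sums over division points -/

theorem sum_range_two_mul_of_reflect {h : ℕ → ℝ} (n : ℕ) (hh : ∀ b < 2 * n, h (2 * n - 1 - b) = h b) :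
    ∑ b ∈ Finset.range (2 * n), h b = 2 * ∑ b ∈ Finset.range n, h b := by
  rw [two_mul n, Finset.sum_range_add, two_mul]
  congr 1
  rw [← Finset.sum_range_reflect]
  refine Finset.sum_congr rfl fun b hb => ?_
  have := Finset.mem_range.mp hb
  rw [← hh b (by omega)]
  congr 1
  omega

theorem sum_range_two_mul_add_one_of_reflect {h : ℕ → ℝ} (n : ℕ)
    (hh : ∀ b < 2 * n + 1, h (2 * n - b) = h b) :
    ∑ b ∈ Finset.range (2 * n + 1), h b = 2 * ∑ b ∈ Finset.range n, h b + h n := by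
  rw [show 2 * n + 1 = (n + 1) + n by ring, Finset.sum_range_add, Finset.sum_range_succ]
  rw [← Finset.sum_range_reflect (fun x => h (n + 1 + x))]
  have : ∑ b ∈ Finset.range n, h (n + 1 + (n - 1 - b)) = ∑ b ∈ Finset.range n, h b := by
    refine Finset.sum_congr rfl fun b hb => ?_
    have := Finset.mem_range.mp hb
    rw [← hh b (by omega)]
    congr 1
    omega
  rw [this]
  ring

/-- The points `x 0, …, x (N - 1)` form half of the grid `(b + δ) / M`, `b` modulo `M`, under the
reflection `t ↦ 1 - t`, up to the multiplicities of the fixed points `0` and `1 / 2`. -/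
def HalfGrid (N : ℕ) (x : ℕ → ℝ) (M : ℕ) (δ c d : ℝ) : Prop :=
  ∀ φ : ℝ → ℝ, (∀ t, φ (1 - t) = φ t) → 2 * ∑ k ∈ Finset.range N, φ (x k)
    = ∑ b ∈ Finset.range M, φ ((b + δ) / M) + c * φ 0 + d * φ (1 / 2)

/-- The points `1 / (4N), 3 / (4N), …, (2N - 1) / (4N)`. -/
theorem halfGrid_half_even {N M : ℕ} (hN : 0 < N) (hM : M = 2 * N) :
    HalfGrid N (fun k => (k + 1 / 2) / M) M (1 / 2) 0 0 := by
  intro φ hφ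
  have hM0 : (M : ℝ) ≠ 0 := by
    have : M ≠ 0 := by omega
    exact_mod_cast this
  have := sum_range_two_mul_of_reflect (h := fun b => φ ((b + 1 / 2) / M)) N fun b hb => by
    rw [← hφ, Nat.sub_sub, Nat.cast_sub (by omega)]
    congr 1
    field_simp
    rw [hM]; push_cast; ring
  rw [← this, hM]
  simp

/-- The odd multiples of `1 / (4N - 2)` up to `1 / 2`. -/
theorem halfGrid_half_odd {N M : ℕ} (hN : 0 < N) (hM : M + 1 = 2 * N) :
    HalfGrid N (fun k => (k + 1 / 2) / M) M (1 / 2) 0 1 := by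
  intro φ hφ
  obtain ⟨n, rfl⟩ : ∃ n, N = n + 1 := ⟨N - 1, by omega⟩
  obtain rfl : M = 2 * n + 1 := by omega
  have hM0 : ((2 * n + 1 : ℕ) : ℝ) ≠ 0 := by positivity
  have := sum_range_two_mul_add_one_of_reflect
    (h := fun b => φ ((b + 1 / 2) / (2 * n + 1 : ℕ))) n fun b hb => by
    rw [← hφ, Nat.cast_sub (by omega)]
    congr 1
    field_simp
    push_cast; ring
  have hhalf : ((n : ℝ) + 1 / 2) / (2 * n + 1 : ℕ) = 1 / 2 := by
    field_simp
    push_cast; ring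
  beta_reduce
  rw [this, Finset.sum_range_succ, hhalf]
  ring

/-- Pairing of `b / M` with `1 - b / M` for even `M = 2n + 2`, with fixed points `0` and `1 / 2`.
The summand `0` gives the left-hand side the form used in `HalfGrid`. -/
theorem sum_division_even (φ : ℝ → ℝ) (hφ : ∀ t, φ (1 - t) = φ t) (n : ℕ) :
    ∑ b ∈ Finset.range (2 * n + 2), φ ((b + 0) / (2 * n + 2 : ℕ))
      = φ 0 + 2 * ∑ b ∈ Finset.range n, φ ((b + 1 : ℕ) / (2 * n + 2 : ℕ)) + φ (1 / 2) := by
  have hM0 : ((2 * n + 2 : ℕ) : ℝ) ≠ 0 := by positivity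
  have := sum_range_two_mul_add_one_of_reflect
    (h := fun b => φ ((b + 1 : ℕ) / (2 * n + 2 : ℕ))) n fun b hb => by
    rw [← hφ, Nat.cast_add, Nat.cast_sub (by omega)]
    congr 1
    field_simp
    push_cast; ring
  have hhalf : ((n + 1 : ℕ) : ℝ) / (2 * n + 2 : ℕ) = 1 / 2 := by
    field_simp
    push_cast; ring
  simp only [hhalf, add_zero] at this ⊢
  rw [show 2 * n + 2 = 2 * n + 1 + 1 by ring] at this ⊢
  rw [Finset.sum_range_succ', this]
  simp
  ring

theorem sum_division_odd (φ : ℝ → ℝ) (hφ : ∀ t, φ (1 - t) = φ t) (n : ℕ) :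
    ∑ b ∈ Finset.range (2 * n + 1), φ ((b + 0) / (2 * n + 1 : ℕ))
      = φ 0 + 2 * ∑ b ∈ Finset.range n, φ ((b + 1 : ℕ) / (2 * n + 1 : ℕ)) := by
  have hM0 : ((2 * n + 1 : ℕ) : ℝ) ≠ 0 := by positivity
  have := sum_range_two_mul_of_reflect
    (h := fun b => φ ((b + 1 : ℕ) / (2 * n + 1 : ℕ))) n fun b hb => by
    rw [← hφ, Nat.cast_add, Nat.sub_sub, Nat.cast_sub (by omega)]
    congr 1
    field_simp
    push_cast; ring
  simp only [add_zero] at this ⊢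
  rw [Finset.sum_range_succ', this]
  simp
  ring

/-- The points `1 / (2N + 2), …, N / (2N + 2)`, which avoid both fixed points. -/
theorem halfGrid_interior_even {N M : ℕ} (hM : M = 2 * N + 2) :
    HalfGrid N (fun k => (k + 1 : ℕ) / M) M 0 (-1) (-1) := by
  intro φ hφ
  rw [hM, sum_division_even φ hφ N]
  ring

/-- The points `1 / (2N + 1), …, N / (2N + 1)`. -/
theorem halfGrid_interior_odd {N M : ℕ} (hM : M = 2 * N + 1) :
    HalfGrid N (fun k => (k + 1 : ℕ) / M) M 0 (-1) 0 := by
  intro φ hφ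
  rw [hM, sum_division_odd φ hφ N]
  ring

/-- The points `1 / (2N), …, N / (2N)`. -/
theorem halfGrid_pos_even {N M : ℕ} (hN : 0 < N) (hM : M = 2 * N) :
    HalfGrid N (fun k => (k + 1 : ℕ) / M) M 0 (-1) 1 := by
  intro φ hφ
  obtain ⟨n, rfl⟩ : ∃ n, N = n + 1 := ⟨N - 1, by omega⟩
  obtain rfl : M = 2 * n + 2 := by omega
  have hhalf : ((n + 1 : ℕ) : ℝ) / (2 * n + 2 : ℕ) = 1 / 2 := by
    push_cast; field_simp
  beta_reduce
  rw [sum_division_even φ hφ n, Finset.sum_range_succ, hhalf]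
  ring

/-- The points `0, 1 / (2N - 2), …, (N - 1) / (2N - 2)`. -/
theorem halfGrid_closed_even {N M : ℕ} (hN : 2 ≤ N) (hM : M + 2 = 2 * N) :
    HalfGrid N (fun k => k / M) M 0 1 1 := by
  intro φ hφ
  obtain ⟨n, rfl⟩ : ∃ n, N = n + 2 := ⟨N - 2, by omega⟩
  obtain rfl : M = 2 * n + 2 := by omega
  have hhalf : ((n + 1 : ℕ) : ℝ) / (2 * n + 2 : ℕ) = 1 / 2 := by
    push_cast; field_simp
  beta_reduce
  rw [sum_division_even φ hφ n, Finset.sum_range_succ, Finset.sum_range_succ', hhalf,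
    Nat.cast_zero, zero_div]
  ring

/-- The points `0, 1 / (2N - 1), …, (N - 1) / (2N - 1)`. -/
theorem halfGrid_closed_odd {N M : ℕ} (hN : 0 < N) (hM : M + 1 = 2 * N) :
    HalfGrid N (fun k => k / M) M 0 1 0 := by
  intro φ hφ
  obtain ⟨n, rfl⟩ : ∃ n, N = n + 1 := ⟨N - 1, by omega⟩
  obtain rfl : M = 2 * n + 1 := by omega
  beta_reduce
  rw [sum_division_odd φ hφ n, Finset.sum_range_succ', Nat.cast_zero, zero_div]
  ring

/-- The points `0, 1 / (2N), …, (N - 1) / (2N)`. -/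
theorem halfGrid_nonneg_even {N M : ℕ} (hN : 0 < N) (hM : M = 2 * N) :
    HalfGrid N (fun k => k / M) M 0 1 (-1) := by
  intro φ hφ
  obtain ⟨n, rfl⟩ : ∃ n, N = n + 1 := ⟨N - 1, by omega⟩
  obtain rfl : M = 2 * n + 2 := by omega
  beta_reduce
  rw [sum_division_even φ hφ n, Finset.sum_range_succ', Nat.cast_zero, zero_div]
  ring

section

variable {N M : ℕ} {x : ℕ → ℝ} {δ c d y : ℝ}

theorem logTheta_one_sub (v y : ℝ) : logTheta (1 - v) y = logTheta v y := by
  rw [← logTheta_neg, neg_sub, ← logTheta_add_one, sub_add_cancel]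

theorem sum_logTheta_grid (hy : 0 < y) (hM : 0 < M) (v δ : ℝ) :
    ∑ b ∈ Finset.range M, logTheta (v + (b + δ) / M) y = logTheta (M * v + δ) (M * y) := by
  have hM0 : (M : ℝ) ≠ 0 := by exact_mod_cast hM.ne'
  rw [show (M * v + δ) = M * (v + δ / M) by field_simp, ← logTheta_distribution hy M hM]
  refine Finset.sum_congr rfl fun b _ => ?_
  congr 1
  ring

theorem HalfGrid.sum_logTheta (h : HalfGrid N x M δ c d) (hM : 0 < M) (hy : 0 < y) :
    2 * ∑ k ∈ Finset.range N, logTheta (x k) y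
      = logTheta δ (M * y) + c * logTheta 0 y + d * logTheta (1 / 2) y := by
  rw [h (fun t => logTheta t y) fun t => logTheta_one_sub t y]
  have := sum_logTheta_grid hy hM 0 δ
  simp only [zero_add, mul_zero] at this
  rw [this]

theorem HalfGrid.sum_logTheta_add_half (h : HalfGrid N x M δ c d) (hM : 0 < M) (hy : 0 < y) :
    2 * ∑ k ∈ Finset.range N, logTheta (x k + 1 / 2) y
      = logTheta (M / 2 + δ) (M * y) + c * logTheta (1 / 2) y + d * logTheta 0 y := by
  rw [h (fun t => logTheta (t + 1 / 2) y) fun t => by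
    rw [← logTheta_one_sub (t + 1 / 2), ← logTheta_add_one (1 - (t + 1 / 2))]
    congr 1
    ring]
  have := sum_logTheta_grid hy hM (1 / 2) δ
  have e : ∀ b : ℕ, logTheta ((b + δ) / M + 1 / 2) y = logTheta (1 / 2 + (b + δ) / M) y :=
    fun b => by rw [add_comm]
  simp_rw [e, this]
  rw [show (1 / 2 + 1 / 2 : ℝ) = 0 + 1 by norm_num, logTheta_add_one, zero_add]
  congr 4
  ring

theorem logTheta_two_mul (hy : 0 < y) (v : ℝ) :
    logTheta (2 * v) y = logTheta v (y / 2) + logTheta (v + 1 / 2) (y / 2) := by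
  have h := logTheta_distribution (y := y / 2) (by positivity) 2 two_pos v
  simp only [Finset.sum_range_succ, Finset.sum_range_zero, Nat.cast_zero, Nat.cast_one,
    Nat.cast_ofNat, zero_div, add_zero, zero_add] at h
  rw [show 2 * (y / 2) = y by ring] at h
  exact h.symm

theorem sum_Ioi_of_symm {G : Fin N → Fin N → ℝ} (hG : ∀ j k, G j k = G k j) :
    2 * ∑ j, ∑ k ∈ Finset.Ioi j, G k j = ∑ j, ∑ k, G j k - ∑ j, G j j := by
  have h := Finset.sum_sum_Ioi_add_eq_sum_sum_off_diag G
  have h1 : ∑ j, ∑ k ∈ Finset.Ioi j, (G k j + G j k) = 2 * ∑ j, ∑ k ∈ Finset.Ioi j, G k j := by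
    rw [Finset.mul_sum]
    refine Finset.sum_congr rfl fun j _ => ?_
    rw [Finset.mul_sum]
    exact Finset.sum_congr rfl fun k _ => by rw [hG j k]; ring
  rw [← h1, h, ← Finset.sum_sub_distrib]
  refine Finset.sum_congr rfl fun j _ => ?_
  have := Finset.sum_compl_add_sum {j} (fun k => G j k)
  rw [Finset.sum_singleton] at this
  rw [← this]
  simp only [add_sub_cancel_right]
  exact Finset.sum_congr rfl fun k _ => hG k j

/-- The sum over pairs of points of a half grid: for each fixed `x_k` the points `±x_j` run
through the full grid, up to the fixed points of the reflection. -/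
theorem HalfGrid.sum_pairs (h : HalfGrid N x M δ c d) (hM : 0 < M) (hy : 0 < y)
    (hδ : ∃ n : ℤ, 2 * δ = n) (hx : ∀ k < N, ∃ n : ℤ, M * x k = n + δ) :
    2 * ∑ j : Fin N, ∑ k ∈ Finset.Ioi j, (logTheta (x k - x j) y + logTheta (x k + x j) y)
      = N * logTheta 0 (M * y) + c * ∑ k ∈ Finset.range N, logTheta (x k) y
        + d * ∑ k ∈ Finset.range N, logTheta (x k + 1 / 2) y - N * logTheta 0 y
        - ∑ k ∈ Finset.range N, logTheta (2 * x k) y := by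
  rw [sum_Ioi_of_symm (G := fun k j => logTheta (x k - x j) y + logTheta (x k + x j) y)
    fun j k => by rw [← logTheta_neg (x k - x j), neg_sub, add_comm (x j)]]
  have key : ∀ k < N, ∑ j : Fin N, (logTheta (x k - x j) y + logTheta (x k + x j) y)
      = logTheta 0 (M * y) + c * logTheta (x k) y + d * logTheta (x k + 1 / 2) y := by
    intro k hk
    rw [← Finset.sum_range fun j => logTheta (x k - x j) y + logTheta (x k + x j) y]
    have h1 := h (fun t => logTheta (x k - t) y + logTheta (x k + t) y) fun t => by
      rw [add_comm]
      congr 1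
      · rw [← logTheta_add_one (x k - t)]; congr 1; ring
      · rw [← logTheta_add_one (x k - (1 - t))]; congr 1; ring
    rw [Finset.sum_add_distrib (s := Finset.range M)] at h1
    have e : ∀ b : ℕ, logTheta (x k - (b + δ) / M) y = logTheta (-x k + (b + δ) / M) y := by
      intro b; rw [← logTheta_neg]; congr 1; ring
    simp_rw [e] at h1
    rw [sum_logTheta_grid hy hM, sum_logTheta_grid hy hM] at h1
    obtain ⟨n, hn⟩ := hx k hk
    obtain ⟨m, hm⟩ := hδ
    have e1 : logTheta (M * x k + δ) (M * y) = logTheta 0 (M * y) := by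
      rw [hn, show (n + δ + δ : ℝ) = 0 + ((n + m : ℤ) : ℝ) by push_cast; linarith,
        logTheta_add_int]
    have e2 : logTheta (M * -x k + δ) (M * y) = logTheta 0 (M * y) := by
      rw [mul_neg, hn, show (-(n + δ) + δ : ℝ) = 0 + ((-n : ℤ) : ℝ) by push_cast; ring,
        logTheta_add_int]
    have e3 : logTheta (x k - 1 / 2) y = logTheta (x k + 1 / 2) y := by
      rw [← logTheta_add_one]; congr 1; ring
    rw [e1, e2, e3, sub_zero, add_zero] at h1
    linarith
  have h2 : ∑ k : Fin N, ∑ j : Fin N, (logTheta (x k - x j) y + logTheta (x k + x j) y)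
      = N * logTheta 0 (M * y) + c * ∑ k ∈ Finset.range N, logTheta (x k) y
        + d * ∑ k ∈ Finset.range N, logTheta (x k + 1 / 2) y := by
    rw [Finset.sum_congr rfl fun (k : Fin N) _ => key k k.2,
      ← Finset.sum_range fun k => logTheta 0 (M * y) + c * logTheta (x k) y
        + d * logTheta (x k + 1 / 2) y, Finset.sum_add_distrib, Finset.sum_add_distrib,
      Finset.mul_sum, Finset.mul_sum]
    simp
  have h3 : ∑ k : Fin N, (logTheta (x k - x k) y + logTheta (x k + x k) y)
      = N * logTheta 0 y + ∑ k ∈ Finset.range N, logTheta (2 * x k) y := by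
    rw [← Finset.sum_range fun k => logTheta (x k - x k) y + logTheta (x k + x k) y,
      Finset.sum_add_distrib]
    simp [two_mul]
  rw [h2, h3]
  ring

end

/-! ### The eta quotients -/

section

variable {N M : ℕ} {x : ℕ → ℝ} {δ c d y : ℝ}

theorem HalfGrid.sum_logThetaImag (h : HalfGrid N x M δ c d) (hM : 0 < M) (hy : 0 < y) :
    2 * ∑ k ∈ Finset.range N, logThetaImag (x k) (M * y)
      = logThetaImag δ y + c * logThetaImag 0 (M * y) + d * logThetaImag (1 / 2) (M * y) := by
  rw [h (fun t => logThetaImag t (M * y)) fun t => logThetaImag_one_sub t _,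
    ← logThetaImag_distribution hy M hM]
  simp_rw [add_comm δ]

theorem sum_logTheta_two_mul (hy : 0 < y) (N : ℕ) (x : ℕ → ℝ) :
    ∑ k ∈ Finset.range N, logTheta (2 * x k) y
      = ∑ k ∈ Finset.range N, logTheta (x k) (y / 2)
        + ∑ k ∈ Finset.range N, logTheta (x k + 1 / 2) (y / 2) := by
  rw [← Finset.sum_add_distrib]
  exact Finset.sum_congr rfl fun k _ => logTheta_two_mul hy _

theorem sum_Ioi_const (N : ℕ) (a : ℝ) :
    2 * ∑ j : Fin N, ∑ _k ∈ Finset.Ioi j, a = N * (N - 1) * a := by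
  rw [sum_Ioi_of_symm (G := fun _ _ => a) fun _ _ => rfl]
  simp
  ring

theorem logTheta_half_of_half (hy : 0 < y) :
    logTheta (1 / 2) (y / 2) = 2 * logEta y - 2 * logEta (y / 2) := by
  rw [logTheta_half (by positivity), mul_div_cancel₀ y two_ne_zero]

theorem logThetaImag_half_eq (hy : 0 < y) :
    logThetaImag (1 / 2) y = 4 * logEta y - 2 * logEta (y / 2) - 2 * logEta (2 * y) := by
  rw [logThetaImag_half hy, logThetaImag_zero hy, logThetaImag_zero (by positivity),
    mul_div_cancel₀ y two_ne_zero]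
  ring

/-- `HalfGrid.sum_pairs` with the factors `η(iy)` of the theta functions included. -/
theorem HalfGrid.sum_pairs_eta (h : HalfGrid N x M δ c d) (hM : 0 < M) (hy : 0 < y)
    (hδ : ∃ n : ℤ, 2 * δ = n) (hx : ∀ k < N, ∃ n : ℤ, M * x k = n + δ) :
    2 * ∑ j : Fin N, ∑ k ∈ Finset.Ioi j,
        ((logEta y + logTheta (x k - x j) y) + (logEta y + logTheta (x k + x j) y))
      = 2 * (N * (N - 1)) * logEta y + (N * logTheta 0 (M * y)
        + c * ∑ k ∈ Finset.range N, logTheta (x k) y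
        + d * ∑ k ∈ Finset.range N, logTheta (x k + 1 / 2) y - N * logTheta 0 y
        - ∑ k ∈ Finset.range N, logTheta (2 * x k) y) := by
  rw [← h.sum_pairs hM hy hδ hx]
  have h1 := sum_Ioi_const N (2 * logEta y)
  rw [show 2 * (N * (N - 1)) * logEta y = N * (N - 1) * (2 * logEta y) by ring, ← h1, ← mul_add,
    ← Finset.sum_add_distrib]
  congr 1
  refine Finset.sum_congr rfl fun j _ => ?_
  rw [← Finset.sum_add_distrib]
  exact Finset.sum_congr rfl fun k _ => by ring

theorem logTheta_nat_div_two {m : ℕ} (hm : m % 2 = 0) (v y : ℝ) :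
    logTheta (m / 2 + v) y = logTheta v y := by
  obtain ⟨n, rfl⟩ : ∃ n, m = 2 * n := ⟨m / 2, by omega⟩
  rw [← logTheta_add_int v y n]
  congr 1
  push_cast
  ring

theorem logTheta_nat_div_two_odd {m : ℕ} (hm : m % 2 = 1) (v y : ℝ) :
    logTheta (m / 2 + v) y = logTheta (1 / 2 + v) y := by
  obtain ⟨n, rfl⟩ : ∃ n, m = 2 * n + 1 := ⟨m / 2, by omega⟩
  rw [← logTheta_add_int (1 / 2 + v) y n]
  congr 1
  push_cast
  ring

/-- The logarithm of the determinant formula at the division points, without its elementary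
factors. Both sides are sums over half grids: the distribution relations reduce them to values of
`logTheta` and `logThetaImag` at `0` and `1 / 2`, which are combinations of values of `logEta`.
The sums of `logTheta (x k)` and `logTheta (x k + 1 / 2)` at the moduli `y` and `y / 2` serve as
intermediate quantities, the latter through the duplication formula for `logTheta (2 * x k)`. -/
theorem eta_identity_B (hN : 0 < N) (hM : M + 1 = 2 * N) (hy : 0 < y)
    (hx : x = fun k : ℕ => ((k : ℝ) + 1 / 2) / M) :
    ∑ l ∈ Finset.range N, (logEta (M * y) + logThetaImag (l / M) (M * y))
      = Real.log 2 - N * (N - 1) * logEta y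
        + ∑ k ∈ Finset.range N, (logEta y + logTheta (x k) y)
        + ∑ j : Fin N, ∑ k ∈ Finset.Ioi j,
          ((logEta y + logTheta (x k - x j) y) + (logEta y + logTheta (x k + x j) y)) := by
  have hM0 : 0 < M := by omega
  have hMr : (0 : ℝ) < M := by exact_mod_cast hM0
  have hg := halfGrid_half_odd hN hM
  rw [← hx] at hg
  have hw : 0 < M * y := by positivity
  have hJ := (halfGrid_closed_odd hN hM).sum_logThetaImag hM0 hy
  have hP := hg.sum_pairs_eta hM0 hy ⟨1, by norm_num⟩ fun k _ => ⟨k, by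
    rw [hx]; push_cast; field_simp⟩
  have hy2 : 0 < y / 2 := by positivity
  have hw2 : (M : ℝ) * (y / 2) = M * y / 2 := by ring
  have h1 := hg.sum_logTheta hM0 hy
  have h2 := hg.sum_logTheta_add_half hM0 hy
  have h3 := hg.sum_logTheta hM0 hy2
  have h4 := hg.sum_logTheta_add_half hM0 hy2
  rw [sum_logTheta_two_mul hy] at hP
  simp only [logTheta_nat_div_two_odd (show M % 2 = 1 by omega), hw2] at h2 h3 h4
  rw [show (1 / 2 + 1 / 2 : ℝ) = 0 + 1 by norm_num, logTheta_add_one] at h2 h4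
  simp only [logTheta_zero hy, logTheta_half hy, logTheta_zero hw, logTheta_half hw,
    logTheta_zero hy2, logTheta_half_of_half hy, logTheta_half_of_half hw,
    logTheta_zero (half_pos hw), logThetaImag_zero hy, logThetaImag_zero hw,
    logThetaImag_half_eq hw] at hJ hP h1 h2 h3 h4
  rw [Finset.sum_add_distrib, Finset.sum_add_distrib]
  simp only [Finset.sum_const, Finset.card_range, nsmul_eq_mul]
  linarith

theorem eta_identity_Bv (hN : 0 < N) (hM : M = 2 * N) (hy : 0 < y)
    (hx : x = fun k : ℕ => ((k : ℝ) + 1 / 2) / M) :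
    ∑ l ∈ Finset.range N, (logEta (M * y) + logThetaImag (l / M) (M * y))
      = Real.log 2 - (N - 1) ^ 2 * logEta y - (N - 1) * logEta (2 * y)
        + ∑ k ∈ Finset.range N, (logEta (2 * y) + logTheta (2 * x k) (2 * y))
        + ∑ j : Fin N, ∑ k ∈ Finset.Ioi j,
          ((logEta y + logTheta (x k - x j) y) + (logEta y + logTheta (x k + x j) y)) := by
  have hM0 : 0 < M := by omega
  have hMr : (0 : ℝ) < M := by exact_mod_cast hM0
  have hg := halfGrid_half_even hN hM
  rw [← hx] at hg
  have hw : 0 < M * y := by positivity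
  have hJ := (halfGrid_nonneg_even hN hM).sum_logThetaImag hM0 hy
  have hP := hg.sum_pairs_eta hM0 hy ⟨1, by norm_num⟩ fun k _ => ⟨k, by
    rw [hx]; push_cast; field_simp⟩
  have hy2 : 0 < y / 2 := by positivity
  have hw2 : (M : ℝ) * (y / 2) = M * y / 2 := by ring
  have h1 := hg.sum_logTheta hM0 hy
  have h2 := hg.sum_logTheta_add_half hM0 hy
  have h3 := hg.sum_logTheta hM0 hy2
  have h4 := hg.sum_logTheta_add_half hM0 hy2
  have h5 := sum_logTheta_two_mul (y := 2 * y) (by positivity) N x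
  rw [mul_div_cancel_left₀ y two_ne_zero] at h5
  rw [sum_logTheta_two_mul hy] at hP
  simp only [logTheta_nat_div_two (show M % 2 = 0 by omega), hw2] at h2 h3 h4
  simp only [logTheta_zero hy, logTheta_half hy, logTheta_zero hw, logTheta_half hw,
    logTheta_zero hy2, logTheta_half_of_half hy, logTheta_half_of_half hw,
    logThetaImag_zero hy, logThetaImag_zero hw,
    logThetaImag_half_eq hw] at hJ hP h1 h2 h3 h4
  simp only [Finset.sum_add_distrib, Finset.sum_const, Finset.card_range,
    nsmul_eq_mul, h5] at hJ hP h1 h2 h3 h4 ⊢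
  linarith

theorem eta_identity_C (hN : 0 < N) (hM : M = 2 * N + 2) (hy : 0 < y)
    (hx : x = fun k : ℕ => ((k : ℝ) + 1) / M) :
    ∑ l ∈ Finset.range N, (logEta (M * y) + logThetaImag ((l + 1) / M) (M * y))
      = -N * (N - 1) * logEta y
        + ∑ k ∈ Finset.range N, (logEta y + logTheta (2 * x k) y)
        + ∑ j : Fin N, ∑ k ∈ Finset.Ioi j,
          ((logEta y + logTheta (x k - x j) y) + (logEta y + logTheta (x k + x j) y)) := by
  have hM0 : 0 < M := by omega
  have hMr : (0 : ℝ) < M := by exact_mod_cast hM0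
  have hg := halfGrid_interior_even hM
  simp only [Nat.cast_add, Nat.cast_one] at hg
  rw [← hx] at hg
  have hw : 0 < M * y := by positivity
  have hJ := (halfGrid_interior_even hM).sum_logThetaImag hM0 hy
  simp only [Nat.cast_add, Nat.cast_one] at hJ
  have hP := hg.sum_pairs_eta hM0 hy ⟨0, by norm_num⟩ fun k _ => ⟨k + 1, by
    rw [hx]; push_cast; field_simp; ring⟩
  have hy2 : 0 < y / 2 := by positivity
  have hw2 : (M : ℝ) * (y / 2) = M * y / 2 := by ring
  have h1 := hg.sum_logTheta hM0 hy
  have h2 := hg.sum_logTheta_add_half hM0 hy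
  have h3 := hg.sum_logTheta hM0 hy2
  have h4 := hg.sum_logTheta_add_half hM0 hy2
  rw [sum_logTheta_two_mul hy] at hP
  simp only [logTheta_nat_div_two (show M % 2 = 0 by omega), hw2] at h2 h3 h4
  simp only [logTheta_zero hy, logTheta_half hy, logTheta_zero hw,
    logTheta_zero hy2, logTheta_half_of_half hy,
    logTheta_zero (half_pos hw), logThetaImag_zero hy, logThetaImag_zero hw,
    logThetaImag_half_eq hw] at hJ hP h1 h2 h3 h4
  simp only [Finset.sum_add_distrib, Finset.sum_const, Finset.card_range,
    nsmul_eq_mul, sum_logTheta_two_mul hy] at hJ hP h1 h2 h3 h4 ⊢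
  linarith

theorem eta_identity_Cv (hN : 0 < N) (hM : M = 2 * N) (hy : 0 < y)
    (hx : x = fun k : ℕ => ((k : ℝ) + 1) / M) :
    ∑ l ∈ Finset.range N, (logEta (M * y) + logThetaImag ((l + 1 / 2) / M) (M * y))
      = -(N - 1) ^ 2 * logEta y - (N - 1) * logEta (y / 2)
        + ∑ k ∈ Finset.range N, (logEta (y / 2) + logTheta (x k) (y / 2))
        + ∑ j : Fin N, ∑ k ∈ Finset.Ioi j,
          ((logEta y + logTheta (x k - x j) y) + (logEta y + logTheta (x k + x j) y)) := by
  have hM0 : 0 < M := by omega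
  have hMr : (0 : ℝ) < M := by exact_mod_cast hM0
  have hg := halfGrid_pos_even hN hM
  simp only [Nat.cast_add, Nat.cast_one] at hg
  rw [← hx] at hg
  have hw : 0 < M * y := by positivity
  have hJ := (halfGrid_half_even hN hM).sum_logThetaImag hM0 hy
  have hP := hg.sum_pairs_eta hM0 hy ⟨0, by norm_num⟩ fun k _ => ⟨k + 1, by
    rw [hx]; push_cast; field_simp; ring⟩
  have hy2 : 0 < y / 2 := by positivity
  have hw2 : (M : ℝ) * (y / 2) = M * y / 2 := by ring
  have h1 := hg.sum_logTheta hM0 hy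
  have h2 := hg.sum_logTheta_add_half hM0 hy
  have h3 := hg.sum_logTheta hM0 hy2
  have h4 := hg.sum_logTheta_add_half hM0 hy2
  rw [sum_logTheta_two_mul hy] at hP
  simp only [logTheta_nat_div_two (show M % 2 = 0 by omega), hw2] at h2 h3 h4
  simp only [logTheta_zero hy, logTheta_half hy, logTheta_zero hw,
    logTheta_zero hy2, logTheta_half_of_half hy,
    logTheta_zero (half_pos hw), logThetaImag_zero hw,
    logThetaImag_half_eq hy, logThetaImag_half_eq hw] at hJ hP h1 h2 h3 h4
  simp only [Finset.sum_add_distrib, Finset.sum_const, Finset.card_range,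
    nsmul_eq_mul] at hJ hP h1 h2 h3 h4 ⊢
  linarith

theorem eta_identity_BC (hM : M = 2 * N + 1) (hy : 0 < y)
    (hx : x = fun k : ℕ => ((k : ℝ) + 1) / M) :
    ∑ l ∈ Finset.range N, (logEta (M * y) + logThetaImag ((l + 1) / M) (M * y))
      = -N * (N - 1) * logEta y - N * logEta (2 * y)
        + ∑ k ∈ Finset.range N, ((logEta y + logTheta (x k) y)
          + (logEta (2 * y) + logTheta (2 * x k) y - logTheta (2 * x k) (2 * y)))
        + ∑ j : Fin N, ∑ k ∈ Finset.Ioi j,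
          ((logEta y + logTheta (x k - x j) y) + (logEta y + logTheta (x k + x j) y)) := by
  have hM0 : 0 < M := by omega
  have hMr : (0 : ℝ) < M := by exact_mod_cast hM0
  have hg := halfGrid_interior_odd hM
  simp only [Nat.cast_add, Nat.cast_one] at hg
  rw [← hx] at hg
  have hw : 0 < M * y := by positivity
  have hJ := (halfGrid_interior_odd hM).sum_logThetaImag hM0 hy
  simp only [Nat.cast_add, Nat.cast_one] at hJ
  have hP := hg.sum_pairs_eta hM0 hy ⟨0, by norm_num⟩ fun k _ => ⟨k + 1, by
    rw [hx]; push_cast; field_simp; ring⟩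
  have hy2 : 0 < y / 2 := by positivity
  have hw2 : (M : ℝ) * (y / 2) = M * y / 2 := by ring
  have h1 := hg.sum_logTheta hM0 hy
  have h2 := hg.sum_logTheta_add_half hM0 hy
  have h3 := hg.sum_logTheta hM0 hy2
  have h4 := hg.sum_logTheta_add_half hM0 hy2
  have h5 := sum_logTheta_two_mul (y := 2 * y) (by positivity) N x
  rw [mul_div_cancel_left₀ y two_ne_zero] at h5
  rw [sum_logTheta_two_mul hy] at hP
  simp only [logTheta_nat_div_two_odd (show M % 2 = 1 by omega), hw2] at h2 h3 h4
  rw [add_zero] at h2 h4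
  simp only [logTheta_zero hy, logTheta_half hy, logTheta_zero hw, logTheta_half hw,
    logTheta_zero hy2, logTheta_half_of_half hy, logTheta_half_of_half hw,
    logTheta_zero (half_pos hw), logThetaImag_zero hy, logThetaImag_zero hw,
    logThetaImag_half_eq hw] at hJ hP h1 h2 h3 h4
  simp only [Finset.sum_add_distrib, Finset.sum_sub_distrib, Finset.sum_const, Finset.card_range,
    nsmul_eq_mul, sum_logTheta_two_mul hy, h5] at hJ hP h1 h2 h3 h4 ⊢
  linarith

theorem eta_identity_D (hN : 2 ≤ N) (hM : M + 2 = 2 * N) (hy : 0 < y)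
    (hx : x = fun k : ℕ => (k : ℝ) / M) :
    ∑ l ∈ Finset.range N, (logEta (M * y) + logThetaImag (l / M) (M * y))
      = Real.log 2 - N * (N - 2) * logEta y
        + ∑ j : Fin N, ∑ k ∈ Finset.Ioi j,
          ((logEta y + logTheta (x k - x j) y) + (logEta y + logTheta (x k + x j) y)) := by
  have hM0 : 0 < M := by omega
  have hMr : (0 : ℝ) < M := by exact_mod_cast hM0
  have hg := halfGrid_closed_even hN hM
  rw [← hx] at hg
  have hw : 0 < M * y := by positivity
  have hJ := (halfGrid_closed_even hN hM).sum_logThetaImag hM0 hy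
  have hP := hg.sum_pairs_eta hM0 hy ⟨0, by norm_num⟩ fun k _ => ⟨k, by
    rw [hx]; push_cast; field_simp; ring⟩
  have hy2 : 0 < y / 2 := by positivity
  have hw2 : (M : ℝ) * (y / 2) = M * y / 2 := by ring
  have h1 := hg.sum_logTheta hM0 hy
  have h2 := hg.sum_logTheta_add_half hM0 hy
  have h3 := hg.sum_logTheta hM0 hy2
  have h4 := hg.sum_logTheta_add_half hM0 hy2
  rw [sum_logTheta_two_mul hy] at hP
  simp only [logTheta_nat_div_two (show M % 2 = 0 by omega), hw2] at h2 h3 h4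
  simp only [logTheta_zero hy, logTheta_half hy, logTheta_zero hw,
    logTheta_zero hy2, logTheta_half_of_half hy,
    logTheta_zero (half_pos hw), logThetaImag_zero hy, logThetaImag_zero hw,
    logThetaImag_half_eq hw] at hJ hP h1 h2 h3 h4
  simp only [Finset.sum_add_distrib, Finset.sum_const, Finset.card_range,
    nsmul_eq_mul] at hJ hP h1 h2 h3 h4 ⊢
  linarith

/-- Without reflection no half grids are needed: for each `k` the differences `x k - x j` run
through the full grid of `N`-division points. -/
theorem eta_identity_A (hN : 0 < N) (hy : 0 < y) (hx : x = fun k : ℕ => ((k : ℝ) + δ) / N) :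
    ∑ l ∈ Finset.range N, (logEta (N * y) + logThetaImag (l / N) (N * y))
      = Real.log 2 - (N - 1) * (N - 2) / 2 * logEta y + (logEta y + logTheta (1 / 2) y)
        + ∑ j : Fin N, ∑ k ∈ Finset.Ioi j, (logEta y + logTheta (x k - x j) y) := by
  have hNr : (0 : ℝ) < N := by exact_mod_cast hN
  have hw : 0 < N * y := by positivity
  have hJ := logThetaImag_distribution hy N hN 0
  simp only [zero_add] at hJ
  have hrow : ∀ k : Fin N, ∑ j : Fin N, (logEta y + logTheta (x k - x j) y)
      = N * logEta y + logTheta 0 (N * y) := by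
    intro k
    rw [← Finset.sum_range fun j => logEta y + logTheta (x k - x j) y, Finset.sum_add_distrib]
    have h := sum_logTheta_grid hy hN (-((k : ℝ) / N)) 0
    have e : (N : ℝ) * (-((k : ℝ) / N)) + 0 = 0 + ((-(k : ℤ) : ℤ) : ℝ) := by
      push_cast; field_simp; ring
    rw [e, logTheta_add_int] at h
    rw [← h]
    congr 1
    · simp
    · refine Finset.sum_congr rfl fun j _ => ?_
      rw [← logTheta_neg, hx]
      congr 1
      ring
  have hP := sum_Ioi_of_symm (N := N) (G := fun k j => logEta y + logTheta (x k - x j) y)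
    fun j k => by rw [← logTheta_neg (x k - x j), neg_sub]
  simp only [hrow, sub_self, logTheta_zero hy, logTheta_zero hw] at hP
  rw [logThetaImag_zero hy] at hJ
  rw [Finset.sum_add_distrib, hJ, logTheta_half hy]
  simp only [Finset.sum_const, Finset.card_range, Finset.card_univ, Fintype.card_fin,
    nsmul_eq_mul] at hP ⊢
  linarith

end

/-! ### Trigonometric determinants -/

open Polynomial in
/-- Solutions of the three-term recurrence `g (l + 2) = 2 c g (l + 1) - g l` are, up to the factor
`g 0`, polynomials in `c` of exact degree `l`; so their determinant reduces to a Vandermonde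
determinant. -/
theorem det_recurrence_ne_zero {K : Type*} [Field K] [CharZero K] {N : ℕ} {c : Fin N → K}
    (hc : Function.Injective c) {g : ℕ → Fin N → K} {a b : K} (ha : a ≠ 0)
    (h0 : ∀ m, g 0 m ≠ 0) (h1 : ∀ m, g 1 m = (a * c m + b) * g 0 m)
    (h2 : ∀ l m, g (l + 2) m = 2 * c m * g (l + 1) m - g l m) :
    (Matrix.of fun l m : Fin N => g l m).det ≠ 0 := by
  have hpoly : ∀ l : ℕ, ∃ p q : K[X], (p.natDegree = l ∧ p ≠ 0 ∧ ∀ m, g l m = p.eval (c m) * g 0 m)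
      ∧ (q.natDegree = l + 1 ∧ q ≠ 0 ∧ ∀ m, g (l + 1) m = q.eval (c m) * g 0 m) := by
    intro l
    induction l with
    | zero =>
      refine ⟨1, C a * X + C b, ⟨natDegree_one, one_ne_zero, fun m => by simp⟩,
        natDegree_linear ha, ?_, fun m => by rw [h1]; simp⟩
      intro h
      have := natDegree_linear (b := b) ha
      rw [h] at this
      simp at this
    | succ l ih =>
      obtain ⟨p, q, ⟨hp, hp0, hpe⟩, hq, hq0, hqe⟩ := ih
      have h2C : (C (2 : K)) ≠ 0 := C_ne_zero.mpr two_ne_zero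
      have hd : (C 2 * X * q).natDegree = l + 2 := by
        rw [natDegree_mul (mul_ne_zero h2C X_ne_zero) hq0, natDegree_mul h2C X_ne_zero,
          natDegree_C, natDegree_X, hq]
        ring
      have hd2 : (C 2 * X * q - p).natDegree = l + 2 := by
        rw [natDegree_sub_eq_left_of_natDegree_lt (by rw [hd, hp]; omega), hd]
      refine ⟨q, C 2 * X * q - p, ⟨hq, hq0, hqe⟩, hd2, ?_, fun m => ?_⟩
      · intro h
        rw [h] at hd2
        simp at hd2
      · rw [h2, hpe, hqe]
        simp
        ring
  choose p _ hp using fun l => hpoly l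
  have hpd := fun l => (hp l).1.1
  have hp0 := fun l => (hp l).1.2.1
  have hpe := fun l => (hp l).1.2.2
  have hdet := Matrix.det_eval_matrixOfPolynomials_eq_det_vandermonde c
    (fun l : Fin N => p l * C (p l).leadingCoeff⁻¹)
    (fun l => by rw [natDegree_mul_leadingCoeff_inv _ (hp0 l), hpd])
    (fun l => monic_mul_leadingCoeff_inv (hp0 l))
  have hfac : (Matrix.of fun l m : Fin N => g l m)
      = Matrix.of fun l m => g 0 m * (Matrix.of fun l m : Fin N => (p l).leadingCoeff
        * (Matrix.of fun m l : Fin N => (p l * C (p l).leadingCoeff⁻¹).eval (c m)).transpose l m)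
          l m := by
    ext l m
    have := leadingCoeff_ne_zero.mpr (hp0 l)
    simp only [Matrix.of_apply, Matrix.transpose_apply, eval_mul, eval_C, hpe l m]
    field_simp
  rw [hfac, Matrix.det_mul_row, Matrix.det_mul_column, Matrix.det_transpose, ← hdet]
  refine mul_ne_zero (Finset.prod_ne_zero_iff.mpr fun m _ => h0 m)
    (mul_ne_zero (Finset.prod_ne_zero_iff.mpr fun l _ => leadingCoeff_ne_zero.mpr (hp0 l)) ?_)
  exact Matrix.det_vandermonde_ne_zero_iff.mpr hc

theorem injective_cos {N : ℕ} {φ : Fin N → ℝ} (hφ : Function.Injective φ)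
    (h : ∀ m, φ m ∈ Set.Icc 0 π) : Function.Injective fun m => ((Real.cos (φ m) : ℝ) : ℂ) := by
  intro m n hmn
  exact hφ (Real.injOn_cos (h m) (h n) (Complex.ofReal_injective hmn))

theorem det_cos_ne_zero {N : ℕ} {φ : Fin N → ℝ} (hφ : Function.Injective φ)
    (h : ∀ m, φ m ∈ Set.Icc 0 π) :
    (Matrix.of fun l m : Fin N => ((Real.cos ((l : ℕ) * φ m) : ℝ) : ℂ)).det ≠ 0 := by
  refine det_recurrence_ne_zero (g := fun l m => ((Real.cos (l * φ m) : ℝ) : ℂ))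
    (injective_cos hφ h) (a := 1) (b := 0) one_ne_zero (fun m => by simp) (fun m => by simp)
    fun l m => ?_
  norm_cast
  have := Real.cos_add_cos ((l + 2 : ℕ) * φ m) (l * φ m)
  rw [show ((l + 2 : ℕ) * φ m + l * φ m) / 2 = (l + 1 : ℕ) * φ m by push_cast; ring,
    show ((l + 2 : ℕ) * φ m - l * φ m) / 2 = φ m by push_cast; ring] at this
  linarith

/-- The determinant with entries `sin ((l + ε) φ_m)`, for `ε = 1` or `ε = 1 / 2`. -/
theorem det_sin_ne_zero {N : ℕ} {φ : Fin N → ℝ} (hφ : Function.Injective φ)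
    (h : ∀ m, φ m ∈ Set.Icc 0 π) {ε : ℝ} (hε : ε = 1 ∨ ε = 1 / 2)
    (h0 : ∀ m, Real.sin (ε * φ m) ≠ 0) :
    (Matrix.of fun l m : Fin N => ((Real.sin (((l : ℕ) + ε) * φ m) : ℝ) : ℂ)).det ≠ 0 := by
  have hrec : ∀ (l : ℕ) m, ((Real.sin (((l + 2 : ℕ) + ε) * φ m) : ℝ) : ℂ)
      = 2 * (Real.cos (φ m) : ℝ) * (Real.sin (((l + 1 : ℕ) + ε) * φ m) : ℝ)
        - (Real.sin ((l + ε) * φ m) : ℝ) := by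
    intro l m
    norm_cast
    have := Real.sin_add_sin (((l + 2 : ℕ) + ε) * φ m) ((l + ε) * φ m)
    rw [show (((l + 2 : ℕ) + ε) * φ m + (l + ε) * φ m) / 2 = ((l + 1 : ℕ) + ε) * φ m by
        push_cast; ring,
      show (((l + 2 : ℕ) + ε) * φ m - (l + ε) * φ m) / 2 = φ m by push_cast; ring] at this
    linarith
  have h0' : ∀ m, ((Real.sin (((0 : ℕ) + ε) * φ m) : ℝ) : ℂ) ≠ 0 := fun m => by
    rw [Nat.cast_zero, zero_add]
    exact Complex.ofReal_ne_zero.mpr (h0 m)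
  rcases hε with rfl | rfl
  · refine det_recurrence_ne_zero (g := fun l m => ((Real.sin ((l + 1) * φ m) : ℝ) : ℂ))
      (injective_cos hφ h) (a := 2) (b := 0) two_ne_zero h0' (fun m => ?_) hrec
    norm_cast
    have h1 := Real.sin_two_mul (φ m)
    norm_num
    linarith
  · refine det_recurrence_ne_zero (g := fun l m => ((Real.sin ((l + 1 / 2) * φ m) : ℝ) : ℂ))
      (injective_cos hφ h) (a := 2) (b := 1) two_ne_zero h0' (fun m => ?_) hrec
    norm_cast
    have h1 := Real.sin_sub_sin ((1 + 1 / 2) * φ m) ((0 + 1 / 2) * φ m)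
    rw [show ((1 + 1 / 2) * φ m - (0 + 1 / 2) * φ m) / 2 = (0 + 1 / 2) * φ m by ring,
      show ((1 + 1 / 2) * φ m + (0 + 1 / 2) * φ m) / 2 = φ m by ring] at h1
    linarith

/-- A Vandermonde determinant with distinct nodes on the unit circle. -/
theorem det_exp_ne_zero {N : ℕ} {y : Fin N → ℝ} (hy : StrictMono y)
    (h : ∀ m n, y m - y n < 1) :
    (Matrix.of fun l m : Fin N => cexp (2 * π * I * (l : ℕ) * y m)).det ≠ 0 := by
  have hv : (Matrix.of fun l m : Fin N => cexp (2 * π * I * (l : ℕ) * y m))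
      = (Matrix.vandermonde fun m => cexp (2 * π * I * y m)).transpose := by
    ext l m
    rw [Matrix.transpose_apply, Matrix.vandermonde_apply, ← Complex.exp_nat_mul, Matrix.of_apply]
    ring_nf
  rw [hv, Matrix.det_transpose]
  refine Matrix.det_vandermonde_ne_zero_iff.mpr fun m n hmn => ?_
  obtain ⟨k, hk⟩ := Complex.exp_eq_exp_iff_exists_int.mp hmn
  have hpi : (2 * π * I : ℂ) ≠ 0 := Complex.two_pi_I_ne_zero
  have hk2 : y m = y n + k := by
    have : (2 * π * I : ℂ) * (y m - (y n + k)) = 0 := by linear_combination hk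
    have := (mul_eq_zero.mp this).resolve_left hpi
    exact_mod_cast sub_eq_zero.mp this
  have h1 := h m n
  have h2 := h n m
  have h3 : (k : ℝ) < 1 := by linarith
  have h4 : (-1 : ℝ) < k := by linarith
  have : k = 0 := by
    have h3' : k < 1 := by exact_mod_cast h3
    have h4' : -1 < k := by exact_mod_cast h4
    omega
  rw [this, Int.cast_zero, add_zero] at hk2
  exact hy.injective hk2

/-! ### The theta waves and their values at division points -/

/-- The building block `e^{2πiJv} ϑ₁(Jτ + Mv + α; Mτ)` in the normalized variable
`v = z / (2πr)`. -/
noncomputable def wave (J : ℝ) (M : ℕ) (α τ v : ℂ) : ℂ :=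
  cexp (2 * π * I * J * v) * theta1 (J * τ + M * v + α) (M * τ)

theorem thetaWave_eq_wave (J r : ℝ) (M : ℕ) (α τ z : ℂ) :
    thetaWave J M r α τ z = wave J M α τ (z / (2 * π * r)) := by
  unfold thetaWave wave
  have hpi : (π : ℂ) ≠ 0 := Complex.ofReal_ne_zero.mpr Real.pi_ne_zero
  by_cases hr : (r : ℂ) = 0
  · simp [hr]
  · congr 2
    · field_simp
    · push_cast
      field_simp

theorem wave_mem_thetaSpace {J s : ℝ} {M : ℕ} {α ε₁ ε₂ : ℂ} (hM : 0 < M) (hs : 0 < s)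
    (h1 : cexp (2 * π * I * J) * (-1) ^ M = ε₁) (h2 : -cexp (-(2 * π * I * α)) = ε₂) :
    wave J M α (I * s) ∈ thetaSpace M ε₁ ε₂ (I * s) := by
  have hMτ : 0 < ((M : ℂ) * (I * s)).im := by
    have : (0 : ℝ) < M * s := by positivity
    simpa using this
  refine ⟨?_, fun v => ?_, fun v => ?_⟩
  · unfold wave
    have h := (differentiable_theta1 hMτ).comp
      (f := fun v : ℂ => J * (I * s) + M * v + α) (by fun_prop)
    exact Differentiable.mul (by fun_prop) h
  · unfold wave
    rw [mul_add, Complex.exp_add, ← h1,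
      show (J : ℂ) * (I * s) + M * (v + 1) + α = (J * (I * s) + M * v + α) + M by ring,
      theta1_add_nat]
    ring_nf
  · unfold wave
    rw [show (J : ℂ) * (I * s) + M * (v + I * s) + α
      = (J * (I * s) + M * v + α) + M * (I * s) by ring, theta1_add_tau, ← h2]
    have : cexp (2 * π * I * J * (v + I * s))
        * cexp (-π * I * (M * (I * s)) - 2 * π * I * (J * (I * s) + M * v + α))
        = cexp (-(2 * π * I * α)) * cexp (-π * I * M * (I * s) - 2 * π * I * M * v)
          * cexp (2 * π * I * J * v) := by
      rw [← Complex.exp_add, ← Complex.exp_add, ← Complex.exp_add]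
      ring_nf
    linear_combination (-theta1 (J * (I * s) + M * v + α) (M * (I * s))) * this

theorem comp_neg_mem_thetaSpace {M : ℕ} {ε₁ ε₂ τ : ℂ} (h1 : ε₁ * ε₁ = 1) (h2 : ε₂ * ε₂ = 1)
    {F : ℂ → ℂ} (hF : F ∈ thetaSpace M ε₁ ε₂ τ) :
    (fun v => F (-v)) ∈ thetaSpace M ε₁ ε₂ τ := by
  obtain ⟨hd, hF1, hF2⟩ := hF
  refine ⟨hd.comp differentiable_neg, fun v => ?_, fun v => ?_⟩
  · have h := hF1 (-(v + 1))
    rw [show -(v + 1) + 1 = -v by ring] at h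
    simp only
    linear_combination -F (-(v + 1)) * h1 - ε₁ * h
  · have h := hF2 (-(v + τ))
    rw [show -(v + τ) + τ = -v by ring] at h
    simp only
    have e : cexp (-π * I * M * τ - 2 * π * I * M * v)
        * cexp (-π * I * M * τ - 2 * π * I * M * -(v + τ)) = 1 := by
      rw [← Complex.exp_add, ← Complex.exp_zero]
      ring_nf
    rw [h]
    linear_combination (-F (-(v + τ))) * h2
      - ε₂ * ε₂ * F (-(v + τ)) * e

/-- The combination `wave(v) - σ wave(-v)` has parity `-σ`. -/
theorem wave_sub_mem {J s : ℝ} {M : ℕ} {α ε₁ ε₂ σ : ℂ} (hM : 0 < M) (hs : 0 < s)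
    (h1 : cexp (2 * π * I * J) * (-1) ^ M = ε₁) (h2 : -cexp (-(2 * π * I * α)) = ε₂)
    (hε₁ : ε₁ * ε₁ = 1) (hε₂ : ε₂ * ε₂ = 1) (hσ : σ * σ = 1) :
    (fun v => wave J M α (I * s) v - σ * wave J M α (I * s) (-v))
      ∈ thetaSpaceParity M ε₁ ε₂ (-σ) (I * s) := by
  have h := wave_mem_thetaSpace hM hs h1 h2
  refine ⟨Submodule.sub_mem _ h (Submodule.smul_mem _ σ (comp_neg_mem_thetaSpace hε₁ hε₂ h)),
    fun v => ?_⟩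
  simp only [neg_neg]
  linear_combination -wave J M α (I * s) (-v) * hσ

/-- The value of a wave at a division point: the theta function depends on the point only
through a sign. -/
theorem wave_division {J s : ℝ} {M : ℕ} {α δ : ℂ} (hM : 0 < M) (hδ : α + δ = 1 / 2) (k : ℕ) :
    wave J M α (I * s) ((k + δ) / M)
      = (-1) ^ k * theta1 (J * (I * s) + 1 / 2) (M * (I * s))
        * cexp (2 * π * I * J * ((k + δ) / M)) := by
  have hM' : (M : ℂ) ≠ 0 := by exact_mod_cast hM.ne'
  unfold wave
  rw [show (J : ℂ) * (I * s) + M * ((k + δ) / M) + α = (J * (I * s) + 1 / 2) + k by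
    rw [← hδ]; field_simp; ring, theta1_add_nat]
  ring

/-- The value of a wave at the negative of a division point contains the same theta function. -/
theorem wave_division_neg {J s : ℝ} {M : ℕ} {α δ : ℂ} (hM : 0 < M) (hδ : α + δ = 1 / 2)
    (n k : ℕ) (hn : 2 * δ = n) :
    wave J M α (I * s) (-((k + δ) / M))
      = (-1) ^ (k + n) * theta1 (J * (I * s) + 1 / 2) (M * (I * s))
        * cexp (-(2 * π * I * J * ((k + δ) / M))) := by
  have hM' : (M : ℂ) ≠ 0 := by exact_mod_cast hM.ne'
  unfold wave
  have h := theta1_add_nat (J * (I * s) + M * (-((k + δ) / M)) + α) (M * (I * s)) (k + n)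
  rw [show (J : ℂ) * (I * s) + M * (-((k + δ) / M)) + α + (k + n : ℕ) = J * (I * s) + 1 / 2 by
    rw [← hδ]; push_cast; rw [← hn]; field_simp; ring] at h
  rw [h, mul_neg]
  have : ((-1 : ℂ) ^ (k + n)) * (-1) ^ (k + n) = 1 := by
    rw [← mul_pow]; simp
  linear_combination (-theta1 (J * (I * s) + M * (-((k + δ) / M)) + α) (M * (I * s))
    * cexp (-(2 * π * I * J * ((k + δ) / M)))) * this

/-- After multiplication by `e^{πiτJ²/M}` the theta constants of `wave_division` are exponentials of
real numbers. -/
theorem exp_mul_theta1_wave {M : ℕ} (hM : 0 < M) {s : ℝ} (hs : 0 < s) (J : ℝ) :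
    cexp (π * I * (I * s) * J ^ 2 / M) * theta1 (J * (I * s) + 1 / 2) (M * (I * s))
      = ((Real.exp (logEta (M * s) + logThetaImag (J / M) (M * s)) : ℝ) : ℂ) := by
  have hM' : (M : ℂ) ≠ 0 := by exact_mod_cast hM.ne'
  have h := theta1_imag_eq_exp (y := M * s) (by positivity) (J / M)
  rw [← h]
  push_cast
  congr 2
  · field_simp
  · field_simp
  · ring

/-! ### The product side as an alternating function -/

section

variable {M M' : ℕ} {ε₁ ε₂ ε₁' ε₂' σ σ' τ : ℂ}

theorem mul_mem_thetaSpaceParity {F G : ℂ → ℂ} (hF : F ∈ thetaSpaceParity M ε₁ ε₂ σ τ)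
    (hG : G ∈ thetaSpaceParity M' ε₁' ε₂' σ' τ) :
    (fun v => F v * G v) ∈ thetaSpaceParity (M + M') (ε₁ * ε₁') (ε₂ * ε₂') (σ * σ') τ :=
  ⟨mul_mem_thetaSpace hF.1 hG.1, fun v => by simp only [hF.2, hG.2]; ring⟩

theorem prod_mem_thetaSpaceParity {ι : Type*} (s : Finset ι) {F : ι → ℂ → ℂ}
    (hF : ∀ i ∈ s, F i ∈ thetaSpaceParity M ε₁ ε₂ σ τ) :
    (fun v => ∏ i ∈ s, F i v)
      ∈ thetaSpaceParity (s.card * M) (ε₁ ^ s.card) (ε₂ ^ s.card) (σ ^ s.card) τ :=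
  ⟨prod_mem_thetaSpace s fun i hi => (hF i hi).1, fun v => by
    beta_reduce
    rw [Finset.prod_congr rfl fun i hi => (hF i hi).2 v, Finset.prod_mul_distrib,
      Finset.prod_const]⟩

theorem theta1_add_const_mem (hτ : 0 < τ.im) (a : ℂ) :
    (fun v => theta1 (v + a) τ) ∈ thetaSpace 1 (-1) (-cexp (-(2 * π * I * a))) τ := by
  refine ⟨(differentiable_theta1 hτ).comp (by fun_prop : Differentiable ℂ fun v : ℂ => v + a),
    fun v => ?_, fun v => ?_⟩
  · beta_reduce
    rw [add_right_comm, theta1_add_one]; ring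
  · beta_reduce
    rw [add_right_comm, theta1_add_tau,
      show -π * I * τ - 2 * π * I * (v + a)
        = -(2 * π * I * a) + (-π * I * (1 : ℕ) * τ - 2 * π * I * (1 : ℕ) * v) by
        push_cast; ring, Complex.exp_add]
    ring

theorem theta1_mem (hτ : 0 < τ.im) :
    (fun v => theta1 v τ) ∈ thetaSpaceParity 1 (-1) (-1) (-1) τ := by
  refine ⟨?_, fun v => by beta_reduce; rw [theta1_neg]; ring⟩
  simpa using theta1_add_const_mem hτ 0

/-- The dependence of a pair factor on one of its two variables. -/
theorem theta1_pair_mem (hτ : 0 < τ.im) (a : ℂ) :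
    (fun v => theta1 (a - v) τ * theta1 (a + v) τ) ∈ thetaSpaceParity 2 1 1 1 τ := by
  constructor
  · have h := Submodule.neg_mem _ (mul_mem_thetaSpace (theta1_add_const_mem hτ (-a))
      (theta1_add_const_mem hτ a))
    have e : -cexp (-(2 * π * I * -a)) * -cexp (-(2 * π * I * a)) = 1 := by
      rw [neg_mul_neg, ← Complex.exp_add, ← Complex.exp_zero]
      ring_nf
    rw [e, show (-1 : ℂ) * -1 = 1 by ring] at h
    convert h using 1
    ext v
    rw [Pi.neg_apply, ← neg_sub, theta1_neg, add_comm a v, sub_eq_add_neg]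
    ring
  · intro v
    beta_reduce
    rw [sub_neg_eq_add, ← sub_eq_add_neg]
    ring

theorem theta1_two_mul_two_mem (hτ : 0 < τ.im) :
    (fun v => theta1 (2 * v) (2 * τ)) ∈ thetaSpaceParity 2 1 (-1) (-1) τ := by
  have hτ2 : 0 < (2 * τ).im := by simpa using hτ
  refine ⟨⟨(differentiable_theta1 hτ2).comp (by fun_prop : Differentiable ℂ fun v : ℂ => 2 * v),
    fun v => ?_, fun v => ?_⟩, fun v => ?_⟩
  · have := theta1_add_nat (2 * v) (2 * τ) 2
    push_cast at this
    beta_reduce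
    rw [mul_add, mul_one, this]; norm_num
  · beta_reduce
    rw [mul_add, theta1_add_tau]
    push_cast
    ring_nf
  · beta_reduce
    rw [mul_neg, theta1_neg]; ring

theorem theta1_add_two_tau (v τ : ℂ) :
    theta1 (v + 2 * τ) τ = cexp (-4 * π * I * τ - 4 * π * I * v) * theta1 v τ := by
  rw [two_mul, ← add_assoc, theta1_add_tau, theta1_add_tau, neg_mul (cexp _), neg_mul (cexp _),
    mul_neg, neg_neg, ← mul_assoc, ← Complex.exp_add]
  ring_nf

theorem theta1_two_mul_mem (hτ : 0 < τ.im) :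
    (fun v => theta1 (2 * v) τ) ∈ thetaSpaceParity 4 1 1 (-1) τ := by
  refine ⟨⟨(differentiable_theta1 hτ).comp (by fun_prop : Differentiable ℂ fun v : ℂ => 2 * v),
    fun v => ?_, fun v => ?_⟩, fun v => ?_⟩
  · have := theta1_add_nat (2 * v) τ 2
    push_cast at this
    beta_reduce
    rw [mul_add, mul_one, this]; norm_num
  · beta_reduce
    rw [mul_add, theta1_add_two_tau]
    push_cast
    ring_nf
  · beta_reduce
    rw [mul_neg, theta1_neg]; ring

theorem theta1_half_mem (hτ : 0 < τ.im) :
    (fun v => theta1 v (τ / 2)) ∈ thetaSpaceParity 2 (-1) 1 (-1) τ := by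
  have hτ2 : 0 < (τ / 2).im := by simpa using hτ
  refine ⟨⟨differentiable_theta1 hτ2, fun v => ?_, fun v => ?_⟩, fun v => ?_⟩
  · beta_reduce
    rw [theta1_add_one]; ring
  · have h := theta1_add_two_tau v (τ / 2)
    rw [mul_div_cancel₀ τ two_ne_zero] at h
    beta_reduce
    rw [h]
    push_cast
    ring_nf
  · beta_reduce
    rw [theta1_neg]; ring

theorem theta0_two_mul_two_mem (hτ : 0 < τ.im) :
    (fun v => theta0 (2 * v) (2 * τ)) ∈ thetaSpaceParity 2 1 (-1) 1 τ := by
  have hτ2 : 0 < (2 * τ).im := by simpa using hτ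
  refine ⟨⟨(differentiable_theta0 hτ2).comp (by fun_prop : Differentiable ℂ fun v : ℂ => 2 * v),
    fun v => ?_, fun v => ?_⟩, fun v => ?_⟩
  · beta_reduce
    rw [mul_add, mul_one, show 2 * v + 2 = 2 * v + 1 + 1 by ring, theta0_add_one, theta0_add_one]
    ring
  · beta_reduce
    rw [mul_add, theta0_add_tau]
    push_cast
    ring_nf
  · beta_reduce
    rw [mul_neg, theta0_neg]; ring

end

/-- The product `∏ κ(x_l) ∏_{j<k} ϑ₁(x_k - x_j) ϑ₁(x_k + x_j)`. -/
noncomputable def pairProduct {N : ℕ} (κ : ℂ → ℂ) (τ : ℂ) (x : Fin N → ℂ) : ℂ :=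
  (∏ l, κ (x l)) * ∏ j, ∏ k ∈ Finset.Ioi j, (theta1 (x k - x j) τ * theta1 (x k + x j) τ)

theorem pairProduct_comp_perm {N : ℕ} (κ : ℂ → ℂ) (τ : ℂ) (x : Fin N → ℂ)
    (σ : Equiv.Perm (Fin N)) :
    pairProduct κ τ (x ∘ σ) = (Equiv.Perm.sign σ : ℤ) * pairProduct κ τ x := by
  unfold pairProduct
  have h := Equiv.Perm.prod_Ioi_comp_eq_sign_mul_prod σ
    (f := fun j k => theta1 (x k - x j) τ * theta1 (x k + x j) τ) fun j k => by
      rw [← neg_sub, theta1_neg, add_comm (x k)]; ring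
  simp only [Function.comp_apply]
  rw [h, Equiv.prod_comp σ fun l => κ (x l)]
  ring

/-- For an alternating function it suffices to know its dependence on the first variable. -/
theorem slot_of_slot_zero {n : ℕ} {V : Submodule ℂ (ℂ → ℂ)} {P : (Fin (n + 1) → ℂ) → ℂ}
    (hslot : ∀ x, (fun t => P (Function.update x 0 t)) ∈ V)
    (hperm : ∀ x (σ : Equiv.Perm (Fin (n + 1))), P (x ∘ σ) = (Equiv.Perm.sign σ : ℤ) * P x)
    (x : Fin (n + 1) → ℂ) (i : Fin (n + 1)) : (fun t => P (Function.update x i t)) ∈ V := by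
  have h := V.smul_mem ((Equiv.Perm.sign (Equiv.swap 0 i) : ℤ) : ℂ)
    (hslot (x ∘ Equiv.swap 0 i))
  convert h using 1
  ext t
  rw [Pi.smul_apply, smul_eq_mul, ← hperm]
  congr 1
  ext m
  rw [Function.comp_apply]
  by_cases hm : m = i
  · subst hm; simp
  · rw [Function.update_of_ne hm, Function.update_of_ne, Function.comp_apply, Equiv.swap_apply_self]
    intro h0
    exact hm (by rw [← Equiv.swap_apply_self 0 i m, h0, Equiv.swap_apply_left])

/-- In each variable every one of the `N - 1` pair factors contributes degree `2`. -/
theorem pairProduct_slot_mem {N m : ℕ} {κ : ℂ → ℂ} {ε₁ ε₂ σ τ : ℂ} (hτ : 0 < τ.im) (hN : 0 < N)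
    (hκ : κ ∈ thetaSpaceParity m ε₁ ε₂ σ τ) (x : Fin N → ℂ) (i : Fin N) :
    (fun t => pairProduct κ τ (Function.update x i t))
      ∈ thetaSpaceParity (m + (N - 1) * 2) ε₁ ε₂ σ τ := by
  obtain ⟨n, rfl⟩ : ∃ n, N = n + 1 := ⟨N - 1, by omega⟩
  refine slot_of_slot_zero (P := pairProduct κ τ) (fun x => ?_) (pairProduct_comp_perm κ τ) x i
  have h := mul_mem_thetaSpaceParity hκ (prod_mem_thetaSpaceParity Finset.univ
    fun (k : Fin n) _ => theta1_pair_mem hτ (x k.succ))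
  simp only [one_pow, mul_one, Finset.card_univ, Fintype.card_fin] at h
  have h2 := Submodule.smul_mem _ ((∏ l : Fin n, κ (x l.succ)) * ∏ j : Fin n,
    ∏ k ∈ Finset.Ioi j, (theta1 (x k.succ - x j.succ) τ * theta1 (x k.succ + x j.succ) τ)) h
  rw [Nat.add_sub_cancel]
  convert h2 using 1
  ext t
  unfold pairProduct
  rw [Pi.smul_apply, smul_eq_mul, Fin.prod_univ_succ, Fin.prod_univ_succ, Fin.prod_Ioi_zero]
  simp only [Fin.prod_Ioi_succ, Function.update_self,
    Function.update_of_ne (Fin.succ_ne_zero _)]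
  ring

/-! ### Determinants of theta waves in product form -/

/-- An alternating function whose slots lie in a space with a zero criterion is proportional to
the determinant; the constant is read off at the points `y`. -/
theorem det_eq_of_alternating {N : ℕ} {V : Submodule ℂ (ℂ → ℂ)} {e : ℂ}
    (hc : ∀ F ∈ V, Continuous F)
    (hV : ∀ F ∈ V, (∀ n : ℕ, n < N → twistedCoeff (e + n) F = 0) → F = 0)
    {f : Fin N → ℂ → ℂ} (hf : ∀ l, f l ∈ V) {P : (Fin N → ℂ) → ℂ}
    (hslot : ∀ x i, (fun t => P (Function.update x i t)) ∈ V)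
    (hperm : ∀ x (σ : Equiv.Perm (Fin N)), P (x ∘ σ) = (Equiv.Perm.sign σ : ℤ) * P x)
    {y : Fin N → ℂ} {Q d p : ℂ} {a b c C₀ : ℝ} (hd : d ≠ 0) (hp : p ≠ 0)
    (hdet : (Matrix.of fun l m => f l (y m)).det * cexp Q = d * ((Real.exp a : ℝ) : ℂ))
    (hP : P y = p * ((Real.exp b : ℝ) : ℂ)) (hab : a = c + C₀ + b) (v : Fin N → ℂ) :
    (Matrix.of fun l m => f l (v m)).det * cexp Q
      = d / p * ((Real.exp c : ℝ) : ℂ) * (((Real.exp C₀ : ℝ) : ℂ) * P v) := by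
  have he : ∀ a : ℝ, ((Real.exp a : ℝ) : ℂ) ≠ 0 := fun a =>
    Complex.ofReal_ne_zero.mpr (Real.exp_ne_zero a)
  have hy : (Matrix.of fun l m => f l (y m)).det ≠ 0 := by
    intro h
    rw [h, zero_mul] at hdet
    exact mul_ne_zero hd (he a) hdet.symm
  have h := alternating_mul_det hf
    (fun F hF h0 => eq_zero_of_forall_eval_eq_zero hc hV hf hy hF h0) hslot hperm (y := y) v
  rw [hP] at h
  rw [hab, Real.exp_add, Real.exp_add] at hdet
  push_cast at hdet h ⊢
  have hb := he b
  rw [Complex.ofReal_exp] at hb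
  have : (Matrix.of fun l m => f l (v m)).det * cexp Q * (p * cexp b)
      = d * (cexp c * cexp C₀ * cexp b) * P v := by
    rw [← hdet]
    linear_combination (-cexp Q) * h
  apply mul_right_cancel₀ (mul_ne_zero hp hb)
  rw [this]
  field_simp

/-- The determinant of the symmetrized waves at the division points `(k₀ + m + n / 2) / M`. -/
theorem det_wave_division {N M n k₀ : ℕ} {s : ℝ} {α σ : ℂ} (hM : 0 < M) (hs : 0 < s)
    (hα : α + n / 2 = 1 / 2) (J : Fin N → ℝ) {y : Fin N → ℝ}
    (hy : ∀ m, y m = ((k₀ + m : ℕ) + (n : ℝ) / 2) / M) :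
    (Matrix.of fun l m : Fin N =>
        wave (J l) M α (I * s) (y m) - σ * wave (J l) M α (I * s) (-(y m))).det
        * cexp (∑ l, π * I * (I * s) * J l ^ 2 / M)
      = (∏ m : Fin N, (-1 : ℂ) ^ (k₀ + (m : ℕ))) * (Matrix.of fun l m : Fin N =>
          cexp (2 * π * I * J l * y m) - σ * (-1) ^ n * cexp (-(2 * π * I * J l * y m))).det
        * ((Real.exp (∑ l, (logEta (M * s) + logThetaImag (J l / M) (M * s))) : ℝ) : ℂ) := by
  have h : (Matrix.of fun l m : Fin N =>
        wave (J l) M α (I * s) (y m) - σ * wave (J l) M α (I * s) (-(y m)))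
      = Matrix.of fun l m : Fin N => (-1 : ℂ) ^ (k₀ + (m : ℕ)) * (Matrix.of fun l m : Fin N =>
          theta1 (J l * (I * s) + 1 / 2) (M * (I * s)) * (Matrix.of fun l m : Fin N =>
          cexp (2 * π * I * J l * y m)
            - σ * (-1) ^ n * cexp (-(2 * π * I * J l * y m))) l m) l m := by
    ext l m
    have e : (y m : ℂ) = (((k₀ + m : ℕ) : ℂ) + (n : ℂ) / 2) / M := by
      rw [hy]; push_cast; ring
    simp only [Matrix.of_apply]
    rw [e, wave_division hM hα, wave_division_neg hM hα n (k₀ + m) (by ring), pow_add]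
    ring
  rw [h, Matrix.det_mul_row, Matrix.det_mul_column, Complex.exp_sum, Real.exp_sum]
  have h3 := fun l => exp_mul_theta1_wave hM hs (J l)
  push_cast at h3 ⊢
  simp only [← h3, Finset.prod_mul_distrib]
  ring

theorem sin_pi_mul_ne_zero {x : ℝ} (h0 : 0 < x) (h1 : x < 1) : Real.sin (π * x) ≠ 0 := by
  have := Real.pi_pos
  exact (Real.sin_pos_of_pos_of_lt_pi (by positivity) (by nlinarith)).ne'

/-- The product side at real points is an elementary constant times the exponential of a sum of
real logarithms. -/
theorem pairProduct_eq_exp {N : ℕ} {s : ℝ} (hs : 0 < s) {κ : ℂ → ℂ} {y : Fin N → ℝ}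
    {q : Fin N → ℂ} {g : Fin N → ℝ} (hκ : ∀ l, κ (y l) = q l * ((Real.exp (g l) : ℝ) : ℂ)) :
    pairProduct κ (I * s) (fun l => (y l : ℂ))
      = ((∏ l, q l) * ∏ j : Fin N, ∏ k ∈ Finset.Ioi j,
          (((2 * Real.sin (π * (y k - y j))) * (2 * Real.sin (π * (y k + y j))) : ℝ) : ℂ))
        * ((Real.exp (∑ l, g l + ∑ j : Fin N, ∑ k ∈ Finset.Ioi j,
          ((logEta s + logTheta (y k - y j) s) + (logEta s + logTheta (y k + y j) s))) : ℝ) : ℂ) := by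
  have h : ∀ j k : Fin N, theta1 (y k - y j) (I * s) * theta1 (y k + y j) (I * s)
      = (((2 * Real.sin (π * (y k - y j))) * (2 * Real.sin (π * (y k + y j))) : ℝ) : ℂ)
        * ((Real.exp ((logEta s + logTheta (y k - y j) s)
          + (logEta s + logTheta (y k + y j) s)) : ℝ) : ℂ) := by
    intro j k
    have h1 := theta1_eq_exp hs (y k - y j)
    have h2 := theta1_eq_exp hs (y k + y j)
    push_cast at h1 h2 ⊢
    rw [h1, h2, Complex.exp_add (_ + _)]
    ring
  unfold pairProduct
  rw [Real.exp_add, Real.exp_sum, Real.exp_sum]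
  simp only [Real.exp_sum, Complex.ofReal_mul _ (∏ _, _), Complex.ofReal_prod, h, hκ,
    Finset.prod_mul_distrib]
  ring

/-- The determinant formula for the families with a reflection `v ↦ -v`. Here `m` is the degree of
`κ = k₁`, which takes the values `q exp(g)` at the division points `y`; the numbers `e + l` with
`e = -w / 2` and `l < N` are the frequencies whose Fourier coefficients determine the functions of
the family; `htrig` is the trigonometric determinant left over at the division points; and `heta`
identifies `exp (C₀ s)` as the prefactor. -/
theorem det_wave_sub_formula {N M m n k₀ w : ℕ} {α e σ ε₁ ε₂ : ℂ} {J : Fin N → ℝ}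
    {κ : ℝ → ℂ → ℂ} {y : Fin N → ℝ} {q : Fin N → ℂ} {g : ℝ → Fin N → ℝ} {c : ℝ} {C₀ : ℝ → ℝ}
    (hN : 0 < N) (hM : m + (N - 1) * 2 = M) (hM0 : 0 < M) (hα : α + n / 2 = 1 / 2)
    (hy : ∀ m, y m = ((k₀ + m : ℕ) + (n : ℝ) / 2) / M)
    (hy1 : ∀ m k : Fin N, m < k → y k + y m < 1) (hy0 : ∀ m k : Fin N, m < k → 0 < y k + y m)
    (h1 : ∀ l, cexp (2 * π * I * J l) * (-1) ^ M = ε₁) (h2 : -cexp (-(2 * π * I * α)) = ε₂)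
    (hε₁ : ε₁ * ε₁ = 1) (hε₂ : ε₂ * ε₂ = 1) (hσ : σ * σ = 1)
    (he : cexp (2 * π * I * e) = ε₁) (hw : 2 * e = -w)
    (hcover : ∀ n < M, n < N ∨ (n ≤ w ∧ w < n + N) ∨ (-σ = -1 ∧ 2 * n = w) ∨
      (-σ = -1 ∧ ε₂ = 1 ∧ 2 * n = M + w))
    (htrig : (Matrix.of fun l m : Fin N => cexp (2 * π * I * J l * y m)
      - σ * (-1) ^ n * cexp (-(2 * π * I * J l * y m))).det ≠ 0)
    (hκm : ∀ s : ℝ, 0 < s → κ s ∈ thetaSpaceParity m ε₁ ε₂ (-σ) (I * s))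
    (hκ : ∀ s : ℝ, 0 < s → ∀ l, κ s (y l) = q l * ((Real.exp (g s l) : ℝ) : ℂ))
    (hq : ∀ l, q l ≠ 0)
    (heta : ∀ s : ℝ, 0 < s → ∑ l, (logEta (M * s) + logThetaImag (J l / M) (M * s))
      = c + C₀ s + (∑ l, g s l + ∑ j : Fin N, ∑ k ∈ Finset.Ioi j,
          ((logEta s + logTheta (y k - y j) s) + (logEta s + logTheta (y k + y j) s)))) :
    ∃ C : ℂ, C ≠ 0 ∧ ∀ s : ℝ, 0 < s → ∀ v : Fin N → ℂ,
      (Matrix.of fun l m : Fin N =>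
        wave (J l) M α (I * s) (v m) - σ * wave (J l) M α (I * s) (-(v m))).det
        * cexp (∑ l, π * I * (I * s) * J l ^ 2 / M)
      = C * (((Real.exp (C₀ s) : ℝ) : ℂ) * pairProduct (κ s) (I * s) v) := by
  have hMr : (0 : ℝ) < M := by exact_mod_cast hM0
  have hd : (∏ m : Fin N, (-1 : ℂ) ^ (k₀ + (m : ℕ))) * (Matrix.of fun l m : Fin N =>
      cexp (2 * π * I * J l * y m)
        - σ * (-1) ^ n * cexp (-(2 * π * I * J l * y m))).det ≠ 0 :=
    mul_ne_zero (Finset.prod_ne_zero_iff.mpr fun m _ => pow_ne_zero _ (by norm_num)) htrig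
  have hmono : ∀ j k : Fin N, j < k → 0 < y k - y j ∧ y k - y j ≤ y k + y j := by
    intro j k hjk
    have h3 : ((j : ℕ) : ℝ) < (k : ℕ) := by exact_mod_cast hjk
    refine ⟨?_, ?_⟩
    · rw [hy, hy, ← sub_div]
      apply div_pos _ hMr
      push_cast
      linarith
    · have : 0 ≤ y j := by rw [hy]; positivity
      linarith
  have hp : ((∏ l, q l) * ∏ j : Fin N, ∏ k ∈ Finset.Ioi j,
      (((2 * Real.sin (π * (y k - y j))) * (2 * Real.sin (π * (y k + y j))) : ℝ) : ℂ)) ≠ 0 := by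
    refine mul_ne_zero (Finset.prod_ne_zero_iff.mpr fun l _ => hq l)
      (Finset.prod_ne_zero_iff.mpr fun j _ => Finset.prod_ne_zero_iff.mpr fun k hk => ?_)
    rw [Finset.mem_Ioi] at hk
    obtain ⟨h3, h4⟩ := hmono j k hk
    have h5 := hy1 j k hk
    exact Complex.ofReal_ne_zero.mpr (mul_ne_zero
      (mul_ne_zero two_ne_zero (sin_pi_mul_ne_zero h3 (by linarith)))
      (mul_ne_zero two_ne_zero (sin_pi_mul_ne_zero (hy0 j k hk) h5)))
  have hε₂0 : ε₂ ≠ 0 := by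
    rintro rfl
    simp at hε₂
  refine ⟨_, mul_ne_zero (div_ne_zero hd hp)
    (Complex.ofReal_ne_zero.mpr (Real.exp_ne_zero c)), fun s hs v => ?_⟩
  have hτ : 0 < (I * s : ℂ).im := by simpa using hs
  exact det_eq_of_alternating (V := thetaSpaceParity M ε₁ ε₂ (-σ) (I * s)) (e := e)
    (fun F hF => hF.1.1.continuous)
    (fun F hF h0 => eq_zero_of_twistedCoeff_parity hM0 hF hε₂0 he hw hcover h0)
    (fun l => wave_sub_mem hM0 hs (h1 l) h2 hε₁ hε₂ hσ)
    (fun x i => hM ▸ pairProduct_slot_mem hτ hN (hκm s hs) x i)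
    (fun x p => pairProduct_comp_perm _ _ x p)
    hd hp (det_wave_division hM0 hs hα J hy) (pairProduct_eq_exp hs (hκ s hs)) (heta s hs) v

/-- The trigonometric determinant of the families with cosines. -/
theorem det_exp_add_exp_ne_zero {N : ℕ} {y : Fin N → ℝ} (hy : Function.Injective y)
    (h : ∀ m, 0 ≤ y m ∧ y m ≤ 1 / 2) {J : Fin N → ℝ} (hJ : ∀ l, J l = (l : ℕ)) {ρ : ℂ}
    (hρ : ρ = -1) :
    (Matrix.of fun l m : Fin N => cexp (2 * π * I * J l * y m)
      - ρ * cexp (-(2 * π * I * J l * y m))).det ≠ 0 := by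
  have hpi := Real.pi_pos
  have hd := det_cos_ne_zero (φ := fun m => 2 * π * y m)
    (fun a b hab => hy (mul_left_cancel₀ (by positivity) hab))
    (fun m => ⟨mul_nonneg (by positivity) (h m).1, by nlinarith [(h m).2]⟩)
  have e : (Matrix.of fun l m : Fin N => cexp (2 * π * I * J l * y m)
      - ρ * cexp (-(2 * π * I * J l * y m)))
      = Matrix.of fun l m => (2 : ℂ) * (Matrix.of fun l m : Fin N =>
        ((Real.cos ((l : ℕ) * (2 * π * y m)) : ℝ) : ℂ)) l m := by
    ext l m
    simp only [Matrix.of_apply]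
    rw [hρ, hJ]
    push_cast
    rw [Complex.cos]
    ring_nf
  rw [e, Matrix.det_mul_row (fun _ => (2 : ℂ))]
  exact mul_ne_zero (Finset.prod_ne_zero_iff.mpr fun _ _ => two_ne_zero) hd

/-- The trigonometric determinant of the families with sines. -/
theorem det_exp_sub_exp_ne_zero {N : ℕ} {y : Fin N → ℝ} (hy : Function.Injective y)
    (h : ∀ m, 0 < y m ∧ y m ≤ 1 / 2) {ε : ℝ} (hε : ε = 1 ∧ (∀ m, y m < 1 / 2) ∨ ε = 1 / 2)
    {J : Fin N → ℝ} (hJ : ∀ l, J l = (l : ℕ) + ε) {ρ : ℂ} (hρ : ρ = 1) :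
    (Matrix.of fun l m : Fin N => cexp (2 * π * I * J l * y m)
      - ρ * cexp (-(2 * π * I * J l * y m))).det ≠ 0 := by
  have hpi := Real.pi_pos
  have hd := det_sin_ne_zero (φ := fun m => 2 * π * y m)
    (fun a b hab => hy (mul_left_cancel₀ (by positivity) hab))
    (fun m => ⟨mul_nonneg (by positivity) (h m).1.le, by nlinarith [(h m).2]⟩)
    (hε.imp And.left id) (fun m => by
      have hm := h m
      rw [show ε * (2 * π * y m) = π * (2 * ε * y m) by ring]
      rcases hε with ⟨rfl, h3⟩ | rfl
      · exact sin_pi_mul_ne_zero (by linarith [hm.1]) (by linarith [h3 m])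
      · exact sin_pi_mul_ne_zero (by linarith [hm.1]) (by linarith [hm.2]))
  have e : (Matrix.of fun l m : Fin N => cexp (2 * π * I * J l * y m)
      - ρ * cexp (-(2 * π * I * J l * y m)))
      = Matrix.of fun l m => (2 * I : ℂ) * (Matrix.of fun l m : Fin N =>
        ((Real.sin (((l : ℕ) + ε) * (2 * π * y m)) : ℝ) : ℂ)) l m := by
    ext l m
    simp only [Matrix.of_apply]
    rw [hρ, hJ]
    push_cast
    rw [Complex.sin]
    ring_nf
    rw [I_sq]
    ring_nf
  rw [e, Matrix.det_mul_row (fun _ => (2 * I : ℂ))]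
  exact mul_ne_zero (Finset.prod_ne_zero_iff.mpr fun _ _ => mul_ne_zero two_ne_zero I_ne_zero) hd

/-! ### The determinant formula for each family with a reflection -/

theorem eta_zpow_eq_exp {y : ℝ} (hy : 0 < y) (k : ℤ) :
    ModularForm.eta (I * y) ^ k = ((Real.exp (k * logEta y) : ℝ) : ℂ) := by
  rw [eta_eq_exp hy, ← Complex.ofReal_zpow, mul_comm, Real.exp_mul,
    Real.rpow_intCast]

theorem I_mul_two_mul (s : ℝ) : 2 * (I * s : ℂ) = I * ((2 * s : ℝ) : ℂ) := by push_cast; ring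

theorem I_mul_div_two (s : ℝ) : (I * s : ℂ) / 2 = I * ((s / 2 : ℝ) : ℂ) := by push_cast; ring

/-- The product formula for the determinant of the `f^R_ℓ`: up to a nonzero constant and an
exponential which are independent of the points, the determinant is
`c₀ k_sym ∏ k₁ ∏ k₂`. -/
def DetFormula (R : RootFamily) (N : ℕ) (r : ℝ) : Prop :=
  ∃ C : ℂ, C ≠ 0 ∧ ∀ s : ℝ, 0 < s → ∀ x : Fin N → ℝ,
    (fMatrix (fun j z => f R N r j z (I * s)) (fun m => (x m : ℂ))).det
      * cexp (∑ l : Fin N, π * I * (I * s) * (J R ((l : ℤ) + 1)) ^ 2 / calN R N)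
    = C * (c0 R N (I * s) * kSym R r x (I * s) * (∏ l, k1 R r (x l) (I * s))
      * ∏ j : Fin N, ∏ k ∈ Finset.Ioi j, k2 R r (x k) (x j) (I * s))

/-- The passage from the normalized variable `v = z / (2πr)` and the functions `wave`, `pairProduct`
to the functions of the family `R`. -/
theorem detFormula_of_wave {R : RootFamily} {N M : ℕ} {r : ℝ} {α σ : ℂ} {κ : ℝ → ℂ → ℂ}
    {C₀ : ℝ → ℝ} (hR : R ≠ .A) (hM : calN R N = M)
    (hf : ∀ j z τ, f R N r j z τ = thetaWave (J R j) (calN R N) r α τ z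
      - σ * thetaWave (J R j) (calN R N) r α τ (-z))
    (hk1 : ∀ s x : ℝ, k1 R r x (I * s) = κ s ((x : ℂ) / (2 * π * r)))
    (hc0 : ∀ s : ℝ, 0 < s → c0 R N (I * s) = ((Real.exp (C₀ s) : ℝ) : ℂ))
    (h : ∃ C : ℂ, C ≠ 0 ∧ ∀ s : ℝ, 0 < s → ∀ v : Fin N → ℂ,
      (Matrix.of fun l m : Fin N => wave (J R ((l : ℤ) + 1)) M α (I * s) (v m)
        - σ * wave (J R ((l : ℤ) + 1)) M α (I * s) (-(v m))).det
        * cexp (∑ l : Fin N, π * I * (I * s) * (J R ((l : ℤ) + 1) : ℂ) ^ 2 / M)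
      = C * (((Real.exp (C₀ s) : ℝ) : ℂ) * pairProduct (κ s) (I * s) v)) :
    DetFormula R N r := by
  obtain ⟨C, hC, h⟩ := h
  refine ⟨C, hC, fun s hs x => ?_⟩
  have h' := h s hs fun m => (x m : ℂ) / (2 * π * r)
  have hsym : kSym R r x (I * s) = 1 := by
    cases R <;> first | rfl | exact absurd rfl hR
  have hk2 : ∀ a b : ℝ, k2 R r a b (I * s)
      = theta1 ((a : ℂ) / (2 * π * r) - (b : ℂ) / (2 * π * r)) (I * s)
        * theta1 ((a : ℂ) / (2 * π * r) + (b : ℂ) / (2 * π * r)) (I * s) := by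
    intro a b
    rw [← sub_div, ← add_div]
    cases R <;> first | exact absurd rfl hR | (simp only [k2]; push_cast; rfl)
  rw [hc0 s hs, hsym]
  simp only [hk1, hk2, fMatrix, hf, hM, thetaWave_eq_wave, neg_div, Complex.ofReal_natCast]
  rw [h', pairProduct]
  ring

section

variable {N : ℕ} {r : ℝ}

theorem cast_mul_I_im_pos {s : ℝ} (hs : 0 < s) : 0 < (I * s : ℂ).im := by simpa using hs

theorem exp_two_pi_I_mul_nat (n : ℕ) : cexp (2 * π * I * n) = 1 := by
  rw [mul_comm]
  exact_mod_cast Complex.exp_nat_mul_two_pi_mul_I n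

theorem exp_two_pi_I_mul_neg_half (w : ℕ) : cexp (2 * π * I * (-(w : ℂ) / 2)) = (-1) ^ w := by
  rw [show 2 * π * I * (-(w : ℂ) / 2) = w * (-(π * I)) by ring, Complex.exp_nat_mul,
    Complex.exp_neg, Complex.exp_pi_mul_I]
  norm_num

theorem division_lt {a M : ℝ} (hM : 0 < M) {m k : Fin N} (hmk : m < k) :
    (((m : ℕ) : ℝ) + a) / M < (((k : ℕ) : ℝ) + a) / M := by
  have : ((m : ℕ) : ℝ) < (k : ℕ) := by exact_mod_cast hmk
  gcongr

theorem division_injective {a M : ℝ} (hM : 0 < M) :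
    Function.Injective fun m : Fin N => (((m : ℕ) : ℝ) + a) / M :=
  StrictMono.injective fun _ _ => division_lt hM

/-- The functions have frequencies `J + M (ℤ - 1 / 2)` with `0 ≤ J < N`, so `N` consecutive ones
start at `-M / 2`; as `M = 2N - 1`, the reflection covers the other residues. -/
theorem detFormula_B (hN : 2 ≤ N) : DetFormula .B N r := by
  obtain ⟨M, hM⟩ : ∃ M, M + 1 = 2 * N := ⟨2 * N - 1, by omega⟩
  have hMr : (M : ℝ) + 1 = 2 * N := by exact_mod_cast hM
  have hM0 : (0 : ℝ) < M := by exact_mod_cast (show 0 < M by omega)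
  have hMR : calN .B N = M := by simp only [calN]; linarith
  have hodd : Odd M := ⟨N - 1, by omega⟩
  have hlt : ∀ m : Fin N, ((m : ℕ) : ℝ) + 1 ≤ N := fun m => by exact_mod_cast m.2
  have hJ : ∀ l : Fin N, J .B ((l : ℤ) + 1) = (l : ℕ) := fun l => by simp [J]
  refine detFormula_of_wave (α := 0) (σ := 1) (κ := fun s v => theta1 v (I * s))
    (C₀ := fun s => -(N * (N - 1)) * logEta s) (by simp) hMR
    (fun j z τ => by simp only [f, one_mul]) (fun s x => by simp only [k1]; push_cast; rfl)
    (fun s hs => by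
      simp only [c0]; rw [eta_zpow_eq_exp hs]; push_cast; rfl) ?_
  have hpt : ∀ m : Fin N, 0 < (((m : ℕ) : ℝ) + 1 / 2) / M ∧ (((m : ℕ) : ℝ) + 1 / 2) / M ≤ 1 / 2 := by
    intro m
    refine ⟨by positivity, ?_⟩
    rw [div_le_iff₀ hM0]
    linarith [hlt m]
  refine det_wave_sub_formula (m := 1) (n := 1) (k₀ := 0) (w := M) (e := -(M : ℂ) / 2)
    (ε₁ := -1) (ε₂ := -1)
    (y := fun m => (((m : ℕ) : ℝ) + 1 / 2) / M)
    (q := fun m => 2 * Real.sin (π * ((((m : ℕ) : ℝ) + 1 / 2) / M)))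
    (g := fun s m => logEta s + logTheta ((((m : ℕ) : ℝ) + 1 / 2) / M) s) (c := Real.log 2)
    (by omega) (by omega) (by omega) (by norm_num)
    (fun m => by push_cast; ring) (fun m k hmk => ?_) (fun m k _ => ?_) (fun l => ?_) ?_ (by ring)
    (by ring) (by ring) ?_ (by ring) ?_ ?_ (fun s hs => ?_) (fun s hs l => ?_) (fun l => ?_)
    (fun s hs => ?_)
  · linarith [division_lt (a := 1 / 2) hM0 hmk, (hpt k).2]
  · linarith [hpt m, hpt k]
  · rw [hJ, Complex.ofReal_natCast, exp_two_pi_I_mul_nat, hodd.neg_one_pow, one_mul]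
  · simp
  · rw [exp_two_pi_I_mul_neg_half, hodd.neg_one_pow]
  · intro n hn
    rcases lt_or_ge n N with h | h
    · exact Or.inl h
    · exact Or.inr (Or.inl ⟨by omega, by omega⟩)
  · exact det_exp_add_exp_ne_zero (division_injective hM0) (fun m => ⟨(hpt m).1.le, (hpt m).2⟩)
      hJ (by ring)
  · exact theta1_mem (cast_mul_I_im_pos hs)
  · exact_mod_cast theta1_eq_exp hs ((((l : ℕ) : ℝ) + 1 / 2) / M)
  · have := sin_pi_mul_ne_zero (hpt l).1 (by linarith [(hpt l).2])
    exact mul_ne_zero two_ne_zero (Complex.ofReal_ne_zero.mpr this)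
  · have h := eta_identity_B (by omega) hM hs rfl
    rw [Finset.sum_range, Finset.sum_range] at h
    simp only [hJ]
    rw [h]
    ring

/-- The frequencies start at `-M / 2` with `M = 2N`; the remaining residue, the frequency `0`, is
excluded by oddness. -/
theorem detFormula_Bv (hN : 2 ≤ N) : DetFormula .Bv N r := by
  obtain ⟨M, hM⟩ : ∃ M, M = 2 * N := ⟨2 * N, rfl⟩
  have hMr : (M : ℝ) = 2 * N := by exact_mod_cast hM
  have hM0 : (0 : ℝ) < M := by exact_mod_cast (show 0 < M by omega)
  have hMR : calN .Bv N = M := by simp only [calN]; linarith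
  have hev : Even M := ⟨N, by omega⟩
  have hlt : ∀ m : Fin N, ((m : ℕ) : ℝ) + 1 ≤ N := fun m => by exact_mod_cast m.2
  have hJ : ∀ l : Fin N, J .Bv ((l : ℤ) + 1) = (l : ℕ) := fun l => by simp [J]
  refine detFormula_of_wave (α := 0) (σ := 1) (κ := fun s v => theta1 (2 * v) (2 * (I * s)))
    (C₀ := fun s => -(N - 1) ^ 2 * logEta s + -(N - 1) * logEta (2 * s)) (by simp) hMR
    (fun j z τ => by simp only [f, one_mul])
    (fun s x => by simp only [k1]; push_cast; congr 1; ring)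
    (fun s hs => by
      simp only [c0]
      rw [eta_zpow_eq_exp hs, I_mul_two_mul, eta_zpow_eq_exp (by positivity), Real.exp_add]
      push_cast; rfl) ?_
  have hpt : ∀ m : Fin N, 0 < (((m : ℕ) : ℝ) + 1 / 2) / M ∧ (((m : ℕ) : ℝ) + 1 / 2) / M < 1 / 2 := by
    intro m
    refine ⟨by positivity, ?_⟩
    rw [div_lt_iff₀ hM0]
    linarith [hlt m]
  refine det_wave_sub_formula (m := 2) (n := 1) (k₀ := 0) (w := M) (e := -(M : ℂ) / 2)
    (ε₁ := 1) (ε₂ := -1)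
    (y := fun m => (((m : ℕ) : ℝ) + 1 / 2) / M)
    (q := fun m => 2 * Real.sin (π * (2 * ((((m : ℕ) : ℝ) + 1 / 2) / M))))
    (g := fun s m => logEta (2 * s) + logTheta (2 * ((((m : ℕ) : ℝ) + 1 / 2) / M)) (2 * s))
    (c := Real.log 2)
    (by omega) (by omega) (by omega) (by norm_num)
    (fun m => by push_cast; ring) (fun m k _ => ?_) (fun m k _ => ?_) (fun l => ?_) ?_ (by ring)
    (by ring) (by ring) ?_ (by ring) ?_ ?_ (fun s hs => ?_) (fun s hs l => ?_) (fun l => ?_)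
    (fun s hs => ?_)
  · linarith [hpt m, hpt k]
  · linarith [hpt m, hpt k]
  · rw [hJ, Complex.ofReal_natCast, exp_two_pi_I_mul_nat, hev.neg_one_pow, one_mul]
  · simp
  · rw [exp_two_pi_I_mul_neg_half, hev.neg_one_pow]
  · intro n hn
    rcases lt_or_ge n N with h | h
    · exact Or.inl h
    rcases eq_or_lt_of_le h with h | h
    · exact Or.inr (Or.inr (Or.inl ⟨rfl, by omega⟩))
    · exact Or.inr (Or.inl ⟨by omega, by omega⟩)
  · exact det_exp_add_exp_ne_zero (division_injective hM0) (fun m => ⟨(hpt m).1.le, (hpt m).2.le⟩)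
      hJ (by ring)
  · exact theta1_two_mul_two_mem (cast_mul_I_im_pos hs)
  · have h := theta1_eq_exp (y := 2 * s) (by positivity) (2 * ((((l : ℕ) : ℝ) + 1 / 2) / M))
    rw [I_mul_two_mul]
    exact_mod_cast h
  · have := sin_pi_mul_ne_zero (x := 2 * ((((l : ℕ) : ℝ) + 1 / 2) / M)) (by linarith [hpt l])
      (by linarith [hpt l])
    exact mul_ne_zero two_ne_zero (Complex.ofReal_ne_zero.mpr this)
  · have h := eta_identity_Bv (by omega) hM hs rfl
    rw [Finset.sum_range, Finset.sum_range] at h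
    simp only [hJ]
    rw [h]
    ring

/-- The frequencies start at `1 - M / 2 = -N`; the two remaining residues, the frequencies `0` and
`M / 2`, are excluded by oddness. -/
theorem detFormula_C (hN : 2 ≤ N) : DetFormula .C N r := by
  obtain ⟨M, hM⟩ : ∃ M, M = 2 * N + 2 := ⟨2 * N + 2, rfl⟩
  have hMr : (M : ℝ) = 2 * N + 2 := by exact_mod_cast hM
  have hM0 : (0 : ℝ) < M := by exact_mod_cast (show 0 < M by omega)
  have hMR : calN .C N = M := by simp only [calN]; linarith
  have hev : Even M := ⟨N + 1, by omega⟩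
  have hlt : ∀ m : Fin N, ((m : ℕ) : ℝ) + 1 ≤ N := fun m => by exact_mod_cast m.2
  have hJ : ∀ l : Fin N, J .C ((l : ℤ) + 1) = (l : ℕ) + 1 := fun l => by simp [J]
  refine detFormula_of_wave (α := 1 / 2) (σ := 1) (κ := fun s v => theta1 (2 * v) (I * s))
    (C₀ := fun s => -(N * (N - 1)) * logEta s) (by simp) hMR
    (fun j z τ => by simp only [f, one_mul])
    (fun s x => by simp only [k1]; push_cast; congr 1; ring)
    (fun s hs => by
      simp only [c0]; rw [eta_zpow_eq_exp hs]; push_cast; rfl) ?_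
  have hpt : ∀ m : Fin N, 0 < (((m : ℕ) : ℝ) + 1) / M ∧ (((m : ℕ) : ℝ) + 1) / M < 1 / 2 := by
    intro m
    refine ⟨by positivity, ?_⟩
    rw [div_lt_iff₀ hM0]
    linarith [hlt m]
  refine det_wave_sub_formula (m := 4) (n := 0) (k₀ := 1) (w := 2 * N)
    (e := -((2 * N : ℕ) : ℂ) / 2) (ε₁ := 1) (ε₂ := 1)
    (y := fun m => (((m : ℕ) : ℝ) + 1) / M)
    (q := fun m => 2 * Real.sin (π * (2 * ((((m : ℕ) : ℝ) + 1) / M))))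
    (g := fun s m => logEta s + logTheta (2 * ((((m : ℕ) : ℝ) + 1) / M)) s)
    (c := 0)
    (by omega) (by omega) (by omega) (by norm_num)
    (fun m => by push_cast; ring) (fun m k _ => ?_) (fun m k _ => ?_) (fun l => ?_) ?_ (by ring)
    (by ring) (by ring) ?_ (by ring) ?_ ?_ (fun s hs => ?_) (fun s hs l => ?_) (fun l => ?_)
    (fun s hs => ?_)
  · linarith [hpt m, hpt k]
  · linarith [hpt m, hpt k]
  · have h := exp_two_pi_I_mul_nat ((l : ℕ) + 1)
    push_cast at h
    rw [hJ, hev.neg_one_pow]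
    push_cast
    rw [h, one_mul]
  · rw [show -(2 * π * I * (1 / 2)) = -(π * I) by ring, Complex.exp_neg, Complex.exp_pi_mul_I]
    norm_num
  · rw [exp_two_pi_I_mul_neg_half, (even_two_mul N).neg_one_pow]
  · intro n hn
    rcases lt_or_ge n N with h | h
    · exact Or.inl h
    rcases eq_or_lt_of_le h with h | h
    · exact Or.inr (Or.inr (Or.inl ⟨rfl, by omega⟩))
    rcases lt_or_ge (2 * N) n with h' | h'
    · exact Or.inr (Or.inr (Or.inr ⟨rfl, rfl, by omega⟩))
    · exact Or.inr (Or.inl ⟨by omega, by omega⟩)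
  · exact det_exp_sub_exp_ne_zero (division_injective hM0) (fun m => ⟨(hpt m).1, (hpt m).2.le⟩)
      (Or.inl ⟨rfl, fun m => (hpt m).2⟩) hJ (by ring)
  · exact theta1_two_mul_mem (cast_mul_I_im_pos hs)
  · have h := theta1_eq_exp hs (2 * ((((l : ℕ) : ℝ) + 1) / M))
    exact_mod_cast h
  · have := sin_pi_mul_ne_zero (x := 2 * ((((l : ℕ) : ℝ) + 1) / M)) (by linarith [hpt l])
      (by linarith [hpt l])
    exact mul_ne_zero two_ne_zero (Complex.ofReal_ne_zero.mpr this)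
  · have h := eta_identity_C (by omega) hM hs rfl
    rw [Finset.sum_range, Finset.sum_range] at h
    simp only [hJ]
    rw [h]
    ring

/-- The frequencies start at `1 / 2 - M / 2 = -(2N - 1) / 2`, and the reflection covers the other
residues modulo `M = 2N`. The last division point is `1 / 2`, where the sines of half-integral
multiples do not vanish. -/
theorem detFormula_Cv (hN : 2 ≤ N) : DetFormula .Cv N r := by
  obtain ⟨M, hM⟩ : ∃ M, M = 2 * N := ⟨2 * N, rfl⟩
  have hMr : (M : ℝ) = 2 * N := by exact_mod_cast hM
  have hM0 : (0 : ℝ) < M := by exact_mod_cast (show 0 < M by omega)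
  have hMR : calN .Cv N = M := by simp only [calN]; linarith
  have hev : Even M := ⟨N, by omega⟩
  have hodd : Odd (2 * N - 1) := ⟨N - 1, by omega⟩
  have hlt : ∀ m : Fin N, ((m : ℕ) : ℝ) + 1 ≤ N := fun m => by exact_mod_cast m.2
  have hJ : ∀ l : Fin N, J .Cv ((l : ℤ) + 1) = (l : ℕ) + 1 / 2 := fun l => by
    simp only [J]; push_cast; ring
  refine detFormula_of_wave (α := 1 / 2) (σ := 1) (κ := fun s v => theta1 v (I * s / 2))
    (C₀ := fun s => -(N - 1) ^ 2 * logEta s + -(N - 1) * logEta (s / 2)) (by simp) hMR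
    (fun j z τ => by simp only [f, one_mul])
    (fun s x => by simp only [k1]; push_cast; rfl)
    (fun s hs => by
      simp only [c0]
      rw [eta_zpow_eq_exp hs, I_mul_div_two, eta_zpow_eq_exp (by positivity), Real.exp_add]
      push_cast; rfl) ?_
  have hpt : ∀ m : Fin N, 0 < (((m : ℕ) : ℝ) + 1) / M ∧ (((m : ℕ) : ℝ) + 1) / M ≤ 1 / 2 := by
    intro m
    refine ⟨by positivity, ?_⟩
    rw [div_le_iff₀ hM0]
    linarith [hlt m]
  refine det_wave_sub_formula (m := 2) (n := 0) (k₀ := 1) (w := 2 * N - 1)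
    (e := -((2 * N - 1 : ℕ) : ℂ) / 2) (ε₁ := -1) (ε₂ := 1)
    (y := fun m => (((m : ℕ) : ℝ) + 1) / M)
    (q := fun m => 2 * Real.sin (π * ((((m : ℕ) : ℝ) + 1) / M)))
    (g := fun s m => logEta (s / 2) + logTheta ((((m : ℕ) : ℝ) + 1) / M) (s / 2))
    (c := 0)
    (by omega) (by omega) (by omega) (by norm_num)
    (fun m => by push_cast; ring) (fun m k hmk => ?_) (fun m k _ => ?_) (fun l => ?_) ?_ (by ring)
    (by ring) (by ring) ?_ (by ring) ?_ ?_ (fun s hs => ?_) (fun s hs l => ?_) (fun l => ?_)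
    (fun s hs => ?_)
  · linarith [division_lt (a := 1) hM0 hmk, (hpt k).2]
  · linarith [hpt m, hpt k]
  · rw [hJ, hev.neg_one_pow]
    push_cast
    rw [mul_add, Complex.exp_add, exp_two_pi_I_mul_nat,
      show 2 * π * I * (1 / 2) = π * I by ring, Complex.exp_pi_mul_I]
    ring
  · rw [show -(2 * π * I * (1 / 2)) = -(π * I) by ring, Complex.exp_neg, Complex.exp_pi_mul_I]
    norm_num
  · rw [exp_two_pi_I_mul_neg_half, hodd.neg_one_pow]
  · intro n hn
    rcases lt_or_ge n N with h | h
    · exact Or.inl h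
    · exact Or.inr (Or.inl ⟨by omega, by omega⟩)
  · exact det_exp_sub_exp_ne_zero (division_injective hM0) hpt (Or.inr rfl) hJ (by ring)
  · exact theta1_half_mem (cast_mul_I_im_pos hs)
  · have h := theta1_eq_exp (y := s / 2) (by positivity) ((((l : ℕ) : ℝ) + 1) / M)
    rw [I_mul_div_two]
    exact_mod_cast h
  · have := sin_pi_mul_ne_zero (hpt l).1 (by linarith [(hpt l).2])
    exact mul_ne_zero two_ne_zero (Complex.ofReal_ne_zero.mpr this)
  · have h := eta_identity_Cv (by omega) hM hs rfl
    rw [Finset.sum_range, Finset.sum_range] at h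
    simp only [hJ]
    rw [h]
    ring

/-- The frequencies start at `1 - M / 2 = -(2N - 1) / 2`; the remaining residue, the frequency
`M / 2`, is excluded by oddness. -/
theorem detFormula_BC (hN : 2 ≤ N) : DetFormula .BC N r := by
  obtain ⟨M, hM⟩ : ∃ M, M = 2 * N + 1 := ⟨2 * N + 1, rfl⟩
  have hMr : (M : ℝ) = 2 * N + 1 := by exact_mod_cast hM
  have hM0 : (0 : ℝ) < M := by exact_mod_cast (show 0 < M by omega)
  have hMR : calN .BC N = M := by simp only [calN]; linarith
  have hoddM : Odd M := ⟨N, by omega⟩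
  have hev : Even (2 * N) := even_two_mul N
  have hlt : ∀ m : Fin N, ((m : ℕ) : ℝ) + 1 ≤ N := fun m => by exact_mod_cast m.2
  have hJ : ∀ l : Fin N, J .BC ((l : ℤ) + 1) = (l : ℕ) + 1 := fun l => by simp [J]
  refine detFormula_of_wave (α := 1 / 2) (σ := 1)
    (κ := fun s v => theta1 v (I * s) * theta0 (2 * v) (2 * (I * s)))
    (C₀ := fun s => -(N * (N - 1)) * logEta s + -N * logEta (2 * s)) (by simp) hMR
    (fun j z τ => by simp only [f, one_mul])
    (fun s x => by
      simp only [k1]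
      push_cast
      rw [show 2 * ((x : ℂ) / (2 * π * r)) = x / (π * r) by ring])
    (fun s hs => by
      simp only [c0]
      rw [eta_zpow_eq_exp hs, I_mul_two_mul, eta_zpow_eq_exp (by positivity), Real.exp_add]
      push_cast; rfl) ?_
  have hpt : ∀ m : Fin N, 0 < (((m : ℕ) : ℝ) + 1) / M ∧ (((m : ℕ) : ℝ) + 1) / M < 1 / 2 := by
    intro m
    refine ⟨by positivity, ?_⟩
    rw [div_lt_iff₀ hM0]
    linarith [hlt m]
  refine det_wave_sub_formula (m := 3) (n := 0) (k₀ := 1) (w := 2 * N - 1)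
    (e := -((2 * N - 1 : ℕ) : ℂ) / 2) (ε₁ := -1) (ε₂ := 1)
    (y := fun m => (((m : ℕ) : ℝ) + 1) / M)
    (q := fun m => 2 * Real.sin (π * ((((m : ℕ) : ℝ) + 1) / M)))
    (g := fun s m => (logEta s + logTheta ((((m : ℕ) : ℝ) + 1) / M) s)
      + (logEta (2 * s) + logTheta (2 * ((((m : ℕ) : ℝ) + 1) / M)) s
        - logTheta (2 * ((((m : ℕ) : ℝ) + 1) / M)) (2 * s)))
    (c := 0)
    (by omega) (by omega) (by omega) (by norm_num)
    (fun m => by push_cast; ring) (fun m k _ => ?_) (fun m k _ => ?_) (fun l => ?_) ?_ (by ring)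
    (by ring) (by ring) ?_ (by ring) ?_ ?_ (fun s hs => ?_) (fun s hs l => ?_) (fun l => ?_)
    (fun s hs => ?_)
  · linarith [hpt m, hpt k]
  · linarith [hpt m, hpt k]
  · have h := exp_two_pi_I_mul_nat ((l : ℕ) + 1)
    push_cast at h
    rw [hJ, hoddM.neg_one_pow]
    push_cast
    rw [h, one_mul]
  · rw [show -(2 * π * I * (1 / 2)) = -(π * I) by ring, Complex.exp_neg, Complex.exp_pi_mul_I]
    norm_num
  · rw [exp_two_pi_I_mul_neg_half, Odd.neg_one_pow ⟨N - 1, by omega⟩]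
  · intro n hn
    rcases lt_or_ge n N with h | h
    · exact Or.inl h
    rcases lt_or_ge (2 * N - 1) n with h' | h'
    · exact Or.inr (Or.inr (Or.inr ⟨rfl, rfl, by omega⟩))
    · exact Or.inr (Or.inl ⟨by omega, by omega⟩)
  · exact det_exp_sub_exp_ne_zero (division_injective hM0) (fun m => ⟨(hpt m).1, (hpt m).2.le⟩)
      (Or.inl ⟨rfl, fun m => (hpt m).2⟩) hJ (by ring)
  · have h := mul_mem_thetaSpaceParity (theta1_mem (cast_mul_I_im_pos hs))
      (theta0_two_mul_two_mem (cast_mul_I_im_pos hs))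
    norm_num at h ⊢
    exact h
  · have h := theta1_eq_exp hs ((((l : ℕ) : ℝ) + 1) / M)
    have h' := theta0_eq_exp (y := 2 * s) (by positivity) (2 * ((((l : ℕ) : ℝ) + 1) / M))
    rw [mul_div_cancel_left₀ s two_ne_zero] at h'
    rw [I_mul_two_mul, Real.exp_add (logEta s + _)]
    push_cast at h h' ⊢
    rw [h, h']
    ring
  · have := sin_pi_mul_ne_zero (hpt l).1 (by linarith [(hpt l).2])
    exact mul_ne_zero two_ne_zero (Complex.ofReal_ne_zero.mpr this)
  · have h := eta_identity_BC hM hs rfl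
    rw [Finset.sum_range, Finset.sum_range] at h
    simp only [hJ]
    rw [h]
    ring

/-- The functions are even and their frequencies start at `-M / 2` with `M = 2N - 2`. The division
points include both fixed points `0` and `1 / 2` of the reflection, where `κ = 1` does not
vanish. -/
theorem detFormula_D (hN : 2 ≤ N) : DetFormula .D N r := by
  obtain ⟨M, hM⟩ : ∃ M, M + 2 = 2 * N := ⟨2 * N - 2, by omega⟩
  have hMr : (M : ℝ) + 2 = 2 * N := by exact_mod_cast hM
  have hM0 : (0 : ℝ) < M := by exact_mod_cast (show 0 < M by omega)
  have hMR : calN .D N = M := by simp only [calN]; linarith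
  have hev : Even M := ⟨N - 1, by omega⟩
  have hlt : ∀ m : Fin N, ((m : ℕ) : ℝ) + 1 ≤ N := fun m => by exact_mod_cast m.2
  have hJ : ∀ l : Fin N, J .D ((l : ℤ) + 1) = (l : ℕ) := fun l => by simp [J]
  refine detFormula_of_wave (α := 1 / 2) (σ := -1) (κ := fun _ _ => 1)
    (C₀ := fun s => -(N * (N - 2)) * logEta s) (by simp) hMR
    (fun j z τ => by simp only [f]; ring)
    (fun s x => by simp only [k1])
    (fun s hs => by
      simp only [c0]; rw [eta_zpow_eq_exp hs]; push_cast; rfl) ?_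
  have hpt : ∀ m : Fin N, 0 ≤ (((m : ℕ) : ℝ) + 0) / M ∧ (((m : ℕ) : ℝ) + 0) / M ≤ 1 / 2 := by
    intro m
    refine ⟨by positivity, ?_⟩
    rw [div_le_iff₀ hM0]
    linarith [hlt m]
  refine det_wave_sub_formula (m := 0) (n := 0) (k₀ := 0) (w := M)
    (e := -(M : ℂ) / 2) (ε₁ := 1) (ε₂ := 1)
    (y := fun m => (((m : ℕ) : ℝ) + 0) / M) (q := fun _ => 1) (g := fun _ _ => 0)
    (c := Real.log 2)
    (by omega) (by omega) (by omega) (by norm_num)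
    (fun m => by push_cast; ring) (fun m k hmk => ?_) (fun m k hmk => ?_) (fun l => ?_) ?_
    (by ring) (by ring) (by ring) ?_ (by ring) ?_ ?_ (fun s hs => ?_) (fun s hs l => ?_)
    (fun l => one_ne_zero) (fun s hs => ?_)
  · linarith [division_lt (a := 0) hM0 hmk, (hpt k).2]
  · linarith [division_lt (a := 0) hM0 hmk, (hpt m).1]
  · rw [hJ, Complex.ofReal_natCast, exp_two_pi_I_mul_nat, hev.neg_one_pow, one_mul]
  · rw [show -(2 * π * I * (1 / 2)) = -(π * I) by ring, Complex.exp_neg, Complex.exp_pi_mul_I]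
    norm_num
  · rw [exp_two_pi_I_mul_neg_half, hev.neg_one_pow]
  · intro n hn
    rcases lt_or_ge n N with h | h
    · exact Or.inl h
    · exact Or.inr (Or.inl ⟨by omega, by omega⟩)
  · exact det_exp_add_exp_ne_zero (division_injective hM0) hpt hJ (by ring)
  · rw [neg_neg]
    exact ⟨const_mem_thetaSpace 1 _, fun v => by simp⟩
  · simp
  · have h := eta_identity_D hN hM hs rfl
    rw [Finset.sum_range] at h
    simp only [hJ, add_zero, Finset.sum_const_zero, zero_add]
    rw [h]
    ring

end

/-! ### The determinant formula for the family without reflections -/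

theorem prod_theta1_add_mem {ι : Type*} (s : Finset ι) {τ : ℂ} (hτ : 0 < τ.im) (a : ι → ℂ) :
    (fun v => ∏ i ∈ s, theta1 (v + a i) τ)
      ∈ thetaSpace s.card ((-1) ^ s.card)
        ((-1) ^ s.card * cexp (-(2 * π * I * ∑ i ∈ s, a i))) τ := by
  classical
  induction s using Finset.induction_on with
  | empty => simpa using const_mem_thetaSpace 1 τ
  | insert i s hi ih =>
    have h := mul_mem_thetaSpace (theta1_add_const_mem hτ (a i)) ih
    simp only [Finset.prod_insert hi, Finset.sum_insert hi, Finset.card_insert_of_notMem hi]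
    rw [add_comm s.card 1, pow_add, pow_one, mul_add (2 * π * I), neg_add, Complex.exp_add]
    convert h using 2
    ring

/-- The product `ϑ₁(∑ x_j - κ) ∏_{j<k} ϑ₁(x_k - x_j)`. -/
noncomputable def differenceProduct {N : ℕ} (κ τ : ℂ) (x : Fin N → ℂ) : ℂ :=
  theta1 (∑ j, x j - κ) τ * ∏ j, ∏ k ∈ Finset.Ioi j, theta1 (x k - x j) τ

theorem differenceProduct_comp_perm {N : ℕ} (κ τ : ℂ) (x : Fin N → ℂ)
    (σ : Equiv.Perm (Fin N)) :
    differenceProduct κ τ (x ∘ σ) = (Equiv.Perm.sign σ : ℤ) * differenceProduct κ τ x := by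
  unfold differenceProduct
  have h := Equiv.Perm.prod_Ioi_comp_eq_sign_mul_prod σ
    (f := fun j k => theta1 (x k - x j) τ) fun j k => by rw [← neg_sub, theta1_neg]
  simp only [Function.comp_apply]
  rw [h, Equiv.sum_comp σ fun l => x l]
  ring

/-- In each variable the arguments of the `N` theta functions add up to `N v - κ`: the shift by
the other variables cancels. -/
theorem differenceProduct_slot_mem {N : ℕ} {κ τ : ℂ} (hτ : 0 < τ.im) (hN : 0 < N)
    (x : Fin N → ℂ) (i : Fin N) :
    (fun t => differenceProduct κ τ (Function.update x i t))
      ∈ thetaSpace N ((-1) ^ N) ((-1) ^ N * cexp (2 * π * I * κ)) τ := by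
  obtain ⟨n, rfl⟩ : ∃ n, N = n + 1 := ⟨N - 1, by omega⟩
  refine slot_of_slot_zero (P := differenceProduct κ τ) (fun x => ?_)
    (differenceProduct_comp_perm κ τ) x i
  have h := prod_theta1_add_mem Finset.univ hτ
    (Fin.cons (∑ k : Fin n, x k.succ - κ) fun k : Fin n => -x k.succ)
  rw [Finset.card_univ, Fintype.card_fin] at h
  simp only [Fin.prod_univ_succ, Fin.sum_univ_succ, Fin.cons_zero, Fin.cons_succ,
    Finset.sum_neg_distrib] at h
  rw [show -(2 * π * I * (∑ k : Fin n, x k.succ - κ + -∑ k : Fin n, x k.succ)) = 2 * π * I * κ by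
    ring] at h
  have h2 := Submodule.smul_mem _ ((-1) ^ n * ∏ j : Fin n,
    ∏ k ∈ Finset.Ioi j, theta1 (x k.succ - x j.succ) τ) h
  convert h2 using 1
  ext t
  have e : ∏ k : Fin n, theta1 (x k.succ - t) τ
      = (-1) ^ n * ∏ k : Fin n, theta1 (t + -x k.succ) τ := by
    have : ∀ k : Fin n, theta1 (x k.succ - t) τ = (-1) * theta1 (t + -x k.succ) τ := fun k => by
      rw [← sub_eq_add_neg, ← neg_sub, theta1_neg]; ring
    rw [Finset.prod_congr rfl fun k _ => this k, Finset.prod_mul_distrib, Finset.prod_const,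
      Finset.card_univ, Fintype.card_fin]
  unfold differenceProduct
  rw [Pi.smul_apply, smul_eq_mul, Fin.prod_univ_succ, Fin.sum_univ_succ, Fin.prod_Ioi_zero]
  simp only [Fin.prod_Ioi_succ, Function.update_self,
    Function.update_of_ne (Fin.succ_ne_zero _)]
  rw [e, ← add_sub_assoc]
  ring

theorem differenceProduct_eq_exp {N : ℕ} {s κ : ℝ} (hs : 0 < s) {y : Fin N → ℝ}
    (hκ : ∑ l, y l - κ = 1 / 2) :
    differenceProduct κ (I * s) (fun l => (y l : ℂ))
      = (2 * ∏ j : Fin N, ∏ k ∈ Finset.Ioi j, ((2 * Real.sin (π * (y k - y j)) : ℝ) : ℂ))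
        * ((Real.exp ((logEta s + logTheta (1 / 2) s) + ∑ j : Fin N, ∑ k ∈ Finset.Ioi j,
          (logEta s + logTheta (y k - y j) s)) : ℝ) : ℂ) := by
  have h : ∀ j k : Fin N, theta1 (y k - y j) (I * s)
      = ((2 * Real.sin (π * (y k - y j)) : ℝ) : ℂ)
        * ((Real.exp (logEta s + logTheta (y k - y j) s) : ℝ) : ℂ) := by
    intro j k
    exact_mod_cast theta1_eq_exp hs (y k - y j)
  have h0 := theta1_eq_exp hs (1 / 2)
  rw [mul_one_div, Real.sin_pi_div_two, ← hκ] at h0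
  unfold differenceProduct
  rw [Real.exp_add, Real.exp_sum]
  simp only [Real.exp_sum, Complex.ofReal_mul _ (∏ _, _), Complex.ofReal_prod, h,
    Finset.prod_mul_distrib]
  rw [hκ] at h0
  have e : (∑ l, (y l : ℂ) - κ) = ((1 / 2 : ℝ) : ℂ) := by rw [← hκ]; push_cast; rfl
  rw [e, h0]
  push_cast
  ring

theorem sum_fin_cast (N : ℕ) : ∑ m : Fin N, ((m : ℕ) : ℝ) = N * (N - 1) / 2 := by
  rw [← Finset.sum_range fun m => (m : ℝ)]
  induction N with
  | zero => simp
  | succ n ih => rw [Finset.sum_range_succ, ih]; push_cast; ring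

/-- The shift `κ_N` is such that `∑ v_m - κ_N / (2πr) = 1 / 2` at the division points
`(m + n / 2) / N`, where `n = 1` for even `N` and `n = 0` for odd `N`. -/
theorem detFormula_A {N : ℕ} {r : ℝ} (hr : r ≠ 0) (hN : 2 ≤ N) : DetFormula .A N r := by
  obtain ⟨n, hn, hκ, hα, hpow⟩ : ∃ n : ℕ, n < 2 ∧ kappa N r / (2 * π * r) = ((N : ℝ) - 2 + n) / 2
      ∧ (1 - (-1 : ℂ) ^ N) / 4 + n / 2 = 1 / 2 ∧ (-1 : ℂ) ^ (N + n) = -1 := by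
    have hpi := Real.pi_ne_zero
    rcases Nat.even_or_odd N with h | h
    · refine ⟨1, by norm_num, ?_, by rw [h.neg_one_pow]; norm_num, h.add_one.neg_one_pow⟩
      rw [kappa, if_pos h]
      field_simp
      push_cast
      ring
    · refine ⟨0, by norm_num, ?_, by rw [h.neg_one_pow]; norm_num, h.neg_one_pow⟩
      rw [kappa, if_neg (Nat.not_even_iff_odd.mpr h)]
      field_simp
      push_cast
      ring
  have hN0 : (0 : ℝ) < N := by exact_mod_cast (show 0 < N by omega)
  have hJ : ∀ l : Fin N, J .A ((l : ℤ) + 1) = (l : ℕ) := fun l => by simp [J]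
  have hlt : ∀ m : Fin N, ((m : ℕ) : ℝ) + 1 ≤ N := fun m => by exact_mod_cast m.2
  set α : ℂ := (1 - (-1 : ℂ) ^ N) / 4 with hαdef
  set κ : ℝ := kappa N r / (2 * π * r) with hκdef
  set y : Fin N → ℝ := fun m => (((m : ℕ) : ℝ) + (n : ℝ) / 2) / N with hy
  have hdiff : ∀ m k, y m - y k < 1 := by
    intro m k
    rw [hy]
    simp only
    rw [← sub_div, div_lt_one hN0]
    have : (0 : ℝ) ≤ ((k : ℕ) : ℝ) := by positivity
    linarith [hlt m]
  have hmono : StrictMono y := fun _ _ => division_lt hN0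
  have hsum : ∑ l, y l - κ = 1 / 2 := by
    rw [hκ, hy, ← Finset.sum_div, Finset.sum_add_distrib, sum_fin_cast]
    simp only [Finset.sum_const, Finset.card_univ, Fintype.card_fin, nsmul_eq_mul]
    field_simp
    ring
  have hd : (∏ m : Fin N, (-1 : ℂ) ^ (0 + (m : ℕ))) * (Matrix.of fun l m : Fin N =>
      cexp (2 * π * I * ((l : ℕ) : ℝ) * y m)
        - 0 * (-1) ^ n * cexp (-(2 * π * I * ((l : ℕ) : ℝ) * y m))).det ≠ 0 := by
    refine mul_ne_zero (Finset.prod_ne_zero_iff.mpr fun m _ => pow_ne_zero _ (by norm_num)) ?_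
    simpa using det_exp_ne_zero hmono hdiff
  have hp : (2 * ∏ j : Fin N, ∏ k ∈ Finset.Ioi j,
      ((2 * Real.sin (π * (y k - y j)) : ℝ) : ℂ)) ≠ 0 := by
    refine mul_ne_zero two_ne_zero
      (Finset.prod_ne_zero_iff.mpr fun j _ => Finset.prod_ne_zero_iff.mpr fun k hk => ?_)
    rw [Finset.mem_Ioi] at hk
    exact Complex.ofReal_ne_zero.mpr (mul_ne_zero two_ne_zero
      (sin_pi_mul_ne_zero (sub_pos.mpr (hmono hk)) (hdiff k j)))
  have hε : (-1) ^ N * cexp (2 * π * I * κ) = -cexp (-(2 * π * I * α)) := by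
    have e1 : (κ : ℂ) = ((N : ℂ) - 2 + n) / 2 := by rw [hκ]; push_cast; ring
    have e2 : α = 1 / 2 - n / 2 := by linear_combination hα
    rw [e1, e2, show 2 * π * I * (((N : ℂ) - 2 + n) / 2)
        = (N + n : ℕ) * (π * I) + -(2 * π * I) by push_cast; ring,
      show -(2 * π * I * (1 / 2 - (n : ℂ) / 2)) = -(π * I) + n * (π * I) by ring,
      Complex.exp_add, Complex.exp_add, Complex.exp_nat_mul, Complex.exp_nat_mul, Complex.exp_neg,
      Complex.exp_neg, Complex.exp_two_pi_mul_I, Complex.exp_pi_mul_I, pow_add]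
    have h2 : ((-1 : ℂ) ^ N) * (-1) ^ N = 1 := by rw [← mul_pow]; simp
    rw [inv_one, inv_neg, inv_one]
    linear_combination (-1 : ℂ) ^ n * h2
  have hε1 : cexp (2 * π * I * (-(N : ℂ) / 2)) = (-1) ^ N := exp_two_pi_I_mul_neg_half N
  refine ⟨_, mul_ne_zero (div_ne_zero hd hp) (Complex.ofReal_ne_zero.mpr
    (Real.exp_ne_zero (Real.log 2))), fun s hs x => ?_⟩
  have hτ : 0 < (I * s : ℂ).im := cast_mul_I_im_pos hs
  have hcrit : ∀ F ∈ thetaSpace N ((-1) ^ N) ((-1) ^ N * cexp (2 * π * I * κ)) (I * s),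
      (∀ k : ℕ, k < N → twistedCoeff (-(N : ℂ) / 2 + k) F = 0) → F = 0 := fun F hF h0 =>
    eq_zero_of_twistedCoeff_lt (by omega) hF
      (mul_ne_zero (pow_ne_zero _ (by norm_num)) (Complex.exp_ne_zero _)) hε1 h0
  have hdet := det_wave_division (M := N) (k₀ := 0) (by omega) hs hα (σ := 0)
    (fun l : Fin N => ((l : ℕ) : ℝ)) (y := y) fun m => by rw [hy]; push_cast; ring
  simp only [zero_mul, sub_zero] at hdet hd ⊢
  have hmem : ∀ l : Fin N, wave ((l : ℕ) : ℝ) N α (I * s)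
      ∈ thetaSpace N ((-1) ^ N) ((-1) ^ N * cexp (2 * π * I * κ)) (I * s) := fun l =>
    wave_mem_thetaSpace (by omega) hs
      (by rw [Complex.ofReal_natCast, exp_two_pi_I_mul_nat, one_mul]) hε.symm
  have hdvd : (2 : ℤ) ∣ ((N : ℤ) - 1) * ((N : ℤ) - 2) := by
    have := Int.even_mul_pred_self ((N : ℤ) - 1)
    rw [show (N : ℤ) - 1 - 1 = N - 2 by ring] at this
    exact this.two_dvd
  have key := det_eq_of_alternating (C₀ := ((-((((N : ℤ) - 1) * ((N : ℤ) - 2)) / 2) : ℤ) : ℝ)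
      * logEta s) (fun F (hF : F ∈ thetaSpace _ _ _ _) => hF.1.continuous) hcrit hmem
    (fun x i => differenceProduct_slot_mem hτ (by omega) x i)
    (fun x p => differenceProduct_comp_perm _ _ x p) hd hp hdet (differenceProduct_eq_exp hs hsum)
    (by
      have h := eta_identity_A (N := N) (by omega) hs (δ := n / 2) rfl
      rw [Finset.sum_range] at h
      rw [h]
      push_cast
      rw [Int.cast_div hdvd (by norm_num)]
      push_cast
      ring) fun m => (x m : ℂ) / (2 * π * r)
  have hPx : ((Real.exp (((-((((N : ℤ) - 1) * ((N : ℤ) - 2)) / 2) : ℤ) : ℝ) * logEta s) : ℝ) : ℂ)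
      * differenceProduct κ (I * s) (fun m => (x m : ℂ) / (2 * π * r))
      = c0 .A N (I * s) * kSym .A r x (I * s) * (∏ l, k1 .A r (x l) (I * s))
      * ∏ j : Fin N, ∏ k ∈ Finset.Ioi j, k2 .A r (x k) (x j) (I * s) := by
    simp only [c0, kSym, k1, k2, differenceProduct, eta_zpow_eq_exp hs, Finset.prod_const_one,
      mul_one, hκdef]
    push_cast
    simp only [← Finset.sum_div, ← sub_div]
    ring
  rw [← hPx, ← key]
  simp only [fMatrix, f, thetaWave_eq_wave, hJ, calN, ← hαdef, Complex.ofReal_natCast]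

theorem detFormula (R : RootFamily) {N : ℕ} (hN : 2 ≤ N) {r : ℝ} (hr : r ≠ 0) :
    DetFormula R N r := by
  cases R
  · exact detFormula_A hr hN
  · exact detFormula_B hN
  · exact detFormula_Bv hN
  · exact detFormula_C hN
  · exact detFormula_Cv hN
  · exact detFormula_BC hN
  · exact detFormula_D hN

/-! ### Gaussian averages of theta waves -/

section

open MeasureTheory ProbabilityTheory

theorem integrable_of_hasSum_of_summable_integral_norm {ι X : Type*} [Countable ι]
    [MeasurableSpace X] {μ : Measure X} {F : ι → X → ℂ} {f : X → ℂ}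
    (hF : ∀ i, Integrable (F i) μ) (hs : Summable fun i => ∫ x, ‖F i x‖ ∂μ)
    (hf : ∀ x, HasSum (F · x) (f x)) (hm : AEStronglyMeasurable f μ) : Integrable f μ := by
  refine ⟨hm, ?_⟩
  have h1 : ∀ i, ∫⁻ x, ‖F i x‖ₑ ∂μ = ENNReal.ofReal (∫ x, ‖F i x‖ ∂μ) := fun i =>
    (ofReal_integral_norm_eq_lintegral_enorm (hF i)).symm
  have h2 : ∀ x, ‖f x‖ₑ ≤ ∑' i, ‖F i x‖ₑ := by
    intro x
    rw [← (hf x).tsum_eq]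
    exact enorm_tsum_le_tsum_enorm
  calc ∫⁻ x, ‖f x‖ₑ ∂μ ≤ ∫⁻ x, ∑' i, ‖F i x‖ₑ ∂μ := lintegral_mono h2
    _ = ∑' i, ∫⁻ x, ‖F i x‖ₑ ∂μ := lintegral_tsum fun i => (hF i).1.enorm
    _ = ∑' i, ENNReal.ofReal (∫ x, ‖F i x‖ ∂μ) := by simp only [h1]
    _ = ENNReal.ofReal (∑' i, ∫ x, ‖F i x‖ ∂μ) :=
      (ENNReal.ofReal_tsum_of_nonneg (fun i => integral_nonneg fun x => norm_nonneg _) hs).symm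
    _ < ⊤ := ENNReal.ofReal_lt_top

variable {t : ℝ}

theorem integral_exp_mul_gaussian (ht : 0 ≤ t) (b : ℝ) :
    ∫ y : ℝ, Real.exp (b * y) ∂(gaussianReal 0 t.toNNReal) = Real.exp (t * b ^ 2 / 2) := by
  have h := congrFun (mgf_fun_id_gaussianReal (μ := 0) (v := t.toNNReal)) b
  rw [mgf] at h
  rw [h, Real.coe_toNNReal t ht, zero_mul, zero_add]

/-- Termwise Gaussian integration of a series of real exponentials. -/
theorem integrable_and_hasSum_gaussian {ι : Type*} [Countable ι] (ht : 0 ≤ t) {c : ι → ℂ}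
    {b : ι → ℝ} {f : ℝ → ℂ} (hf : ∀ y : ℝ, HasSum (fun i => c i * cexp (b i * y)) (f y))
    (hm : Continuous f) (hs : Summable fun i => c i * cexp (t * b i ^ 2 / 2)) :
    Integrable f (gaussianReal 0 t.toNNReal) ∧
      HasSum (fun i => c i * cexp (t * b i ^ 2 / 2)) (∫ y, f y ∂(gaussianReal 0 t.toNNReal)) := by
  have e : ∀ i (y : ℝ), c i * cexp (b i * y) = c i * ((Real.exp (b i * y) : ℝ) : ℂ) :=
    fun i y => by push_cast; rfl
  have hF : ∀ i, Integrable (fun y : ℝ => c i * cexp (b i * y)) (gaussianReal 0 t.toNNReal) := by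
    intro i
    simp only [e]
    exact ((integrable_exp_mul_gaussianReal (b i)).ofReal).const_mul _
  have hI : ∀ i, ∫ y : ℝ, c i * cexp (b i * y) ∂(gaussianReal 0 t.toNNReal)
      = c i * cexp (t * b i ^ 2 / 2) := by
    intro i
    simp only [e]
    rw [integral_const_mul, integral_complex_ofReal, integral_exp_mul_gaussian ht]
    push_cast
    rfl
  have hN : ∀ i, ∫ y : ℝ, ‖c i * cexp (b i * y)‖ ∂(gaussianReal 0 t.toNNReal)
      = ‖c i * cexp (t * b i ^ 2 / 2)‖ := by
    intro i
    have e2 : cexp (t * b i ^ 2 / 2) = ((Real.exp (t * b i ^ 2 / 2) : ℝ) : ℂ) := by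
      push_cast; rfl
    simp only [e, e2, norm_mul, Complex.norm_real, Real.norm_eq_abs, Real.abs_exp]
    rw [integral_const_mul, integral_exp_mul_gaussian ht]
  have hs' : Summable fun i => ∫ y : ℝ, ‖c i * cexp (b i * y)‖ ∂(gaussianReal 0 t.toNNReal) := by
    simp only [hN]
    exact hs.norm
  refine ⟨integrable_of_hasSum_of_summable_integral_norm hF hs' hf hm.aestronglyMeasurable, ?_⟩
  have h := hasSum_integral_of_summable_integral_norm hF hs'
  simp only [hI, fun y => (hf y).tsum_eq] at h
  exact h

theorem hasSum_theta1 {τ : ℂ} (hτ : 0 < τ.im) (v : ℂ) :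
    HasSum (fun n : ℤ => I * ((-1 : ℂ) ^ n * cexp (π * I * τ * ((n : ℂ) - 1 / 2) ^ 2)
      * cexp (π * I * v * (2 * (n : ℂ) - 1)))) (theta1 v τ) := by
  have h := ((summable_jacobiTheta₂_term_iff (v + 1 / 2 - τ / 2) τ).mpr hτ).mul_left
    (cexp (π * I * τ / 4 - π * I * v))
  have h2 : Summable fun n : ℤ => (-1 : ℂ) ^ n * cexp (π * I * τ * ((n : ℂ) - 1 / 2) ^ 2)
      * cexp (π * I * v * (2 * (n : ℂ) - 1)) := by
    refine h.congr fun n => ?_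
    rw [jacobiTheta₂_term, neg_one_zpow_eq_exp, ← Complex.exp_add, ← Complex.exp_add,
      ← Complex.exp_add]
    ring_nf
  exact h2.hasSum.mul_left I

/-- The heat flow acts on a theta wave by decreasing the modulus: the Fourier mode of frequency
`K / r`, with `K = J + n (k - 1 / 2)`, gains the factor `e^{t K² / 2r²}`, and
`K² - J² = n² (k - 1 / 2)² + 2 J n (k - 1 / 2)` is the exponent of the nome in the series. -/
theorem integral_thetaWave_gaussian {n r tstar b : ℝ} (hn : 0 < n) (hr : 0 < r) (ht : 0 ≤ t)
    (hts : t < tstar) (hb : b ^ 2 = 1) (J x : ℝ) (α : ℂ) :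
    Integrable (fun y : ℝ => thetaWave J n r α (I * n * (tstar - (0 : ℝ)) / (2 * π * r ^ 2))
      (b * (x + I * y))) (gaussianReal 0 t.toNNReal) ∧
    ∫ y : ℝ, thetaWave J n r α (I * n * (tstar - (0 : ℝ)) / (2 * π * r ^ 2)) (b * (x + I * y))
      ∂(gaussianReal 0 t.toNNReal)
      = cexp (t * J ^ 2 / (2 * r ^ 2))
        * thetaWave J n r α (I * n * (tstar - t) / (2 * π * r ^ 2)) (b * x) := by
  have hpi : (π : ℂ) ≠ 0 := Complex.ofReal_ne_zero.mpr Real.pi_ne_zero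
  have hr' : (r : ℂ) ≠ 0 := Complex.ofReal_ne_zero.mpr hr.ne'
  have him : ∀ u : ℝ, u < tstar → 0 < ((n : ℂ) * (I * n * (tstar - u) / (2 * π * r ^ 2))).im := by
    intro u hu
    have h1 : (n : ℂ) * (I * n * (tstar - u) / (2 * π * r ^ 2))
        = I * ((n ^ 2 * (tstar - u) / (2 * π * r ^ 2) : ℝ) : ℂ) := by push_cast; ring
    rw [h1, Complex.I_mul_im, Complex.ofReal_re]
    have := sub_pos.mpr hu
    positivity
  have hser : ∀ u : ℝ, u < tstar → ∀ z : ℂ, _ := fun u hu z =>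
    (hasSum_theta1 (him u hu) ((J : ℂ) * (I * n * (tstar - u) / (2 * π * r ^ 2))
      + n * z / (2 * π * r) + α)).mul_left (cexp (I * J * z / r))
  have h0 := him 0 (by linarith)
  have key := integrable_and_hasSum_gaussian ht
    (f := fun y : ℝ => thetaWave J n r α (I * n * (tstar - (0 : ℝ)) / (2 * π * r ^ 2))
      (b * (x + I * y)))
    (b := fun k : ℤ => -(b * (J + n * (k - 1 / 2)) / r))
    (c := fun k : ℤ => cexp (I * J * (b * x) / r) * (I * ((-1 : ℂ) ^ k
      * cexp (π * I * (n * (I * n * (tstar - (0 : ℝ)) / (2 * π * r ^ 2))) * ((k : ℂ) - 1 / 2) ^ 2)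
      * cexp (π * I * (J * (I * n * (tstar - (0 : ℝ)) / (2 * π * r ^ 2)) + n * (b * x) / (2 * π * r)
        + α) * (2 * (k : ℂ) - 1)))))
  have hflow : ∀ k : ℤ, cexp (I * J * (b * x) / r) * (I * ((-1 : ℂ) ^ k
      * cexp (π * I * (n * (I * n * (tstar - (0 : ℝ)) / (2 * π * r ^ 2))) * ((k : ℂ) - 1 / 2) ^ 2)
      * cexp (π * I * (J * (I * n * (tstar - (0 : ℝ)) / (2 * π * r ^ 2)) + n * (b * x) / (2 * π * r)
        + α) * (2 * (k : ℂ) - 1))))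
      * cexp (t * ((-(b * (J + n * (k - 1 / 2)) / r) : ℝ) : ℂ) ^ 2 / 2)
      = cexp (t * J ^ 2 / (2 * r ^ 2)) * (cexp (I * J * (b * x) / r) * (I * ((-1 : ℂ) ^ k
      * cexp (π * I * (n * (I * n * (tstar - t) / (2 * π * r ^ 2))) * ((k : ℂ) - 1 / 2) ^ 2)
      * cexp (π * I * (J * (I * n * (tstar - t) / (2 * π * r ^ 2)) + n * (b * x) / (2 * π * r)
        + α) * (2 * (k : ℂ) - 1))))) := by
    intro k
    have hb' : (b : ℂ) ^ 2 = 1 := by exact_mod_cast hb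
    have e : cexp (π * I * (n * (I * n * (tstar - (0 : ℝ)) / (2 * π * r ^ 2)))
          * ((k : ℂ) - 1 / 2) ^ 2)
        * cexp (π * I * (J * (I * n * (tstar - (0 : ℝ)) / (2 * π * r ^ 2))
          + n * (b * x) / (2 * π * r) + α) * (2 * (k : ℂ) - 1))
        * cexp (t * ((-(b * (J + n * (k - 1 / 2)) / r) : ℝ) : ℂ) ^ 2 / 2)
        = cexp (t * J ^ 2 / (2 * r ^ 2))
        * (cexp (π * I * (n * (I * n * (tstar - t) / (2 * π * r ^ 2))) * ((k : ℂ) - 1 / 2) ^ 2)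
        * cexp (π * I * (J * (I * n * (tstar - t) / (2 * π * r ^ 2)) + n * (b * x) / (2 * π * r)
          + α) * (2 * (k : ℂ) - 1))) := by
      rw [← Complex.exp_add, ← Complex.exp_add, ← Complex.exp_add, ← Complex.exp_add]
      congr 1
      push_cast
      rw [neg_sq, div_pow, mul_pow, hb', one_mul]
      field_simp
      ring_nf
      rw [I_sq]
      ring
    linear_combination (cexp (I * J * (b * x) / r) * I * (-1 : ℂ) ^ k) * e
  -- The averaged series is a multiple of the series at the modulus `τ(t)`, which gives both its
  -- summability and its value.
  have hst := (hser t hts (b * x)).mul_left (cexp (t * J ^ 2 / (2 * r ^ 2)))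
  simp only [hflow] at key
  have key2 := key (fun y => ?_) ?_ hst.summable
  · exact ⟨key2.1, key2.2.unique hst⟩
  · refine Eq.mp (congrArg (fun g => HasSum g _) (funext fun k => ?_))
      (hser 0 (by linarith) (b * (x + I * y)))
    have e : cexp (I * J * (b * (x + I * y)) / r)
        * cexp (π * I * (J * (I * n * (tstar - (0 : ℝ)) / (2 * π * r ^ 2))
          + n * (b * (x + I * y)) / (2 * π * r) + α) * (2 * (k : ℂ) - 1))
        = cexp (I * J * (b * x) / r)
        * cexp (π * I * (J * (I * n * (tstar - (0 : ℝ)) / (2 * π * r ^ 2))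
          + n * (b * x) / (2 * π * r) + α) * (2 * (k : ℂ) - 1))
        * cexp (((-(b * (J + n * (k - 1 / 2)) / r) : ℝ) : ℂ) * y) := by
      rw [← Complex.exp_add, ← Complex.exp_add, ← Complex.exp_add]
      congr 1
      push_cast
      field_simp
      ring_nf
      rw [I_sq]
      ring
    linear_combination (I * (-1 : ℂ) ^ k
      * cexp (π * I * (n * (I * n * (tstar - (0 : ℝ)) / (2 * π * r ^ 2)))
        * ((k : ℂ) - 1 / 2) ^ 2)) * e
  · unfold thetaWave
    have hd := (differentiable_theta1 h0).continuous
    have hd2 := hd.comp (f := fun y : ℝ => (J : ℂ) * (I * n * (tstar - (0 : ℝ)) / (2 * π * r ^ 2))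
      + n * (b * (x + I * y)) / (2 * π * r) + α) (by fun_prop)
    exact Continuous.mul (by fun_prop) hd2

end

section

open MeasureTheory ProbabilityTheory

theorem calN_pos (R : RootFamily) {N : ℕ} (hN : 2 ≤ N) : 0 < calN R N := by
  have : (2 : ℝ) ≤ N := by exact_mod_cast hN
  cases R <;> simp only [calN] <;> linarith

theorem integral_f0_gaussian (R : RootFamily) {N : ℕ} (hN : 2 ≤ N) {r tstar t : ℝ} (hr : 0 < r)
    (ht : 0 ≤ t) (hts : t < tstar) (j : ℤ) (x : ℝ) :
    Integrable (fun y : ℝ => f0 R N r tstar j (x + I * y)) (gaussianReal 0 t.toNNReal) ∧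
    ∫ y : ℝ, f0 R N r tstar j (x + I * y) ∂(gaussianReal 0 t.toNNReal)
      = cexp (t * (J R j) ^ 2 / (2 * r ^ 2)) * f R N r j x (tau R N r tstar t) := by
  have h1 := fun α => integral_thetaWave_gaussian (calN_pos R hN) hr ht hts
    (b := 1) (by norm_num) (J R j) x α
  have h2 := fun α => integral_thetaWave_gaussian (calN_pos R hN) hr ht hts
    (b := -1) (by norm_num) (J R j) x α
  simp only [Complex.ofReal_neg, Complex.ofReal_one, one_mul, neg_one_mul] at h1 h2
  cases R
  · exact h1 _
  all_goals simp only [f0, f, tau]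
  · exact ⟨(h1 _).1.sub (h2 _).1, by rw [integral_sub (h1 _).1 (h2 _).1, (h1 _).2, (h2 _).2]; ring⟩
  · exact ⟨(h1 _).1.sub (h2 _).1, by rw [integral_sub (h1 _).1 (h2 _).1, (h1 _).2, (h2 _).2]; ring⟩
  · exact ⟨(h1 _).1.sub (h2 _).1, by rw [integral_sub (h1 _).1 (h2 _).1, (h1 _).2, (h2 _).2]; ring⟩
  · exact ⟨(h1 _).1.sub (h2 _).1, by rw [integral_sub (h1 _).1 (h2 _).1, (h1 _).2, (h2 _).2]; ring⟩
  · exact ⟨(h1 _).1.sub (h2 _).1, by rw [integral_sub (h1 _).1 (h2 _).1, (h1 _).2, (h2 _).2]; ring⟩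
  · exact ⟨(h1 _).1.add (h2 _).1, by rw [integral_add (h1 _).1 (h2 _).1, (h1 _).2, (h2 _).2]; ring⟩

/-! ### The determinantal martingale-function as a quotient of determinants -/

section

variable {N : ℕ} {F : ℤ → ℂ → ℂ} {u : Fin N → ℝ}

/-- Cramer's rule. -/
theorem Phi_eq_sum (hu : (fMatrix F (fun m => (u m : ℂ))).det ≠ 0) (j : Fin N) (z : ℂ) :
    Phi F u j z = ∑ l : Fin N, (fMatrix F (fun m => (u m : ℂ)))⁻¹ j l * F ((l : ℤ) + 1) z := by
  have h : fMatrix F (Function.update (fun m => (u m : ℂ)) j z)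
      = (fMatrix F (fun m => (u m : ℂ))).updateCol j (fun l => F ((l : ℤ) + 1) z) := by
    ext l m
    rw [Matrix.updateCol_apply]
    simp only [fMatrix, Matrix.of_apply, Function.update_apply]
    split_ifs <;> rfl
  rw [Phi, h, ← Matrix.cramer_apply, Matrix.cramer_eq_adjugate_mulVec, Matrix.mulVec,
    dotProduct, Finset.sum_div]
  refine Finset.sum_congr rfl fun l _ => ?_
  rw [Matrix.inv_def, Ring.inverse_eq_inv', Matrix.smul_apply, smul_eq_mul]
  field_simp

variable {t : ℝ}

theorem integrable_Phi (hint : ∀ (l : Fin N) (x : ℝ),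
      Integrable (fun y : ℝ => F ((l : ℤ) + 1) (x + I * y)) (gaussianReal 0 t.toNNReal))
    (hu : (fMatrix F (fun m => (u m : ℂ))).det ≠ 0) (j : Fin N) (x : ℝ) :
    Integrable (fun y : ℝ => Phi F u j (x + I * y)) (gaussianReal 0 t.toNNReal) := by
  simp only [Phi_eq_sum hu]
  exact integrable_finsetSum _ fun l _ => (hint l x).const_mul _

theorem detMart_eq (hint : ∀ (l : Fin N) (x : ℝ),
      Integrable (fun y : ℝ => F ((l : ℤ) + 1) (x + I * y)) (gaussianReal 0 t.toNNReal))
    (hu : (fMatrix F (fun m => (u m : ℂ))).det ≠ 0) (x : Fin N → ℝ) :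
    detMart F u t x = (Matrix.of fun l k : Fin N =>
      ∫ y : ℝ, F ((l : ℤ) + 1) (x k + I * y) ∂(gaussianReal 0 t.toNNReal)).det
        / (fMatrix F (fun m => (u m : ℂ))).det := by
  have h : (Matrix.of fun j k : Fin N => M F u j t (x k))
      = (fMatrix F (fun m => (u m : ℂ)))⁻¹ * Matrix.of fun l k : Fin N =>
      ∫ y : ℝ, F ((l : ℤ) + 1) (x k + I * y) ∂(gaussianReal 0 t.toNNReal) := by
    ext j k
    simp only [Matrix.of_apply, Matrix.mul_apply, M, Phi_eq_sum hu]
    rw [integral_finsetSum _ fun l _ => (hint l (x k)).const_mul _]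
    exact Finset.sum_congr rfl fun l _ => integral_const_mul _ _
  rw [detMart, h, Matrix.det_mul, Matrix.det_nonsing_inv, Ring.inverse_eq_inv']
  ring

end

end

/-! ### The factorization -/

theorem tau_eq (R : RootFamily) (N : ℕ) (r tstar t : ℝ) :
    tau R N r tstar t = I * ((calN R N * (tstar - t) / (2 * π * r ^ 2) : ℝ) : ℂ) := by
  unfold tau
  push_cast
  ring

theorem eta_ne_zero {y : ℝ} (hy : 0 < y) : ModularForm.eta (I * y) ≠ 0 := by
  rw [eta_eq_exp hy]
  exact Complex.ofReal_ne_zero.mpr (Real.exp_ne_zero _)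

theorem c0_ne_zero (R : RootFamily) (N : ℕ) {s : ℝ} (hs : 0 < s) : c0 R N (I * s) ≠ 0 := by
  have h1 := eta_ne_zero hs
  have h2 : ModularForm.eta (2 * (I * s)) ≠ 0 := by
    rw [I_mul_two_mul]; exact eta_ne_zero (by positivity)
  have h3 : ModularForm.eta (I * s / 2) ≠ 0 := by
    rw [I_mul_div_two]; exact eta_ne_zero (by positivity)
  cases R <;> simp only [c0, ne_eq, mul_eq_zero, not_or] <;>
    first
    | exact zpow_ne_zero _ h1
    | exact ⟨zpow_ne_zero _ h1, zpow_ne_zero _ h2⟩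
    | exact ⟨zpow_ne_zero _ h1, zpow_ne_zero _ h3⟩

theorem theta1_ne_zero {y v : ℝ} (hy : 0 < y) (h0 : 0 < v) (h1 : v < 1) :
    theta1 v (I * y) ≠ 0 := by
  rw [theta1_eq_exp hy]
  exact mul_ne_zero (mul_ne_zero two_ne_zero
    (by exact_mod_cast sin_pi_mul_ne_zero h0 h1))
    (Complex.ofReal_ne_zero.mpr (Real.exp_ne_zero _))

theorem theta0_ne_zero {y : ℝ} (hy : 0 < y) (v : ℝ) : theta0 v (I * y) ≠ 0 := by
  rw [theta0_eq_exp hy]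
  exact Complex.ofReal_ne_zero.mpr (Real.exp_ne_zero _)

theorem k1_ne_zero (R : RootFamily) {r x s : ℝ} (hr : 0 < r) (hs : 0 < s) (h0 : 0 < x)
    (h1 : x < π * r) : k1 R r x (I * s) ≠ 0 := by
  have hpi := Real.pi_pos
  have e1 : 0 < x / (2 * π * r) := by positivity
  have e2 : x / (2 * π * r) < 1 := by rw [div_lt_one (by positivity)]; nlinarith
  have e3 : 0 < x / (π * r) := by positivity
  have e4 : x / (π * r) < 1 := by rwa [div_lt_one (by positivity)]
  cases R <;> simp only [k1, I_mul_two_mul, I_mul_div_two]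
  · exact one_ne_zero
  · exact theta1_ne_zero hs e1 e2
  · exact theta1_ne_zero (by positivity) e3 e4
  · exact theta1_ne_zero hs e3 e4
  · exact theta1_ne_zero (by positivity) e1 e2
  · exact mul_ne_zero (theta1_ne_zero hs e1 e2) (theta0_ne_zero (by positivity) _)
  · exact one_ne_zero

theorem k2_ne_zero (R : RootFamily) {r x y s : ℝ} (hr : 0 < r) (hs : 0 < s) (h0 : 0 < y)
    (hyx : y < x) (h1 : x < π * r) : k2 R r x y (I * s) ≠ 0 := by
  have hpi := Real.pi_pos
  have e1 : 0 < (x - y) / (2 * π * r) := div_pos (by linarith) (by positivity)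
  have e2 : (x - y) / (2 * π * r) < 1 := by rw [div_lt_one (by positivity)]; nlinarith
  have e3 : 0 < (x + y) / (2 * π * r) := div_pos (by linarith) (by positivity)
  have e4 : (x + y) / (2 * π * r) < 1 := by rw [div_lt_one (by positivity)]; nlinarith
  have h2 := theta1_ne_zero hs e1 e2
  have h3 := theta1_ne_zero hs e3 e4
  cases R <;> simp only [k2] <;> first | exact h2 | exact mul_ne_zero h2 h3

section

variable {R : RootFamily} {N : ℕ} {r tstar t : ℝ}

theorem tau_pos (R : RootFamily) (hN : 2 ≤ N) (hr : 0 < r) (hts : t < tstar) :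
    0 < calN R N * (tstar - t) / (2 * π * r ^ 2) := by
  have h1 := calN_pos R hN
  have h2 := sub_pos.mpr hts
  have h3 := Real.pi_pos
  positivity

theorem det_f0_ne_zero_iff (hN : 2 ≤ N) (hr : 0 < r) (hts : 0 < tstar) (u : Fin N → ℝ) :
    (fMatrix (f0 R N r tstar) (fun m => (u m : ℂ))).det ≠ 0 ↔
      kSym R r u (tau R N r tstar 0) ≠ 0 ∧
      (∀ l, k1 R r (u l) (tau R N r tstar 0) ≠ 0) ∧
      (∀ j k, j < k → k2 R r (u k) (u j) (tau R N r tstar 0) ≠ 0) := by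
  obtain ⟨C, hC, h⟩ := detFormula R hN hr.ne'
  have hs := tau_pos R hN hr hts
  have h' := h _ hs u
  have hc := c0_ne_zero R N hs
  rw [← tau_eq] at h' hc
  have e : (fMatrix (f0 R N r tstar) (fun m => (u m : ℂ))).det ≠ 0 ↔
      (fMatrix (f0 R N r tstar) (fun m => (u m : ℂ))).det
      * cexp (∑ l : Fin N, π * I * tau R N r tstar 0 * (J R ((l : ℤ) + 1)) ^ 2 / calN R N) ≠ 0 := by
    rw [ne_eq, ne_eq, mul_eq_zero, or_iff_left (Complex.exp_ne_zero _)]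
  rw [e]
  refine Iff.trans (not_congr (Eq.congr_left h')) ?_
  simp only [mul_eq_zero, not_or, hC, hc, Finset.prod_eq_zero_iff, Finset.mem_univ,
    Finset.mem_Ioi, true_and, not_false_eq_true, not_exists, and_assoc]
  refine and_congr_right fun _ => and_congr_right fun _ => ?_
  exact forall_congr' fun j => forall_congr' fun k => not_and

theorem det_f0_ne_zero (hR : R ≠ .A) (hN : 2 ≤ N) (hr : 0 < r) (hts : 0 < tstar)
    {u : Fin N → ℝ} (hu : u ∈ weylAlcove N r) :
    (fMatrix (f0 R N r tstar) (fun m => (u m : ℂ))).det ≠ 0 := by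
  rw [det_f0_ne_zero_iff hN hr hts, tau_eq]
  have hs := tau_pos R hN hr hts
  refine ⟨?_, fun l => k1_ne_zero R hr hs (hu.2 l).1 (hu.2 l).2, fun j k hjk =>
    k2_ne_zero R hr hs (hu.2 j).1 (hu.1 hjk) (hu.2 k).2⟩
  cases R <;> first | exact absurd rfl hR | exact one_ne_zero

theorem DR_eq (hN : 2 ≤ N) (hr : 0 < r) {u : Fin N → ℝ}
    (hu : (fMatrix (f0 R N r tstar) (fun m => (u m : ℂ))).det ≠ 0) (ht : 0 ≤ t)
    (hts : t < tstar) (x : Fin N → ℝ) :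
    DR R r tstar u t x =
      c0 R N (tau R N r tstar t) / c0 R N (tau R N r tstar 0)
        * (kSym R r x (tau R N r tstar t) / kSym R r u (tau R N r tstar 0))
        * (∏ l, k1 R r (x l) (tau R N r tstar t) / k1 R r (u l) (tau R N r tstar 0))
        * (∏ j : Fin N, ∏ k ∈ Finset.Ioi j,
            k2 R r (x k) (x j) (tau R N r tstar t)
              / k2 R r (u k) (u j) (tau R N r tstar 0)) := by
  obtain ⟨C, hC, h⟩ := detFormula R hN hr.ne'
  have hx := h _ (tau_pos R hN hr hts) x
  have hu' := h _ (tau_pos R hN hr (ht.trans_lt hts)) u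
  rw [← tau_eq] at hx hu'
  have hI := integral_f0_gaussian R hN hr ht hts
  have hdet : (Matrix.of fun l k : Fin N => ∫ y : ℝ, f0 R N r tstar ((l : ℤ) + 1) (x k + I * y)
        ∂(ProbabilityTheory.gaussianReal 0 t.toNNReal)).det
      = cexp (∑ l : Fin N, t * (J R ((l : ℤ) + 1)) ^ 2 / (2 * r ^ 2))
        * (fMatrix (fun j z => f R N r j z (tau R N r tstar t)) (fun m => (x m : ℂ))).det := by
    rw [Complex.exp_sum, ← Matrix.det_mul_column]
    congr 1
    ext l k
    exact (hI _ _).2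
  have hexp : cexp (∑ l : Fin N, t * (J R ((l : ℤ) + 1)) ^ 2 / (2 * r ^ 2))
      * cexp (∑ l : Fin N, π * I * tau R N r tstar 0 * (J R ((l : ℤ) + 1)) ^ 2 / calN R N)
      = cexp (∑ l : Fin N, π * I * tau R N r tstar t * (J R ((l : ℤ) + 1)) ^ 2 / calN R N) := by
    rw [← Complex.exp_add, ← Finset.sum_add_distrib]
    congr 1
    refine Finset.sum_congr rfl fun l _ => ?_
    have h1 : (calN R N : ℂ) ≠ 0 := Complex.ofReal_ne_zero.mpr (calN_pos R hN).ne'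
    have h2 : (π : ℂ) ≠ 0 := Complex.ofReal_ne_zero.mpr Real.pi_ne_zero
    have h3 : (r : ℂ) ≠ 0 := Complex.ofReal_ne_zero.mpr hr.ne'
    unfold tau
    push_cast
    field_simp
    rw [I_sq]
    ring
  have hE := Complex.exp_ne_zero
    (∑ l : Fin N, π * I * tau R N r tstar 0 * (J R ((l : ℤ) + 1)) ^ 2 / calN R N)
  rw [DR, detMart_eq (fun l x => (hI _ x).1) hu, hdet]
  simp only [Finset.prod_div_distrib]
  -- Both sides of the quotient are completed to the two sides of the determinant formula.
  rw [div_mul_div_comm, div_mul_div_comm, div_mul_div_comm,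
    ← mul_div_mul_left _ (_ * _ * _ * _) hC, ← hx, ← hu', ← hexp,
    ← mul_div_mul_right _ _ hE]
  congr 1
  ring

end

end EllipticDyson

theorem proposition2p6 (N : ℕ) (hN : 2 ≤ N) (r tstar : ℝ) (hr : 0 < r) (hts : 0 < tstar) :
    -- both sides of the factorization are defined for exactly the same `u`
    (∀ (R : RootFamily) (u : Fin N → ℝ), u ∈ weylChamber N →
      c0 R N (tau R N r tstar 0) ≠ 0 ∧
      ((fMatrix (f0 R N r tstar) (fun m => (u m : ℂ))).det ≠ 0 ↔
        kSym R r u (tau R N r tstar 0) ≠ 0 ∧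
        (∀ l, k1 R r (u l) (tau R N r tstar 0) ≠ 0) ∧
        (∀ j k, j < k → k2 R r (u k) (u j) (tau R N r tstar 0) ≠ 0))) ∧
    -- and, except for the family `A`, for all `0 < u_1 < ⋯ < u_N < π r`
    (∀ (R : RootFamily) (u : Fin N → ℝ), R ≠ RootFamily.A → u ∈ weylAlcove N r →
      (fMatrix (f0 R N r tstar) (fun m => (u m : ℂ))).det ≠ 0) ∧
    -- the factorization for all seven families, and its explicit forms
    (∀ (R : RootFamily) (u : Fin N → ℝ), u ∈ weylChamber N →
      (fMatrix (f0 R N r tstar) (fun m => (u m : ℂ))).det ≠ 0 →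
      ∀ (t : ℝ), 0 ≤ t → t < tstar → ∀ x : Fin N → ℝ,
        (∀ j k : Fin N, MeasureTheory.Integrable
          (fun y : ℝ => Phi (f0 R N r tstar) u j ((x k : ℂ) + Complex.I * (y : ℂ)))
          (ProbabilityTheory.gaussianReal 0 t.toNNReal)) ∧
        DR R r tstar u t x =
          c0 R N (tau R N r tstar t) / c0 R N (tau R N r tstar 0)
            * (kSym R r x (tau R N r tstar t) / kSym R r u (tau R N r tstar 0))
            * (∏ l, k1 R r (x l) (tau R N r tstar t) / k1 R r (u l) (tau R N r tstar 0))
            * (∏ j : Fin N, ∏ k ∈ Finset.Ioi j,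
                k2 R r (x k) (x j) (tau R N r tstar t)
                  / k2 R r (u k) (u j) (tau R N r tstar 0)) ∧
        ((R = RootFamily.B ∨ R = RootFamily.Bv ∨ R = RootFamily.C ∨ R = RootFamily.Cv) →
          DR R r tstar u t x =
            c0 R N (tau R N r tstar t) / c0 R N (tau R N r tstar 0)
              * (∏ l, theta1 ((c1 R * x l / (2 * Real.pi * r) : ℝ) : ℂ)
                    ((c2 R : ℂ) * tau R N r tstar t)
                  / theta1 ((c1 R * u l / (2 * Real.pi * r) : ℝ) : ℂ)
                    ((c2 R : ℂ) * tau R N r tstar 0))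
              * pairProd r u x (tau R N r tstar 0) (tau R N r tstar t)) ∧
        (R = RootFamily.BC →
          DR R r tstar u t x =
            c0 R N (tau R N r tstar t) / c0 R N (tau R N r tstar 0)
              * (∏ l, theta1 ((x l / (2 * Real.pi * r) : ℝ) : ℂ) (tau R N r tstar t)
                    / theta1 ((u l / (2 * Real.pi * r) : ℝ) : ℂ) (tau R N r tstar 0)
                  * (theta0 ((x l / (Real.pi * r) : ℝ) : ℂ) (2 * tau R N r tstar t)
                    / theta0 ((u l / (Real.pi * r) : ℝ) : ℂ) (2 * tau R N r tstar 0)))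
              * pairProd r u x (tau R N r tstar 0) (tau R N r tstar t)) ∧
        (R = RootFamily.D →
          DR R r tstar u t x =
            c0 R N (tau R N r tstar t) / c0 R N (tau R N r tstar 0)
              * pairProd r u x (tau R N r tstar 0) (tau R N r tstar t))) := by
  refine ⟨fun R u _ => ⟨?_, det_f0_ne_zero_iff hN hr hts u⟩,
    fun R u hR hu => det_f0_ne_zero hR hN hr hts hu, fun R u _ hu t ht htt x => ?_⟩
  · rw [tau_eq]
    exact c0_ne_zero R N (tau_pos R hN hr hts)
  have h := DR_eq hN hr hu ht htt x
  refine ⟨fun j k => integrable_Phi (fun l x => (integral_f0_gaussian R hN hr ht htt _ x).1) hu j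
    (x k), h, fun hR => ?_, fun hR => ?_, fun hR => ?_⟩
  · have hc1 : ∀ b : ℝ, 2 * b / (2 * Real.pi * r) = b / (Real.pi * r) := fun b => by
      rw [mul_assoc, mul_div_mul_left _ _ two_ne_zero]
    have hc2 : ∀ τ : ℂ, ((1 / 2 : ℝ) : ℂ) * τ = τ / 2 := fun τ => by push_cast; ring
    rw [h]
    rcases hR with rfl | rfl | rfl | rfl <;>
      simp only [kSym, k1, k2, pairProd, c1, c2, hc1, hc2, div_one, one_mul, mul_one,
        Complex.ofReal_one, Complex.ofReal_ofNat, mul_div_mul_comm]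
  · subst hR
    rw [h]
    simp only [kSym, k1, k2, pairProd, div_one, mul_one, mul_div_mul_comm]
  · subst hR
    rw [h]
    simp only [kSym, k1, k2, pairProd, div_one, mul_one, Finset.prod_const_one, mul_div_mul_comm]
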